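/- **Definitions.** Let $G=(V,E)$ be a finite simple graph, write $\mathrm{vol}(S)$ for the sum of the degrees of the vertices of $S\subseteq V$, and let $\Phi_G(S)=|E(S,V\setminus S)|/\min\{\mathrm{vol}(S),\mathrm{vol}(V\setminus S)\}$. For $C\subseteq V$ and $\emptyset\ne S\subsetneq C$ let $\Phi_{G\{C\}}(S)=|E(S,C\setminus S)|/\min\{\mathrm{vol}(S),\mathrm{vol}(C\setminus S)\}$, with volumes measured by degrees in $G$. A partition of $V$ into non-empty sets $C_1,\dots,C_k$ is a $(k,\epsilon,\phi)$-clustering of $G$ if for every $i$ one has $\Phi_G(C_i)\le\epsilon$, and $\Phi_{G\{C_i\}}(S)\ge\phi$ for all $\emptyset\neq S\subsetneq C_i$. **Setting.** Let $d\ge 3$, $k\ge 2$, $\epsilon,\phi,\delta\in(0,1)$, $\eta\ge 1$, with $\phi,\eta$ rational. Let $G=(V,E)$ be a $d$-regular simple graph on $n$ vertices, $C_1,\dots,C_k$ a $(k,\epsilon,\phi)$-clustering of $G$ with $|C_i|\le\eta|C_j|$ for all $i,j$, and $\iota(u)$ the index with $u\in C_{\iota(u)}$. For every $u\in V$ let $p(u)$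 be a probability distribution on $[k]$ that gives probability at least $1-\delta$ to $\iota(u)$, and let the noisy labels $\sigma(u)\sim p(u)$ be independent over $u \in V$. Assume $$\frac{\epsilon}{\phi^6}\le\frac1{10^5\eta^4},\qquad \phi^2\eta<\frac1{10^3},\qquad k\log k\le\frac{\phi^6}{10^9\eta^4\epsilon},\qquad \delta d\le\frac1{100},\qquad \min_i|C_i|\ge\log k .$$ **Theorem.** There is a randomized algorithm that takes as input a graph $G$, the numbers $\phi,k,\eta$ ($\phi,\eta$ rational, written in binary) and a labeling $\sigma:V\to[k]$, runs in time polynomial in the bit length of the input (for every input and every outcome of its random bits), always outputs a labeling $\alpha:V\to[k]$, and has the following property. For every $\eta_0$ there is a constant $C$, depending only on $\eta_0$, such that in every setting as above with $\eta\le\eta_0$, $$|\{u\in V:\ \alpha(u)\ne\iota(u)\}|\le C\cdot\frac{d\,\delta\,\epsilon}{\phi^5}\cdot n$$ with probability at least $0.9$ over the random bits of the algorithm and the draw of $\sigma$. -/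

import Mathlib

namespace NoisyClustering

/-! ## A programming language with a bit-cost semantics

First-order functional programs over integers, pairs and lists.  All programs terminate: the only
ways to repeat a computation are `fold` (once per list entry) and `loop` (a given number of times).
Each evaluation step is charged `1 +` the bit length of its argument `+` the bit length of its
result, so a program of cost `t` can be run by a Turing machine in time polynomial in `t`, and every
function that is computable in polynomial time has a program of polynomial cost. -/

/-- Types of data. -/
inductive Ty : Type
  | int : Ty
  | prod : Ty → Ty → Ty
  | list : Ty → Ty

/-- The values of a type of data. -/
@[reducible] def Ty.Val : Ty → Type
  | .int => ℤ
  | .prod a b => a.Val × b.Val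
  | .list a => List a.Val

/-- Bit length of a value (integers in binary, with a sign). -/
def Ty.size : (a : Ty) → a.Val → ℕ
  | .int, z => Nat.size (Int.natAbs z) + 1
  | .prod a b, x => a.size x.1 + b.size x.2 + 1
  | .list a, l => (l.map fun y => a.size y + 1).sum + 1

/-- `Prog a b`: programs that take a value of type `a` and return a value of type `b`. -/
inductive Prog : Ty → Ty → Type
  /-- return the argument -/
  | id {a : Ty} : Prog a a
  /-- run the second program, then the first one on its result -/
  | comp {a b c : Ty} : Prog b c → Prog a b → Prog a c
  /-- run both programs on the argument and return the pair of results -/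
  | pair {a b c : Ty} : Prog a b → Prog a c → Prog a (.prod b c)
  | fst {a b : Ty} : Prog (.prod a b) a
  | snd {a b : Ty} : Prog (.prod a b) b
  /-- an integer constant -/
  | const {a : Ty} : ℤ → Prog a .int
  | add : Prog (.prod .int .int) .int
  | sub : Prog (.prod .int .int) .int
  | mul : Prog (.prod .int .int) .int
  /-- integer division, with value `0` when the divisor is `0` -/
  | div : Prog (.prod .int .int) .int
  /-- `cond t f g`: if the value of `t` is positive run `f`, otherwise run `g` -/
  | cond {a b : Ty} : Prog a .int → Prog a b → Prog a b → Prog a b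
  /-- the empty list -/
  | nil {a b : Ty} : Prog a (.list b)
  | cons {a : Ty} : Prog (.prod a (.list a)) (.list a)
  /-- case distinction on a list: empty, or head and tail -/
  | caseList {a b c : Ty} : Prog a c → Prog (.prod a (.prod b (.list b))) c →
      Prog (.prod a (.list b)) c
  /-- update the state with each entry of the list in turn -/
  | fold {a b : Ty} : Prog (.prod b a) b → Prog (.prod b (.list a)) b
  /-- update the state as many times as the given integer says (never if it is negative) -/
  | loop {a : Ty} : Prog a a → Prog (.prod a .int) a

/-- The result of a program on an argument. -/
def Prog.eval : {a b : Ty} → Prog a b → a.Val → b.Val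
  | _, _, .id, x => x
  | _, _, .comp g f, x => g.eval (f.eval x)
  | _, _, .pair f g, x => (f.eval x, g.eval x)
  | _, _, .fst, x => x.1
  | _, _, .snd, x => x.2
  | _, _, .const z, _ => z
  | _, _, .add, x => (x.1 + x.2 : ℤ)
  | _, _, .sub, x => (x.1 - x.2 : ℤ)
  | _, _, .mul, x => (x.1 * x.2 : ℤ)
  | _, _, .div, x => (x.1 / x.2 : ℤ)
  | _, _, .cond t f g, x => if (0 : ℤ) < t.eval x then f.eval x else g.eval x
  | _, _, .nil, _ => []
  | _, _, .cons, x => x.1 :: x.2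
  | _, _, .caseList f g, x =>
      match x.2 with
      | [] => f.eval x.1
      | y :: l => g.eval (x.1, (y, l))
  | _, _, .fold f, x => x.2.foldl (fun s y => f.eval (s, y)) x.1
  | _, _, .loop f, x => f.eval^[Int.toNat x.2] x.1

/-- The charge for a single evaluation step. -/
def Prog.charge {a b : Ty} (p : Prog a b) (x : a.Val) : ℕ := 1 + a.size x + b.size (p.eval x)

/-- The running time of a program on an argument: the charge for the construct itself plus the
running times of all the subprograms that are run. -/
def Prog.cost : {a b : Ty} → Prog a b → a.Val → ℕ
  | _, _, .comp g f, x => (Prog.comp g f).charge x + f.cost x + g.cost (f.eval x)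
  | _, _, .pair f g, x => (Prog.pair f g).charge x + f.cost x + g.cost x
  | _, _, .cond t f g, x => (Prog.cond t f g).charge x + t.cost x +
      if (0 : ℤ) < t.eval x then f.cost x else g.cost x
  | _, _, .caseList f g, x => (Prog.caseList f g).charge x +
      match x.2 with
      | [] => f.cost x.1
      | y :: l => g.cost (x.1, (y, l))
  | _, _, .fold f, x => (Prog.fold f).charge x +
      (x.2.foldl (fun s y => (f.eval (s.1, y), s.2 + f.cost (s.1, y))) (x.1, 0)).2
  | _, _, .loop f, x => (Prog.loop f).charge x +
      ∑ i ∈ Finset.range (Int.toNat x.2), f.cost (f.eval^[i] x.1)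
  | _, _, .id, x => Prog.id.charge x
  | _, _, .fst, x => Prog.fst.charge x
  | _, _, .snd, x => Prog.snd.charge x
  | a, _, .const z, x => (Prog.const z : Prog a .int).charge x
  | _, _, .add, x => Prog.add.charge x
  | _, _, .sub, x => Prog.sub.charge x
  | _, _, .mul, x => Prog.mul.charge x
  | _, _, .div, x => Prog.div.charge x
  | a, .list b, .nil, x => (Prog.nil : Prog a (.list b)).charge x
  | _, _, .cons, x => Prog.cons.charge x

/-- A randomized algorithm: a program that receives, next to its input `x`, a string of random bits
whose length is a polynomial in the bit length of `x`. -/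
structure RandAlg (a b : Ty) where
  prog : Prog (.prod a (.list .int)) b
  tape : Polynomial ℕ

namespace RandAlg

variable {a b : Ty} (A : RandAlg a b)

/-- Number of random bits used on input `x`. -/
noncomputable def coins (x : a.Val) : ℕ := A.tape.eval (a.size x)

/-- Input `x` together with the random bits `r`, written as a list of zeros and ones. -/
def withCoins {m : ℕ} (x : a.Val) (r : Fin m → Bool) : (Ty.prod a (.list .int)).Val :=
  (x, List.ofFn fun i => if r i then (1 : ℤ) else 0)

/-- Output on input `x` and random bits `r`. -/
noncomputable def output (x : a.Val) (r : Fin (A.coins x) → Bool) : b.Val := A.prog.eval (withCoins x r)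

/-- Running time on input `x` and random bits `r`. -/
noncomputable def time (x : a.Val) (r : Fin (A.coins x) → Bool) : ℕ := A.prog.cost (withCoins x r)

open scoped Classical in
/-- Probability, over uniformly random bits, that the output on input `x` satisfies `P`. -/
noncomputable def prob (x : a.Val) (P : b.Val → Prop) : ℝ :=
  ((Finset.univ.filter fun r : Fin (A.coins x) → Bool => P (A.output x r)).card : ℝ) /
    2 ^ A.coins x

end RandAlg

/-! ## Conductance and clusterings -/

section Graph

variable {V : Type*} [Fintype V] [DecidableEq V] (G : SimpleGraph V)

open scoped Classical in
/-- Sum of the degrees in `G` of the vertices of `S`. -/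
noncomputable def vol (S : Finset V) : ℕ := ∑ v ∈ S, G.degree v

open scoped Classical in
/-- Conductance of `S ⊆ C` in the graph `G{C}`: the subgraph induced by `C`, with volumes measured
by the degrees in `G`. -/
noncomputable def conductanceIn (C S : Finset V) : ℝ :=
  ((G.interedges S (C \ S)).card : ℝ) / (min (vol G S) (vol G (C \ S)) : ℕ)

/-- Conductance of `S` in `G`. -/
noncomputable def conductance (S : Finset V) : ℝ := conductanceIn G Finset.univ S

/-- The cluster with label `i` of a labeling. -/
def cluster {k : ℕ} (ι : V → Fin k) (i : Fin k) : Finset V := Finset.univ.filter fun v => ι v = i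

/-- The clusters of the labeling `ι` form a `(k, ε, φ)`-clustering of `G`: all clusters are
non-empty, each has conductance at most `ε` in `G`, and each `G{C}` has conductance at least `φ`,
that is, so does every cut of `C` into two non-empty parts. -/
structure IsClustering {k : ℕ} (ι : V → Fin k) (ε φ : ℝ) : Prop where
  nonempty : ∀ i, (cluster ι i).Nonempty
  outer : ∀ i, conductance G (cluster ι i) ≤ ε
  inner : ∀ i, ∀ S ⊂ cluster ι i, S.Nonempty → φ ≤ conductanceIn G (cluster ι i) S

end Graph

/-! ## The input model -/

/-- Type of the encoded inputs: adjacency matrix, `φ`, `k`, `η` and the list of noisy labels.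
Rational numbers are pairs of numerator and denominator. -/
abbrev inputTy : Ty :=
  .prod (.list (.list .int)) (.prod (.prod .int .int) (.prod .int (.prod (.prod .int .int)
    (.list .int))))

/-- A labeling as a list of integers. -/
def encodeLabeling {n k : ℕ} (α : Fin n → Fin k) : (Ty.list .int).Val :=
  List.ofFn fun u => ((α u : ℕ) : ℤ)

open scoped Classical in
/-- The encoded input `G, φ, k, η, σ`. -/
noncomputable def encodeInput {n : ℕ} (G : SimpleGraph (Fin n)) (φ : ℚ) (k : ℕ) (η : ℚ)
    (σ : Fin n → Fin k) : inputTy.Val :=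
  (List.ofFn fun u => List.ofFn fun v => if G.Adj u v then (1 : ℤ) else 0,
    (φ.num, (φ.den : ℤ)), (k : ℤ), (η.num, (η.den : ℤ)), encodeLabeling σ)

open scoped Classical in
/-- The standing assumptions: `G` is a `d`-regular graph on `n` vertices, the clusters of the target
labeling `ι` form an `η`-balanced `(k, ε, φ)`-clustering of `G`, the noisy label of `u` has the law
`p u`, which gives probability at least `1 - δ` to the target label, and the parameters are in the
admissible range. -/
structure Setting {n d k : ℕ} (G : SimpleGraph (Fin n)) (φ η : ℚ) (ε δ : ℝ) (ι : Fin n → Fin k)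
    (p : Fin n → Fin k → ℝ) : Prop where
  three_le_d : 3 ≤ d
  regular : G.IsRegularOfDegree d
  two_le_k : 2 ≤ k
  phi_pos : 0 < φ
  phi_lt_one : φ < 1
  eps_pos : 0 < ε
  eps_lt_one : ε < 1
  delta_pos : 0 < δ
  delta_lt_one : δ < 1
  one_le_eta : 1 ≤ η
  clustering : IsClustering G ι ε φ
  balanced : ∀ i j, ((cluster ι i).card : ℝ) ≤ η * ((cluster ι j).card : ℝ)
  log_le_card : ∀ i, Real.log k ≤ (cluster ι i).card
  label_law : ∀ u, p u ∈ stdSimplex ℝ (Fin k)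
  label_correct : ∀ u, 1 - δ ≤ p u (ι u)
  eps_le : ε / (φ : ℝ) ^ 6 ≤ 1 / (10 ^ 5 * (η : ℝ) ^ 4)
  phi_sq_eta : (φ : ℝ) ^ 2 * η < 1 / 10 ^ 3
  k_log_k : (k : ℝ) * Real.log k ≤ (φ : ℝ) ^ 6 / (10 ^ 9 * (η : ℝ) ^ 4 * ε)
  delta_d : δ * d ≤ 1 / 100

/-- Number of vertices on which the labeling `α` differs from the target labeling `ι`. -/
def misclassified {n k : ℕ} (ι α : Fin n → Fin k) : ℕ :=
  (Finset.univ.filter fun u => α u ≠ ι u).card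

/-- Probability that the algorithm `A` outputs a labeling that misclassifies at most a
`γ`-fraction of the vertices, when the noisy labels `σ u` are drawn independently from the laws
`p u`, and independently of the random bits of `A`. -/
noncomputable def successProb {n k : ℕ} (A : RandAlg inputTy (.list .int))
    (G : SimpleGraph (Fin n)) (φ η : ℚ) (ι : Fin n → Fin k) (p : Fin n → Fin k → ℝ)
    (γ : ℝ) : ℝ :=
  ∑ σ : Fin n → Fin k, (∏ u, p u (σ u)) *
    A.prob (encodeInput G φ k η σ) fun out =>
      ∃ α : Fin n → Fin k, out = encodeLabeling α ∧ (misclassified ι α : ℝ) ≤ γ * n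

end NoisyClustering

namespace NoisyClustering

/-! ## Functions computable in polynomial time -/

/-! The algorithm needs no random bits. The proof combines a spectral estimate that does not involve
the labels with a first-moment estimate over the noise.

Spectral part. Let `M` be the random walk matrix. Cheeger's inequality inside each cluster
(`cheeger`, `Setting.walk_gap`) bounds the quadratic form of `M` by `1 - φ² / 2` on the unit vectors
orthogonal to all cluster indicators, so at most `k` eigenvalues are larger
(`card_large_eigenvalues`). The Rayleigh quotients of the indicators miss 1 by a total of at most `k
ε`. The map `x ↦ (x² + x³) / 2` sends `[-1, 1]` into `[0, 1]` and fixes 1; a power `s` of order `1 /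
φ²` brings the small eigenvalues below 1/10; iterating `y ↦ 3y² - 2y³` then drives them to 0 and
lowers no value in `[1/2, 1]`. The filtered matrix has squared Frobenius distance of order `s k ε`
to the projection onto the cluster indicators (`frobenius_specMat_sub`), up to a negligible rounding
error (`projRound_error`). Rows of that projection equal `1 / |C|` on the cluster `C` and 0
elsewhere. Thresholding the computed rows therefore recovers clusters up to one percent, except for
rows in a set `Z` of `O(η³ ε n / φ²)` vertices (`Setting.exists_badSet`). The set `Z` depends on the
graph only, hence is independent of the noise.

Noise part. By an exponential moment bound, with probability at least 19/20 no cluster has more than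
48 percent noisy labels (`Setting.noiseMean_crowded_le`), and then the majority label is correct
outside `Z`. Returning it would cost `|Z|` errors, without the factor `δ`. To gain this factor, let
`F` be the set where noisy and majority label differ and `B` the set of vertices with at least `φ d
/ 2` neighbours of another majority label; the noisy label is kept on the vertices joined to `F ∩ B`
inside `F`, and the majority label is used elsewhere.

A kept label can be wrong only at a noisy vertex of `W`, the union of `Z` and a set that must
contain `B`, or at the end of a path of noisy vertices that starts at `W`. As `δ d` is small, the
expected number of such vertices is `O(d δ |W|)` (`noiseMean_reached_le`). The other danger is a
correct noisy label that is discarded for a wrong majority label. Such vertices form a subset of `Z`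
which is small in each cluster, hence expands; they are not in `B`, so half of the expansion leads
to vertices with the same wrong majority label, and these must be noisy vertices of `Z`
(`Setting.card_lost_le`). Altogether `φ` times the number of errors is at most a variable of mean
`O(d δ |W|)` with `|W| = O(η³ ε n / φ³)`, and Markov's inequality at level 1/20 finishes the proof,
with a factor `1 / φ` to spare.

The running time follows from closure properties of the predicate `PT`; fixed point arithmetic with
clamped entries keeps all intermediate values short. -/

theorem natPoly_mono (T : Polynomial ℕ) {a b : ℕ} (h : a ≤ b) : T.eval a ≤ T.eval b := by
  rw [Polynomial.eval_eq_sum_range, Polynomial.eval_eq_sum_range]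
  gcongr

theorem Prog.charge_le_cost : ∀ {a b : Ty} (p : Prog a b) (x : a.Val), p.charge x ≤ p.cost x
  | _, _, .comp g f, x => by rw [Prog.cost]; omega
  | _, _, .pair f g, x => by rw [Prog.cost]; omega
  | _, _, .cond t f g, x => by rw [Prog.cost]; omega
  | _, _, .caseList f g, x => by rw [Prog.cost]; omega
  | _, _, .fold f, x => by rw [Prog.cost]; omega
  | _, _, .loop f, x => by rw [Prog.cost]; omega
  | _, _, .id, x => by rw [Prog.cost]
  | _, _, .fst, x => by rw [Prog.cost]
  | _, _, .snd, x => by rw [Prog.cost]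
  | a, _, .const z, x => by rw [Prog.cost]
  | _, _, .add, x => by rw [Prog.cost]
  | _, _, .sub, x => by rw [Prog.cost]
  | _, _, .mul, x => by rw [Prog.cost]
  | _, _, .div, x => by rw [Prog.cost]
  | a, .list b, .nil, x => by rw [Prog.cost]
  | _, _, .cons, x => by rw [Prog.cost]

theorem Prog.size_eval_le_cost {a b : Ty} (p : Prog a b) (x : a.Val) :
    b.size (p.eval x) ≤ p.cost x := by
  have := p.charge_le_cost x
  unfold Prog.charge at this
  omega

/-- `f` is computed by a program of polynomial cost. -/
def PT (a b : Ty) (f : a.Val → b.Val) : Prop :=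
  ∃ p : Prog a b, (∀ x, p.eval x = f x) ∧ ∃ T : Polynomial ℕ, ∀ x, p.cost x ≤ T.eval (a.size x)

namespace PT

variable {a b c s : Ty}

theorem size_le {f : a.Val → b.Val} (hf : PT a b f) :
    ∃ T : Polynomial ℕ, ∀ x, b.size (f x) ≤ T.eval (a.size x) := by
  obtain ⟨p, hp, T, hT⟩ := hf
  refine ⟨T, fun x => ?_⟩
  rw [← hp]
  exact (p.size_eval_le_cost x).trans (hT x)

/-- A single construct is polynomial as soon as its result has polynomial size. -/
theorem of_charge (p : Prog a b) (hc : ∀ x, p.cost x = p.charge x) (T : Polynomial ℕ)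
    (h : ∀ x, b.size (p.eval x) ≤ T.eval (a.size x)) : PT a b p.eval := by
  refine ⟨p, fun _ => rfl, 1 + Polynomial.X + T, fun x => ?_⟩
  rw [hc, Prog.charge]
  simp only [Polynomial.eval_add, Polynomial.eval_one, Polynomial.eval_X]
  have := h x
  omega

theorem id : PT a a (fun x => x) :=
  of_charge Prog.id (fun _ => by rw [Prog.cost]) Polynomial.X (fun x => by simp [Prog.eval])

/-- The intermediate result is no longer than the cost of producing it, so the second cost is
bounded by a composite polynomial. The factor 2 pays for the result a second time, in the charge of
the composition. -/
theorem comp {g : b.Val → c.Val} {f : a.Val → b.Val} (hg : PT b c g) (hf : PT a b f) :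
    PT a c (fun x => g (f x)) := by
  obtain ⟨p, hp, T, hT⟩ := hf
  obtain ⟨q, hq, U, hU⟩ := hg
  refine ⟨.comp q p, fun x => by rw [Prog.eval, hp, hq],
    1 + Polynomial.X + 2 * U.comp T + T, fun x => ?_⟩
  rw [Prog.cost, Prog.charge, Prog.eval]
  have h1 := hT x
  have h2 := (p.size_eval_le_cost x).trans h1
  have h3 := (hU (p.eval x)).trans (natPoly_mono U h2)
  have h4 := (q.size_eval_le_cost (p.eval x)).trans h3
  simp only [Polynomial.eval_add, Polynomial.eval_one, Polynomial.eval_X, Polynomial.eval_mul,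
    Polynomial.eval_comp, Polynomial.eval_ofNat]
  omega

theorem pair {g : a.Val → c.Val} {f : a.Val → b.Val} (hf : PT a b f) (hg : PT a c g) :
    PT a (.prod b c) (fun x => (f x, g x)) := by
  obtain ⟨p, hp, T, hT⟩ := hf
  obtain ⟨q, hq, U, hU⟩ := hg
  refine ⟨.pair p q, fun x => by rw [Prog.eval, hp, hq],
    2 + Polynomial.X + 2 * U + 2 * T, fun x => ?_⟩
  rw [Prog.cost, Prog.charge, Prog.eval, Ty.size]
  have h1 := hT x
  have h2 := (p.size_eval_le_cost x)
  have h3 := hU x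
  have h4 := (q.size_eval_le_cost x)
  simp only [Polynomial.eval_add, Polynomial.eval_ofNat, Polynomial.eval_X, Polynomial.eval_mul]
  omega

theorem fst : PT (.prod a b) a (fun x => x.1) :=
  of_charge Prog.fst (fun _ => by rw [Prog.cost]) Polynomial.X
    (fun x => by simp only [Prog.eval, Polynomial.eval_X, Ty.size]; omega)

theorem snd : PT (.prod a b) b (fun x => x.2) :=
  of_charge Prog.snd (fun _ => by rw [Prog.cost]) Polynomial.X
    (fun x => by simp only [Prog.eval, Polynomial.eval_X, Ty.size]; omega)

theorem left {f : a.Val → b.Val × c.Val} (hf : PT a (.prod b c) f) : PT a b (fun x => (f x).1) :=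
  fst.comp hf

theorem right {f : a.Val → b.Val × c.Val} (hf : PT a (.prod b c) f) : PT a c (fun x => (f x).2) :=
  snd.comp hf

theorem const (z : ℤ) : PT a .int (fun _ => z) :=
  of_charge (Prog.const z) (fun _ => by rw [Prog.cost]) (Polynomial.C (Ty.int.size z))
    (fun x => by simp [Prog.eval])

theorem nil : PT a (.list b) (fun _ => []) :=
  of_charge Prog.nil (fun _ => by rw [Prog.cost]) 1
    (fun x => by simp [Prog.eval, Ty.size])

theorem cons' : PT (.prod a (.list a)) (.list a) (fun x => x.1 :: x.2) :=
  of_charge Prog.cons (fun _ => by rw [Prog.cost]) (Polynomial.X + 1)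
    (fun x => by simp [Prog.eval, Ty.size]; omega)

end PT

/-! ### Bit lengths under integer arithmetic -/

theorem Ty.size_int_le_of_natAbs_lt {x : ℤ} {m : ℕ} (h : x.natAbs < 2 ^ m) :
    Ty.int.size x ≤ m + 1 := by
  simp only [Ty.size]
  have := Nat.size_le.2 h
  omega

theorem Ty.natAbs_lt_two_pow_size (x : ℤ) : x.natAbs < 2 ^ (Ty.int.size x - 1) := by
  simp only [Ty.size]
  exact Nat.lt_size_self _

theorem Ty.one_le_size : ∀ (a : Ty) (x : a.Val), 1 ≤ a.size x
  | .int, x => by simp [Ty.size]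
  | .prod a b, x => by simp [Ty.size]
  | .list a, l => by simp [Ty.size]

theorem Ty.size_int_add_le (x y : ℤ) : Ty.int.size (x + y) ≤ Ty.int.size x + Ty.int.size y := by
  have hx := Ty.natAbs_lt_two_pow_size x
  have hy := Ty.natAbs_lt_two_pow_size y
  have h1 := Ty.one_le_size .int x
  have h2 := Ty.one_le_size .int y
  obtain ⟨p, hp⟩ := Nat.exists_eq_add_of_le' h1
  obtain ⟨q, hq⟩ := Nat.exists_eq_add_of_le' h2
  rw [hp] at hx ⊢
  rw [hq] at hy ⊢
  have := @Ty.size_int_le_of_natAbs_lt (x + y) (p + q + 1) (by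
    have h3 := Int.natAbs_add_le x y
    have h4 : 2 ^ p ≤ 2 ^ (p + q) := Nat.pow_le_pow_right (by norm_num) (by omega)
    have h5 : 2 ^ q ≤ 2 ^ (p + q) := Nat.pow_le_pow_right (by norm_num) (by omega)
    rw [pow_succ]
    simp only [Nat.add_sub_cancel] at hx hy
    omega)
  omega

theorem Ty.size_int_neg (x : ℤ) : Ty.int.size (-x) = Ty.int.size x := by simp [Ty.size]

theorem Ty.size_int_sub_le (x y : ℤ) : Ty.int.size (x - y) ≤ Ty.int.size x + Ty.int.size y := by
  rw [sub_eq_add_neg, ← Ty.size_int_neg y]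
  exact Ty.size_int_add_le _ _

theorem Ty.size_int_mul_le (x y : ℤ) : Ty.int.size (x * y) ≤ Ty.int.size x + Ty.int.size y := by
  have hx := Ty.natAbs_lt_two_pow_size x
  have hy := Ty.natAbs_lt_two_pow_size y
  have h1 := Ty.one_le_size .int x
  have h2 := Ty.one_le_size .int y
  refine (@Ty.size_int_le_of_natAbs_lt (x * y)
    (Ty.int.size x - 1 + (Ty.int.size y - 1)) ?_).trans (by omega)
  rw [Int.natAbs_mul, pow_add]
  exact Nat.mul_lt_mul'' hx hy

theorem Ty.size_int_mono {x y : ℤ} (h : x.natAbs ≤ y.natAbs) : Ty.int.size x ≤ Ty.int.size y := by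
  simp only [Ty.size]
  have := Nat.size_le_size h
  omega

theorem Ty.size_int_div_le (x y : ℤ) : Ty.int.size (x / y) ≤ Ty.int.size x := by
  exact Ty.size_int_mono (Int.natAbs_ediv_le_natAbs x y)

namespace PT

variable {a b c s : Ty}

theorem add {f g : a.Val → ℤ} (hf : PT a .int f) (hg : PT a .int g) :
    PT a .int (fun x => f x + g x) :=
  (of_charge Prog.add (fun _ => by rw [Prog.cost]) Polynomial.X fun x => by
    have := Ty.size_int_add_le x.1 x.2
    simp only [Prog.eval, Polynomial.eval_X]
    rw [Ty.size.eq_2]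
    omega).comp (hf.pair hg)

theorem sub {f g : a.Val → ℤ} (hf : PT a .int f) (hg : PT a .int g) :
    PT a .int (fun x => f x - g x) :=
  (of_charge Prog.sub (fun _ => by rw [Prog.cost]) Polynomial.X fun x => by
    have := Ty.size_int_sub_le x.1 x.2
    simp only [Prog.eval, Polynomial.eval_X]
    rw [Ty.size.eq_2]
    omega).comp (hf.pair hg)

theorem mul {f g : a.Val → ℤ} (hf : PT a .int f) (hg : PT a .int g) :
    PT a .int (fun x => f x * g x) :=
  (of_charge Prog.mul (fun _ => by rw [Prog.cost]) Polynomial.X fun x => by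
    have := Ty.size_int_mul_le x.1 x.2
    simp only [Prog.eval, Polynomial.eval_X]
    rw [Ty.size.eq_2]
    omega).comp (hf.pair hg)

theorem div {f g : a.Val → ℤ} (hf : PT a .int f) (hg : PT a .int g) :
    PT a .int (fun x => f x / g x) :=
  (of_charge Prog.div (fun _ => by rw [Prog.cost]) Polynomial.X fun x => by
    have := Ty.size_int_div_le x.1 x.2
    simp only [Prog.eval, Polynomial.eval_X]
    rw [Ty.size.eq_2]
    omega).comp (hf.pair hg)

theorem cons {f : a.Val → b.Val} {g : a.Val → List b.Val} (hf : PT a b f) (hg : PT a (.list b) g) :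
    PT a (.list b) (fun x => f x :: g x) :=
  cons'.comp (hf.pair hg)

theorem ite {t : a.Val → ℤ} {f g : a.Val → b.Val} (ht : PT a .int t) (hf : PT a b f)
    (hg : PT a b g) : PT a b (fun x => if 0 < t x then f x else g x) := by
  obtain ⟨r, hr, R, hR⟩ := ht
  obtain ⟨p, hp, T, hT⟩ := hf
  obtain ⟨q, hq, U, hU⟩ := hg
  refine ⟨.cond r p q, fun x => by rw [Prog.eval, hp, hq, hr],
    1 + Polynomial.X + R + 2 * T + 2 * U, fun x => ?_⟩
  rw [Prog.cost, Prog.charge, Prog.eval]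
  have h1 := hT x
  have h2 := (p.size_eval_le_cost x)
  have h3 := hU x
  have h4 := (q.size_eval_le_cost x)
  have h5 := hR x
  simp only [Polynomial.eval_add, Polynomial.eval_ofNat, Polynomial.eval_X, Polynomial.eval_mul,
    Polynomial.eval_one]
  split_ifs <;> omega

theorem caseList {l : a.Val → List b.Val} {f : a.Val → c.Val} {g : a.Val × b.Val × List b.Val → c.Val}
    (hl : PT a (.list b) l) (hf : PT a c f) (hg : PT (.prod a (.prod b (.list b))) c g) :
    PT a c (fun x => match l x with
      | [] => f x
      | y :: t => g (x, (y, t))) := by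
  obtain ⟨p, hp, T, hT⟩ := hf
  obtain ⟨q, hq, U, hU⟩ := hg
  have key : PT (.prod a (.list b)) c (fun x => match x.2 with
      | [] => f x.1
      | y :: t => g (x.1, (y, t))) := by
    refine ⟨.caseList p q, fun x => ?_, 1 + Polynomial.X + 2 * T + 2 * U, fun x => ?_⟩
    · rw [Prog.eval]
      rcases x with ⟨x, _ | ⟨y, t⟩⟩
      · exact hp x
      · exact hq _
    · simp only [Polynomial.eval_add, Polynomial.eval_ofNat, Polynomial.eval_X,
        Polynomial.eval_mul, Polynomial.eval_one]
      rw [Prog.cost, Prog.charge, Prog.eval]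
      rcases x with ⟨x, _ | ⟨y, t⟩⟩
      · have h1 := hT x
        have h2 := p.size_eval_le_cost x
        have h3 := natPoly_mono T (show a.size x ≤ (Ty.prod a (.list b)).size (x, []) by
          simp only [Ty.size]; omega)
        simp only
        omega
      · have h1 := hU (x, (y, t))
        have h2 := q.size_eval_le_cost (x, (y, t))
        have h3 := natPoly_mono U (show (Ty.prod a (.prod b (.list b))).size (x, (y, t)) ≤
          (Ty.prod a (.list b)).size (x, y :: t) by
          simp only [Ty.size, List.map_cons, List.sum_cons]; omega)
        simp only
        omega
  exact key.comp (id.pair hl)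

end PT

/-! ### Lists: sizes, folds and iterations -/

/-- This is the bookkeeping of `Prog.cost` for a fold. The step is only ever run on states reached
along prefixes of the list, so the bound `K` is required for those alone. -/
theorem foldl_cost_le {α β : Type*} (f : α → β → α) (w : α → β → ℕ) (K : ℕ) (l : List β) (s : α)
    (m : ℕ) (h : ∀ l₁ y l₂, l = l₁ ++ y :: l₂ → w (l₁.foldl f s) y ≤ K) :
    (l.foldl (fun s y => (f s.1 y, s.2 + w s.1 y)) (s, m)).2 ≤ m + l.length * K := by
  induction l generalizing s m with
  | nil => simp
  | cons y l ih =>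
    rw [List.foldl_cons]
    have h1 := h [] y l rfl
    refine (ih (f s y) (m + w s y) fun l₁ z l₂ hl => ?_).trans ?_
    · exact h (y :: l₁) z l₂ (by rw [hl]; rfl)
    · simp only [List.foldl_nil] at h1
      simp only [List.length_cons]
      nlinarith

theorem Ty.length_lt_size {a : Ty} (l : List a.Val) : l.length < (Ty.list a).size l := by
  simp only [Ty.size]
  induction l with
  | nil => simp
  | cons y l ih => simp only [List.map_cons, List.sum_cons, List.length_cons]; omega

theorem Ty.size_le_of_mem {a : Ty} {l : List a.Val} {y : a.Val} (h : y ∈ l) :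
    a.size y < (Ty.list a).size l := by
  simp only [Ty.size]
  have := List.single_le_sum (l := l.map fun y => a.size y + 1) (by simp) (a.size y + 1)
    (List.mem_map_of_mem h)
  omega

theorem Ty.size_list_le {a : Ty} {l : List a.Val} {K : ℕ} (h : ∀ y ∈ l, a.size y ≤ K) :
    (Ty.list a).size l ≤ l.length * (K + 1) + 1 := by
  simp only [Ty.size]
  have := List.sum_le_card_nsmul (l.map fun y => a.size y + 1) (K + 1) (by
    intro z hz
    obtain ⟨y, hy, rfl⟩ := List.mem_map.1 hz
    have := h y hy
    omega)
  simpa using this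

theorem Ty.size_prefix_le {a : Ty} {l l₁ l₂ : List a.Val} (h : l = l₁ ++ l₂) :
    (Ty.list a).size l₁ ≤ (Ty.list a).size l := by
  subst h
  simp only [Ty.size, List.map_append, List.sum_append]
  omega

namespace PT

variable {a b c s : Ty}

/-- Folding over a list whose intermediate states stay polynomially small. -/
theorem foldl {l : a.Val → List b.Val} {i : a.Val → s.Val} {f : a.Val × s.Val × b.Val → s.Val}
    (hl : PT a (.list b) l) (hi : PT a s i) (hf : PT (.prod a (.prod s b)) s f) (B : Polynomial ℕ)
    (hB : ∀ x l₁ l₂, l x = l₁ ++ l₂ →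
      s.size (l₁.foldl (fun t y => f (x, (t, y))) (i x)) ≤ B.eval (a.size x)) :
    PT a s (fun x => (l x).foldl (fun t y => f (x, (t, y))) (i x)) := by
  -- The body of a fold sees only its state and the current entry, so the input `x` is carried along
  -- unchanged in the state.
  obtain ⟨p, hp, T, hT⟩ : PT (.prod (.prod a s) b) (.prod a s)
      (fun z => (z.1.1, f (z.1.1, (z.1.2, z.2)))) :=
    (fst.comp fst).pair (hf.comp ((fst.comp fst).pair ((snd.comp fst).pair snd)))
  have hfold : ∀ (x : a.Val) (l : List b.Val) (t : s.Val),
      l.foldl (fun u y => p.eval (u, y)) (x, t) =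
        (x, l.foldl (fun t y => f (x, (t, y))) t) := by
    intro x l
    induction l with
    | nil => intro t; rfl
    | cons y l ih =>
      intro t
      rw [List.foldl_cons, List.foldl_cons, hp]
      exact ih _
  obtain ⟨q, hq, U, hU⟩ : PT a (.prod (.prod a s) (.list b)) (fun x => ((x, i x), l x)) :=
    (id.pair hi).pair hl
  obtain ⟨L, hL⟩ := hl.size_le
  have hsize : ∀ x : a.Val, ∀ l₁ l₂, l x = l₁ ++ l₂ →
      (Ty.prod a s).size (l₁.foldl (fun u y => p.eval (u, y)) (x, i x)) ≤
        (Polynomial.X + B + 1).eval (a.size x) := by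
    intro x l₁ l₂ h
    rw [hfold]
    have := hB x l₁ l₂ h
    simp only [Ty.size, Polynomial.eval_add, Polynomial.eval_one, Polynomial.eval_X]
    omega
  refine snd.comp (g := Prod.snd) (f := fun x => (x, (l x).foldl (fun t y => f (x, (t, y))) (i x)))
    ⟨.comp (.fold p) q, fun x => ?_,
      1 + Polynomial.X + (Polynomial.X + B + 1) + U + (1 + U + (Polynomial.X + B + 1)) +
        L * T.comp (Polynomial.X + B + 1 + L + 1), fun x => ?_⟩
  · rw [Prog.eval, Prog.eval, hq]
    exact hfold x _ _
  · have e1 : (Prog.comp (.fold p) q).eval x =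
        (l x).foldl (fun u y => p.eval (u, y)) (x, i x) := by
      rw [Prog.eval, Prog.eval, hq]
    have e2 : (Prog.fold p).eval (q.eval x) =
        (l x).foldl (fun u y => p.eval (u, y)) (x, i x) := by
      rw [Prog.eval, hq]
    rw [Prog.cost, Prog.charge, Prog.cost, Prog.charge, e1, e2, hq]
    have h0 := hsize x (l x) [] (by simp)
    have h1 := hU x
    have h2 := q.size_eval_le_cost x
    rw [hq] at h2
    dsimp only at h2
    have h3 := foldl_cost_le (fun u y => p.eval (u, y)) (fun u y => p.cost (u, y))
      (T.eval ((Polynomial.X + B + 1 + L + 1).eval (a.size x))) (l x) (x, i x) 0 (by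
        intro l₁ y l₂ h
        refine (hT _).trans (natPoly_mono T ?_)
        have h4 := hsize x l₁ (y :: l₂) h
        have h5 : b.size y < (Ty.list b).size (l x) := Ty.size_le_of_mem (by rw [h]; simp)
        have h6 := hL x
        simp only [Polynomial.eval_add, Polynomial.eval_one, Polynomial.eval_X] at h4 ⊢
        rw [Ty.size.eq_2]
        dsimp only
        omega)
    have h4 : (l x).length ≤ L.eval (a.size x) := (Ty.length_lt_size (l x)).le.trans (hL x)
    have h5 := Nat.mul_le_mul_right
      (T.eval ((Polynomial.X + B + 1 + L + 1).eval (a.size x))) h4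
    simp only [Polynomial.eval_add, Polynomial.eval_one, Polynomial.eval_X, Polynomial.eval_mul,
      Polynomial.eval_comp] at h0 h3 h5 ⊢
    omega

/-- Iterating a map whose orbit stays polynomially small. -/
theorem iterate {g : a.Val → ℤ} {i : a.Val → s.Val} {f : a.Val × s.Val → s.Val}
    (hg : PT a .int g) (hi : PT a s i) (hf : PT (.prod a s) s f) (L B : Polynomial ℕ)
    (hL : ∀ x, (g x).toNat ≤ L.eval (a.size x))
    (hB : ∀ x j, j ≤ (g x).toNat → s.size ((fun t => f (x, t))^[j] (i x)) ≤ B.eval (a.size x)) :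
    PT a s (fun x => (fun t => f (x, t))^[(g x).toNat] (i x)) := by
  obtain ⟨p, hp, T, hT⟩ : PT (.prod a s) (.prod a s) (fun z => (z.1, f z)) := fst.pair hf
  have hiter : ∀ (x : a.Val) (j : ℕ) (t : s.Val),
      p.eval^[j] (x, t) = (x, (fun t => f (x, t))^[j] t) := by
    intro x j
    induction j with
    | zero => intro t; rfl
    | succ j ih =>
      intro t
      rw [Function.iterate_succ_apply, Function.iterate_succ_apply, hp]
      exact ih _
  obtain ⟨q, hq, U, hU⟩ : PT a (.prod (.prod a s) .int) (fun x => ((x, i x), g x)) :=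
    (id.pair hi).pair hg
  have hsize : ∀ x : a.Val, ∀ j ≤ (g x).toNat,
      (Ty.prod a s).size (p.eval^[j] (x, i x)) ≤ (Polynomial.X + B + 1).eval (a.size x) := by
    intro x j h
    rw [hiter]
    have := hB x j h
    simp only [Ty.size, Polynomial.eval_add, Polynomial.eval_one, Polynomial.eval_X]
    omega
  refine snd.comp (g := Prod.snd) (f := fun x => (x, (fun t => f (x, t))^[(g x).toNat] (i x)))
    ⟨.comp (.loop p) q, fun x => ?_,
      1 + Polynomial.X + (Polynomial.X + B + 1) + U + (1 + U + (Polynomial.X + B + 1)) +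
        L * T.comp (Polynomial.X + B + 1), fun x => ?_⟩
  · rw [Prog.eval, Prog.eval, hq]
    exact hiter x _ _
  · have e1 : (Prog.comp (.loop p) q).eval x = p.eval^[(g x).toNat] (x, i x) := by
      rw [Prog.eval, Prog.eval, hq]
    have e2 : (Prog.loop p).eval (q.eval x) = p.eval^[(g x).toNat] (x, i x) := by
      rw [Prog.eval, hq]
    rw [Prog.cost, Prog.charge, Prog.cost, Prog.charge, e1, e2, hq]
    have h0 := hsize x _ le_rfl
    have h1 := hU x
    have h2 := q.size_eval_le_cost x
    rw [hq] at h2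
    dsimp only at h2
    have h3 : ∑ j ∈ Finset.range (g x).toNat, p.cost (p.eval^[j] (x, i x)) ≤
        L.eval (a.size x) * T.eval ((Polynomial.X + B + 1).eval (a.size x)) := by
      refine (Finset.sum_le_card_nsmul _ _
        (T.eval ((Polynomial.X + B + 1).eval (a.size x))) fun j hj => ?_).trans ?_
      · exact (hT _).trans (natPoly_mono T (hsize x j (Finset.mem_range.1 hj).le))
      · rw [Finset.card_range, smul_eq_mul]
        exact Nat.mul_le_mul_right _ (hL x)
    simp only [Polynomial.eval_add, Polynomial.eval_one, Polynomial.eval_X, Polynomial.eval_mul,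
      Polynomial.eval_comp] at h0 h3 ⊢
    omega

theorem reverse {l : a.Val → List b.Val} (hl : PT a (.list b) l) :
    PT a (.list b) (fun x => (l x).reverse) := by
  have h : PT a (.list b) (fun x => (l x).foldl (fun t y => y :: t) []) := by
    obtain ⟨L, hL⟩ := hl.size_le
    refine foldl (f := fun z => z.2.2 :: z.2.1) hl nil
      ((snd.comp snd).cons (fst.comp snd)) L fun x l₁ l₂ h => ?_
    refine le_trans ?_ ((Ty.size_prefix_le h).trans (hL x))
    rw [List.foldl_flip_cons_eq_append]
    simp [Ty.size, List.sum_reverse]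
  simpa using h

/-- Apply a function to each entry of a list. -/
theorem map {l : a.Val → List b.Val} {f : a.Val × b.Val → c.Val} (hl : PT a (.list b) l)
    (hf : PT (.prod a b) c f) : PT a (.list c) (fun x => (l x).map fun y => f (x, y)) := by
  have h : PT a (.list c) (fun x => (l x).foldl (fun t y => f (x, y) :: t) []) := by
    obtain ⟨L, hL⟩ := hl.size_le
    obtain ⟨T, hT⟩ := hf.size_le
    refine foldl (f := fun z => f (z.1, z.2.2) :: z.2.1) hl nil
      ((hf.comp (fst.pair (snd.comp snd))).cons (fst.comp snd))
      (L * (T.comp (Polynomial.X + L + 1) + 1) + 1) fun x l₁ l₂ h => ?_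
    have e : l₁.foldl (fun t y => f (x, y) :: t) [] = (l₁.map fun y => f (x, y)).reverse := by
      rw [← List.foldl_map (f := fun y => f (x, y)) (g := fun t y => y :: t),
        List.foldl_flip_cons_eq_append, List.append_nil, List.map_id']
    change (Ty.list c).size (l₁.foldl (fun t y => f (x, y) :: t) []) ≤ _
    rw [e]
    refine (Ty.size_list_le (K := T.eval ((Polynomial.X + L + 1).eval (a.size x))) ?_).trans ?_
    · intro z hz
      rw [List.mem_reverse, List.mem_map] at hz
      obtain ⟨y, hy, rfl⟩ := hz
      refine (hT _).trans (natPoly_mono T ?_)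
      have h5 : b.size y < (Ty.list b).size (l x) := Ty.size_le_of_mem (by rw [h]; simp [hy])
      have h6 := hL x
      simp only [Polynomial.eval_add, Polynomial.eval_one, Polynomial.eval_X, Ty.size] at h5 h6 ⊢
      omega
    · have h7 : l₁.length ≤ L.eval (a.size x) :=
        (Ty.length_lt_size l₁).le.trans ((Ty.size_prefix_le h).trans (hL x))
      simp only [List.length_reverse, List.length_map, Polynomial.eval_add, Polynomial.eval_one,
        Polynomial.eval_mul, Polynomial.eval_comp]
      gcongr
  have h' := h.reverse
  have e : ∀ x, ((l x).foldl (fun t y => f (x, y) :: t) []).reverse =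
      (l x).map fun y => f (x, y) := by
    intro x
    rw [← List.foldl_map (f := fun y => f (x, y)) (g := fun t y => y :: t),
      List.foldl_flip_cons_eq_append, List.append_nil, List.reverse_reverse, List.map_id']
  simpa only [e] using h'

theorem length {l : a.Val → List b.Val} (hl : PT a (.list b) l) :
    PT a .int (fun x => ((l x).length : ℤ)) := by
  have e : ∀ (l : List b.Val) (t : ℤ), l.foldl (fun t _ => t + 1) t = t + l.length := by
    intro l
    induction l with
    | nil => simp
    | cons y l ih => intro t; rw [List.foldl_cons, ih]; push_cast [List.length_cons]; ring
  have h : PT a .int (fun x => (l x).foldl (fun (t : ℤ) _ => t + 1) 0) := by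
    obtain ⟨L, hL⟩ := hl.size_le
    refine foldl (s := .int) (f := fun z => z.2.1 + 1) hl (const 0) ((fst.comp snd).add (const 1))
      (L + 1) fun x l₁ l₂ h => ?_
    change Ty.int.size (l₁.foldl (fun (t : ℤ) _ => t + 1) 0) ≤ _
    rw [e]
    refine (Ty.size_int_le_of_natAbs_lt (m := l₁.length) ?_).trans ?_
    · simpa using Nat.lt_two_pow_self
    · have := (Ty.length_lt_size l₁).trans_le ((Ty.size_prefix_le h).trans (hL x))
      simp only [Polynomial.eval_add, Polynomial.eval_one]
      omega
  simpa only [e, zero_add] using h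

theorem sum {l : a.Val → List ℤ} (hl : PT a (.list .int) l) : PT a .int (fun x => (l x).sum) := by
  have e : ∀ (l : List ℤ) (t : ℤ), l.foldl (fun t y => t + y) t = t + l.sum := by
    intro l
    induction l with
    | nil => simp
    | cons y l ih => intro t; rw [List.foldl_cons, ih, List.sum_cons]; ring
  have e' : ∀ l : List ℤ, Ty.int.size l.sum ≤ (Ty.list .int).size l := by
    intro l
    induction l with
    | nil => simp [Ty.size]
    | cons y l ih =>
      have := Ty.size_int_add_le y l.sum
      have h2 : (Ty.list .int).size (y :: l) = (Ty.list .int).size l + Ty.int.size y + 1 := by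
        simp only [Ty.size, List.map_cons, List.sum_cons]; omega
      rw [List.sum_cons, h2]
      omega
  have h : PT a .int (fun x => (l x).foldl (fun (t : ℤ) y => t + y) 0) := by
    obtain ⟨L, hL⟩ := hl.size_le
    refine foldl (s := .int) (b := .int) (f := fun z => z.2.1 + z.2.2) hl (const 0)
      ((fst.comp snd).add (snd.comp snd)) L fun x l₁ l₂ h => ?_
    change Ty.int.size (l₁.foldl (fun (t : ℤ) y => t + y) 0) ≤ _
    rw [e, zero_add]
    exact (e' l₁).trans ((Ty.size_prefix_le h).trans (hL x))
  simpa only [e, zero_add] using h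

/-- The fold runs over the first list; its state holds the unused rest of the second list and the
pairs found so far, in reverse order. -/
theorem zip {l : a.Val → List b.Val} {m : a.Val → List c.Val} (hl : PT a (.list b) l)
    (hm : PT a (.list c) m) : PT a (.list (.prod b c)) (fun x => (l x).zip (m x)) := by
  let F : List c.Val × List (b.Val × c.Val) → b.Val → List c.Val × List (b.Val × c.Val) :=
    fun t y => match t.1 with
      | [] => t
      | z :: r => (r, (y, z) :: t.2)
  have e : ∀ (l : List b.Val) (m : List c.Val) (t : List (b.Val × c.Val)),
      l.foldl F (m, t) = (m.drop l.length, (l.zip m).reverse ++ t) := by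
    intro l
    induction l with
    | nil => intro m t; simp
    | cons y l ih =>
      intro m t
      rw [List.foldl_cons]
      rcases m with _ | ⟨z, m⟩
      · change l.foldl F ([], t) = _
        rw [ih]
        simp
      · change l.foldl F (m, (y, z) :: t) = _
        rw [ih]
        simp
  have hs : ∀ (l : List b.Val) (m : List c.Val),
      (Ty.list (.prod b c)).size (l.zip m) ≤ 2 * ((Ty.list b).size l + (Ty.list c).size m) := by
    intro l
    induction l with
    | nil => intro m; simp only [List.zip_nil_left, Ty.size, List.map_nil, List.sum_nil]; omega
    | cons y l ih =>
      intro m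
      rcases m with _ | ⟨z, m⟩
      · simp only [List.zip_nil_right, Ty.size, List.map_nil, List.sum_nil]; omega
      · have := ih m
        simp only [List.zip_cons_cons, Ty.size, List.map_cons, List.sum_cons] at this ⊢
        omega
  have hd : ∀ (m : List c.Val) (j : ℕ), (Ty.list c).size (m.drop j) ≤ (Ty.list c).size m := by
    intro m j
    have := congrArg (Ty.list c).size (List.take_append_drop j m)
    simp only [Ty.size, List.map_append, List.sum_append] at this ⊢
    omega
  have h : PT a (.prod (.list c) (.list (.prod b c))) (fun x => (l x).foldl F (m x, [])) := by
    obtain ⟨L, hL⟩ := hl.size_le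
    obtain ⟨M, hM⟩ := hm.size_le
    refine foldl (s := .prod (.list c) (.list (.prod b c))) (b := b) (f := fun z => F z.2.1 z.2.2)
      hl (hm.pair nil) ?_ (3 * M + 2 * L + 1) fun x l₁ l₂ h => ?_
    · exact caseList (a := .prod a (.prod (.prod (.list c) (.list (.prod b c))) b))
        (c := .prod (.list c) (.list (.prod b c))) (b := c) (f := fun z => z.2.1)
        (g := fun z => (z.2.2, (z.1.2.2, z.2.1) :: z.1.2.1.2)) (fst.comp (fst.comp snd))
        (fst.comp snd)
        ((snd.comp snd).pair (((snd.comp (snd.comp fst)).pair (fst.comp snd)).cons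
          (snd.comp (fst.comp (snd.comp fst)))))
    · change (Ty.prod (.list c) (.list (.prod b c))).size (l₁.foldl F (m x, [])) ≤ _
      rw [e, Ty.size.eq_2]
      have h1 := hd (m x) l₁.length
      have h2 := hM x
      have h3 := hs l₁ (m x)
      have h4 := (Ty.size_prefix_le h).trans (hL x)
      have h5 : (Ty.list (.prod b c)).size ((l₁.zip (m x)).reverse ++ []) =
          (Ty.list (.prod b c)).size (l₁.zip (m x)) := by
        simp [Ty.size, List.sum_reverse]
      simp only [Polynomial.eval_add, Polynomial.eval_one, Polynomial.eval_mul,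
        Polynomial.eval_ofNat]
      rw [h5]
      omega
  have h' := (snd.comp h).reverse
  simpa only [e, List.append_nil, List.reverse_reverse] using h'

end PT

end NoisyClustering

namespace NoisyClustering

/-! ## The algorithm -/

/-- Inner product of two lists. -/
def dot (r r' : List ℤ) : ℤ := ((r.zip r').map fun p => p.1 * p.2).sum

/-- Indicator of equality. -/
def eqInd (x y : ℤ) : ℤ := if 0 < x - y then 0 else if 0 < y - x then 0 else 1

/-- Keep a number of absolute value at most `2 * Q`, replace any other one by `0`. -/
def clamp (Q x : ℤ) : ℤ := if 0 < (2 * Q + 1 - x) * (2 * Q + 1 + x) then x else 0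

/-- The product of `X` and the transpose of `Y` in fixed point arithmetic with unit `Q`. -/
def mulRound (Q : ℤ) (X Y : List (List ℤ)) : List (List ℤ) :=
  X.map fun r => Y.map fun r' => dot r r' / Q

/-- The polynomial `(a X² + b X³) / c` of a symmetric matrix in fixed point arithmetic. -/
def cubicRound (a b c Q : ℤ) (X : List (List ℤ)) : List (List ℤ) :=
  ((mulRound Q X X).zip (mulRound Q (mulRound Q X X) X)).map fun rr =>
    (rr.1.zip rr.2).map fun p => clamp Q ((a * p.1 + b * p.2) / c)

/-- The number of vertices. -/
def inputN (x : inputTy.Val) : ℤ := (x.1.length : ℤ)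

/-- The unit of the fixed point arithmetic. -/
def unitQ (x : inputTy.Val) : ℤ :=
  (fun t : ℤ => 2 * t)^[(1000 * (inputN x * inputN x)).toNat] 1

/-- The random walk matrix. -/
def walkRound (x : inputTy.Val) : List (List ℤ) :=
  x.1.map fun r => r.map fun y => y * unitQ x / r.sum

/-- One round of repeated squaring, which stops at an exponent of order `1 / φ ^ 2`. -/
def squareStep (num den Q : ℤ) (t : ℤ × List (List ℤ)) : ℤ × List (List ℤ) :=
  if 0 < 10 * (den * den) - t.1 * (num * num) then (2 * t.1, cubicRound 1 0 1 Q t.2) else t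

/-- The power of the random walk matrix. -/
def powerRound (x : inputTy.Val) : List (List ℤ) :=
  ((squareStep x.2.1.1 x.2.1.2 (unitQ x))^[(20 * inputN x).toNat]
    (1, cubicRound 1 1 2 (unitQ x) (walkRound x))).2

/-- The approximate projection to the dominant eigenspace. -/
def projRound (x : inputTy.Val) : List (List ℤ) :=
  (cubicRound 3 (-2) 1 (unitQ x))^[(20 * inputN x).toNat] (powerRound x)

/-- Balance parameter, capped at the number of vertices. -/
def capEta (x : inputTy.Val) : ℤ × ℤ :=
  if 0 < x.2.2.2.1.1 - inputN x * x.2.2.2.1.2 then (inputN x, 1) else x.2.2.2.1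

/-- Indicator that an entry of the projection is large. -/
def bigInd (x : inputTy.Val) (y : ℤ) : ℤ :=
  if 0 < 2 * (capEta x).1 * inputN x * y - x.2.2.1 * (capEta x).2 * unitQ x + 1 then 1 else 0

/-- Excess of the label `l` among the vertices with a large entry in the row `r`. -/
def excess (x : inputTy.Val) (r : List ℤ) (l : ℤ) : ℤ :=
  ((r.zip x.2.2.2.2).map fun p => bigInd x p.1 * (2 * eqInd p.2 l - 1)).sum

/-- The labels by majority among the vertices with a large entry. -/
def majorityLabels (x : inputTy.Val) : List ℤ :=
  ((projRound x).zip x.2.2.2.2).map fun p =>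
    x.2.2.2.2.foldl (fun t l => if 0 < excess x p.1 l then l else t) p.2

/-- Indicators of the vertices with many neighbours of another majority label. -/
def boundaryInd (x : inputTy.Val) (h : List ℤ) : List ℤ :=
  (x.1.zip h).map fun p =>
    if 0 < 2 * x.2.1.2 * ((p.1.zip h).map fun q => q.1 * (1 - eqInd p.2 q.2)).sum -
      x.2.1.1 * p.1.sum + 1 then 1 else 0

/-- Indicators of the vertices whose noisy label is not the majority label. -/
def differInd (x : inputTy.Val) (h : List ℤ) : List ℤ :=
  (x.2.2.2.2.zip h).map fun p => 1 - eqInd p.1 p.2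

/-- One round of a breadth first search. -/
def growStep (A : List (List ℤ)) (F T : List ℤ) : List ℤ :=
  (A.zip (F.zip T)).map fun p => if 0 < p.2.2 + p.2.1 * dot p.1 T then 1 else 0

/-- Indicators of the vertices that keep their noisy label. -/
def keepInd (x : inputTy.Val) (h : List ℤ) : List ℤ :=
  (growStep x.1 (differInd x h))^[(inputN x).toNat]
    (((differInd x h).zip (boundaryInd x h)).map fun p => p.1 * p.2)

/-- The final labels. -/
def finalLabels (x : inputTy.Val) (h : List ℤ) : List ℤ :=
  ((keepInd x h).zip (x.2.2.2.2.zip h)).map fun p => if 0 < p.1 then p.2.1 else p.2.2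

/-- The output of the algorithm. -/
def denoise (x : inputTy.Val) : List ℤ := finalLabels x (majorityLabels x)

/-! ### Its running time -/

/-- The type of matrices. -/
abbrev matTy : Ty := .list (.list .int)

namespace PT

variable {a b c : Ty}

theorem dot {f g : a.Val → List ℤ} (hf : PT a (.list .int) f) (hg : PT a (.list .int) g) :
    PT a .int (fun x => NoisyClustering.dot (f x) (g x)) :=
  sum ((hf.zip hg).map (c := .int) (f := fun z : a.Val × (ℤ × ℤ) => z.2.1 * z.2.2)
    ((left snd).mul (right snd)))

theorem eqInd {f g : a.Val → ℤ} (hf : PT a .int f) (hg : PT a .int g) :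
    PT a .int (fun x => NoisyClustering.eqInd (f x) (g x)) :=
  (hf.sub hg).ite (const 0) ((hg.sub hf).ite (const 0) (const 1))

theorem clamp {f g : a.Val → ℤ} (hf : PT a .int f) (hg : PT a .int g) :
    PT a .int (fun x => NoisyClustering.clamp (f x) (g x)) :=
  PT.ite (b := .int)
    (((((const 2).mul hf).add (const 1)).sub hg).mul ((((const 2).mul hf).add (const 1)).add hg))
    hg (const 0)

theorem mulRound {q : a.Val → ℤ} {f g : a.Val → List (List ℤ)} (hq : PT a .int q)
    (hf : PT a matTy f) (hg : PT a matTy g) :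
    PT a matTy (fun x => NoisyClustering.mulRound (q x) (f x) (g x)) :=
  hf.map (c := .list .int) (f := fun z : a.Val × List ℤ => (g z.1).map fun r' =>
      NoisyClustering.dot z.2 r' / q z.1)
    ((hg.comp fst).map (a := .prod a (.list .int)) (b := .list .int) (c := .int)
      (f := fun z : (a.Val × List ℤ) × List ℤ => NoisyClustering.dot z.1.2 z.2 / q z.1.1)
      ((dot (right fst) snd).div (hq.comp (left fst))))

theorem cubicRound (k l m : ℤ) {q : a.Val → ℤ} {f : a.Val → List (List ℤ)} (hq : PT a .int q)
    (hf : PT a matTy f) : PT a matTy (fun x => NoisyClustering.cubicRound k l m (q x) (f x)) :=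
  ((hq.mulRound hf hf).zip (hq.mulRound (hq.mulRound hf hf) hf)).map (c := .list .int)
    (f := fun z : a.Val × (List ℤ × List ℤ) => (z.2.1.zip z.2.2).map fun p =>
      NoisyClustering.clamp (q z.1) ((k * p.1 + l * p.2) / m))
    (PT.map (a := .prod a (.prod (.list .int) (.list .int))) (b := .prod .int .int) (c := .int)
      (f := fun z : (a.Val × (List ℤ × List ℤ)) × (ℤ × ℤ) =>
        NoisyClustering.clamp (q z.1.1) ((k * z.2.1 + l * z.2.2) / m))
      ((left snd).zip
        (right snd))
      (clamp (hq.comp (left fst))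
        ((((const k).mul (left snd)).add
          ((const l).mul (right snd))).div (const m))))

end PT

/-- A matrix with `m` rows of at most `m` entries of size at most `K`. -/
def MatBound (m K : ℕ) (X : List (List ℤ)) : Prop :=
  X.length = m ∧ ∀ r ∈ X, r.length ≤ m ∧ ∀ y ∈ r, Ty.int.size y ≤ K

theorem MatBound.size_le {m K : ℕ} {X : List (List ℤ)} (h : MatBound m K X) :
    matTy.size X ≤ m * ((m * (K + 1) + 1) + 1) + 1 := by
  have := Ty.size_list_le (a := .list .int) (l := X) (K := m * (K + 1) + 1) (fun r hr => by
    refine (Ty.size_list_le (a := .int) (l := r) (K := K) (h.2 r hr).2).trans ?_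
    have := (h.2 r hr).1
    gcongr)
  rw [h.1] at this
  exact this

/-- The bound does not involve `x`. Without clamping, entries could double in length in each round;
with it, the cost stays polynomial on every input, including those to which the error analysis does
not apply. -/
theorem size_clamp_le (Q x : ℤ) : Ty.int.size (clamp Q x) ≤ 2 * Ty.int.size Q + 3 := by
  have h1 : Ty.int.size (2 * Q + 1) ≤ 2 * Ty.int.size Q + 3 := by
    have e1 := Ty.size_int_add_le (2 * Q) 1
    have e2 := Ty.size_int_add_le Q Q
    have e3 : Ty.int.size 1 = 2 := by simp [Ty.size]
    rw [two_mul] at *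
    omega
  unfold clamp
  split_ifs with h
  · refine le_trans (Ty.size_int_mono ?_) h1
    have : x ^ 2 < (2 * Q + 1) ^ 2 := by nlinarith
    exact (Int.natAbs_lt_iff_sq_lt.2 this).le
  · refine le_trans (Ty.size_int_mono ?_) h1
    simp

theorem matBound_cubicRound (a b c Q : ℤ) (X : List (List ℤ)) :
    MatBound X.length (2 * Ty.int.size Q + 3) (cubicRound a b c Q X) := by
  refine ⟨by simp [cubicRound, mulRound], fun r hr => ?_⟩
  simp only [cubicRound, List.mem_map] at hr
  obtain ⟨⟨r₁, r₂⟩, h, rfl⟩ := hr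
  have h1 := (List.of_mem_zip h).1
  refine ⟨?_, fun y hy => ?_⟩
  · simp only [mulRound, List.mem_map] at h1
    obtain ⟨r, -, rfl⟩ := h1
    simp only [List.length_map, List.length_zip]
    exact min_le_left _ _
  · simp only [List.mem_map] at hy
    obtain ⟨p, -, rfl⟩ := hy
    exact size_clamp_le _ _

/-- From the first round on the clamp alone controls the size, whatever the number of rounds; the
summand for `X` itself covers zero rounds. -/
theorem size_cubicRound_iterate (a b c Q : ℤ) (X : List (List ℤ)) (j : ℕ) :
    ((cubicRound a b c Q)^[j] X).length = X.length ∧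
      matTy.size ((cubicRound a b c Q)^[j] X) ≤ matTy.size X +
        (X.length * ((X.length * ((2 * Ty.int.size Q + 3) + 1) + 1) + 1) + 1) := by
  induction j with
  | zero => simp
  | succ j ih =>
    rw [Function.iterate_succ_apply']
    have h := matBound_cubicRound a b c Q ((cubicRound a b c Q)^[j] X)
    rw [ih.1] at h
    exact ⟨h.1, h.size_le.trans (Nat.le_add_left _ _)⟩

theorem size_squareStep_iterate (num den Q s : ℤ) (X : List (List ℤ)) (j : ℕ) :
    ((squareStep num den Q)^[j] (s, X)).2.length = X.length ∧
      matTy.size ((squareStep num den Q)^[j] (s, X)).2 ≤ matTy.size X +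
        (X.length * ((X.length * ((2 * Ty.int.size Q + 3) + 1) + 1) + 1) + 1) ∧
      Ty.int.size ((squareStep num den Q)^[j] (s, X)).1 ≤ Ty.int.size s + 3 * j := by
  induction j with
  | zero => simp
  | succ j ih =>
    rw [Function.iterate_succ_apply']
    generalize (squareStep num den Q)^[j] (s, X) = t at *
    obtain ⟨h1, h2, h3⟩ := ih
    unfold squareStep
    split_ifs
    · have h := matBound_cubicRound 1 0 1 Q t.2
      rw [h1] at h
      refine ⟨h.1, h.size_le.trans (Nat.le_add_left _ _), ?_⟩
      have e := Ty.size_int_mul_le 2 t.1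
      have e3 : Ty.int.size 2 = 3 := by simp [Ty.size, Nat.size]; decide
      simp only
      omega
    · exact ⟨h1, h2, by omega⟩

namespace PT

theorem input_adj : PT inputTy matTy (fun x => x.1) := fst
theorem input_num : PT inputTy .int (fun x => x.2.1.1) :=
  left (left snd)
theorem input_den : PT inputTy .int (fun x => x.2.1.2) :=
  right (left snd)
theorem input_k : PT inputTy .int (fun x => x.2.2.1) := left (right snd)
theorem input_eta : PT inputTy (.prod .int .int) (fun x => x.2.2.2.1) :=
  left (right (right snd))
theorem input_labels : PT inputTy (.list .int) (fun x => x.2.2.2.2) :=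
  right (right (right snd))

theorem input_n : PT inputTy .int inputN := input_adj.length

end PT

theorem inputN_le_size (x : inputTy.Val) : (inputN x).toNat ≤ inputTy.size x := by
  have h1 : matTy.size x.1 ≤ inputTy.size x := by
    change matTy.size x.1 ≤ matTy.size x.1 + _ + 1; omega
  have h2 : _ < matTy.size _ := Ty.length_lt_size (a := .list .int) x.1
  simp only [inputN, Int.toNat_natCast]
  omega

namespace PT

open Polynomial in
theorem unitQ : PT inputTy .int unitQ := by
  refine PT.iterate (s := .int) (f := fun z : inputTy.Val × ℤ => 2 * z.2)
    (g := fun x => 1000 * (inputN x * inputN x)) (i := fun _ => 1)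
    ((const 1000).mul (input_n.mul input_n)) (const 1) ((const 2).mul snd)
    (1000 * (X * X)) (1000 * (X * X) + 2) (fun x => ?_) (fun x j hj => ?_)
  all_goals
    have h1 := inputN_le_size x
    have e : (1000 * (inputN x * inputN x)).toNat = 1000 * ((inputN x).toNat * (inputN x).toNat) := by
      have : inputN x = ((inputN x).toNat : ℤ) := by simp [inputN]
      rw [this]
      norm_cast
    have h2 := Nat.mul_le_mul h1 h1
    simp only [eval_mul, eval_add, eval_ofNat, eval_X]
  · rw [e]; omega
  · have : (fun t : ℤ => 2 * t)^[j] 1 = 2 ^ j := by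
      simp
    change Ty.int.size ((fun t : ℤ => 2 * t)^[j] 1) ≤ _
    rw [this]
    refine (Ty.size_int_le_of_natAbs_lt (m := j + 1) ?_).trans (by omega)
    rw [Int.natAbs_pow]
    exact Nat.pow_lt_pow_right (by norm_num) (by omega)

theorem walkRound : PT inputTy matTy walkRound :=
  input_adj.map (c := .list .int)
    (f := fun z : inputTy.Val × List ℤ => z.2.map fun y => y * NoisyClustering.unitQ z.1 / z.2.sum)
    (PT.map (a := .prod inputTy (.list .int)) (b := .int) (c := .int)
      (f := fun z : (inputTy.Val × List ℤ) × ℤ =>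
        z.2 * NoisyClustering.unitQ z.1.1 / z.1.2.sum) snd
      ((snd.mul (unitQ.comp (left fst))).div (right fst).sum))

open Polynomial in
theorem powerRound : PT inputTy matTy powerRound := by
  have h0 : PT inputTy matTy fun x =>
      NoisyClustering.cubicRound 1 1 2 (NoisyClustering.unitQ x) (NoisyClustering.walkRound x) :=
    cubicRound 1 1 2 unitQ walkRound
  obtain ⟨B, hB⟩ := h0.size_le
  obtain ⟨R, hR⟩ := unitQ.size_le
  refine right (PT.iterate (s := .prod .int matTy)
    (f := fun z : inputTy.Val × (ℤ × List (List ℤ)) =>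
      squareStep z.1.2.1.1 z.1.2.1.2 (NoisyClustering.unitQ z.1) z.2)
    (g := fun x => 20 * inputN x) (i := fun x => (1, NoisyClustering.cubicRound 1 1 2
      (NoisyClustering.unitQ x) (NoisyClustering.walkRound x)))
    ((const 20).mul input_n) ((const 1).pair h0) ?_
    (20 * X) (B + (B * ((B * ((2 * R + 3) + 1) + 1) + 1) + 1) + 2 + 3 * (20 * X) + 1)
    (fun x => ?_) (fun x j hj => ?_))
  · exact PT.ite (a := .prod inputTy (.prod .int matTy)) (b := .prod .int matTy)
      (((const 10).mul ((input_den.comp fst).mul (input_den.comp fst))).sub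
        ((left snd).mul ((input_num.comp fst).mul (input_num.comp fst))))
      (((const 2).mul (left snd)).pair
        (cubicRound 1 0 1 (unitQ.comp fst) (right snd))) snd
  all_goals
    have h1 := inputN_le_size x
    have e : (20 * inputN x).toNat = 20 * (inputN x).toNat := by
      have : inputN x = ((inputN x).toNat : ℤ) := by simp [inputN]
      rw [this]
      norm_cast
  · simp only [eval_mul, eval_ofNat, eval_X]
    omega
  · obtain ⟨-, h3, h4⟩ := size_squareStep_iterate x.2.1.1 x.2.1.2 (NoisyClustering.unitQ x) 1
      (NoisyClustering.cubicRound 1 1 2 (NoisyClustering.unitQ x)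
        (NoisyClustering.walkRound x)) j
    have h5 := hB x
    have h6 := hR x
    have h7 := Ty.length_lt_size (a := .list .int) (NoisyClustering.cubicRound 1 1 2
      (NoisyClustering.unitQ x) (NoisyClustering.walkRound x))
    have h8 := h7.le.trans h5
    have e3 : Ty.int.size 1 = 2 := by simp [Ty.size]
    have h9 : matTy.size _ ≤ _ := h3.trans (add_le_add h5 (add_le_add_left (Nat.mul_le_mul h8
      (add_le_add_left (add_le_add_left (Nat.mul_le_mul h8
        (add_le_add_left (add_le_add_left (Nat.mul_le_mul_left 2 h6) 3) 1)) 1) 1)) 1))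
    simp only [eval_mul, eval_add, eval_ofNat, eval_X, eval_one]
    rw [Ty.size.eq_2]
    exact le_trans (Nat.add_le_add_right (add_le_add h4 h9) 1) (by omega)

open Polynomial in
theorem projRound : PT inputTy matTy projRound := by
  obtain ⟨B, hB⟩ := powerRound.size_le
  obtain ⟨R, hR⟩ := unitQ.size_le
  refine PT.iterate (s := matTy)
    (f := fun z : inputTy.Val × List (List ℤ) =>
      NoisyClustering.cubicRound 3 (-2) 1 (NoisyClustering.unitQ z.1) z.2)
    (g := fun x => 20 * inputN x) 
    ((const 20).mul input_n) powerRound (cubicRound 3 (-2) 1 (unitQ.comp fst) snd)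
    (20 * X) (B + (B * ((B * ((2 * R + 3) + 1) + 1) + 1) + 1))
    (fun x => ?_) (fun x j hj => ?_)
  · have h1 := inputN_le_size x
    have e : (20 * inputN x).toNat = 20 * (inputN x).toNat := by
      have : inputN x = ((inputN x).toNat : ℤ) := by simp [inputN]
      rw [this]
      norm_cast
    simp only [eval_mul, eval_ofNat, eval_X]
    omega
  · obtain ⟨-, h3⟩ := size_cubicRound_iterate 3 (-2) 1 (NoisyClustering.unitQ x)
      (NoisyClustering.powerRound x) j
    have h5 := hB x
    have h6 := hR x
    have h7 := Ty.length_lt_size (a := .list .int) (NoisyClustering.powerRound x)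
    have h8 := h7.le.trans h5
    have h9 : matTy.size _ ≤ _ := h3.trans (add_le_add h5 (add_le_add_left (Nat.mul_le_mul h8
      (add_le_add_left (add_le_add_left (Nat.mul_le_mul h8
        (add_le_add_left (add_le_add_left (Nat.mul_le_mul_left 2 h6) 3) 1)) 1) 1)) 1))
    simpa only [eval_mul, eval_add, eval_ofNat, eval_X, eval_one] using h9

theorem capEta : PT inputTy (.prod .int .int) capEta :=
  PT.ite (b := .prod .int .int)
    ((left input_eta).sub
      (input_n.mul (right input_eta)))
    (input_n.pair (const 1)) input_eta

theorem bigInd {a : Ty} {f : a.Val → inputTy.Val} {g : a.Val → ℤ} (hf : PT a inputTy f)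
    (hg : PT a .int g) : PT a .int (fun z => bigInd (f z) (g z)) :=
  PT.ite (b := .int)
    (((((const 2).mul ((left capEta).comp hf)).mul
      (input_n.comp hf)).mul hg).sub (((input_k.comp hf).mul
        ((right capEta).comp hf)).mul (unitQ.comp hf)) |>.add (const 1))
    (const 1) (const 0)

theorem excess {a : Ty} {f : a.Val → inputTy.Val} {r : a.Val → List ℤ} {l : a.Val → ℤ}
    (hf : PT a inputTy f) (hr : PT a (.list .int) r) (hl : PT a .int l) :
    PT a .int (fun z => excess (f z) (r z) (l z)) :=
  sum ((hr.zip (input_labels.comp hf)).map (c := .int)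
    (f := fun z : a.Val × (ℤ × ℤ) =>
      NoisyClustering.bigInd (f z.1) z.2.1 * (2 * NoisyClustering.eqInd z.2.2 (l z.1) - 1))
    ((bigInd (hf.comp fst) (left snd)).mul
      (((const 2).mul (eqInd (right snd) (hl.comp fst))).sub
        (const 1))))

end PT

/-- Serves twice: it bounds the size of the state of the majority search, and it shows that every
majority label is one of the given labels. -/
theorem foldl_select_mem {α : Type*} (P : α → Prop) [DecidablePred P] (l : List α) (t : α) :
    l.foldl (fun t y => if P y then y else t) t = t ∨
      l.foldl (fun t y => if P y then y else t) t ∈ l := by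
  induction l generalizing t with
  | nil => simp
  | cons y l ih =>
    rw [List.foldl_cons]
    rcases ih (if P y then y else t) with h | h
    · rw [h]
      split_ifs <;> simp
    · exact Or.inr (List.mem_cons_of_mem _ h)

namespace PT

open Polynomial in
theorem majorityLabels : PT inputTy (.list .int) majorityLabels := by
  obtain ⟨B, hB⟩ := input_labels.size_le
  have h : PT (.prod inputTy (.prod (.list .int) .int)) .int (fun z => z.1.2.2.2.2.foldl
      (fun t l => if 0 < NoisyClustering.excess z.1 z.2.1 l then l else t) z.2.2) := by
    refine PT.foldl (a := .prod inputTy (.prod (.list .int) .int)) (s := .int) (b := .int)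
      (f := fun y : (inputTy.Val × (List ℤ × ℤ)) × (ℤ × ℤ) =>
        if 0 < NoisyClustering.excess y.1.1 y.1.2.1 y.2.2 then y.2.2 else y.2.1)
      (input_labels.comp fst) (right snd)
      (PT.ite (b := .int) (excess (left fst)
        (left (right fst))
        (right snd))
        (right snd) (left snd))
      (X + B) (fun z l₁ l₂ h => ?_)
    simp only [eval_add, eval_X]
    have h2 : inputTy.size z.1 ≤ (Ty.prod inputTy (.prod (.list .int) .int)).size z := by
      rw [Ty.size.eq_2 inputTy]; omega
    have h3 := (hB z.1).trans (natPoly_mono B h2)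
    rcases foldl_select_mem (fun l => 0 < NoisyClustering.excess z.1 z.2.1 l) l₁ z.2.2 with h1 | h1
    · change Ty.int.size (l₁.foldl (fun t l =>
        if 0 < NoisyClustering.excess z.1 z.2.1 l then l else t) z.2.2) ≤ _
      rw [h1]
      have : Ty.int.size z.2.2 ≤ (Ty.prod inputTy (.prod (.list .int) .int)).size z := by
        simp only [Ty.size.eq_2]; omega
      omega
    · change Ty.int.size (l₁.foldl (fun t l =>
        if 0 < NoisyClustering.excess z.1 z.2.1 l then l else t) z.2.2) ≤ _
      have h4 := Ty.size_le_of_mem (a := .int) h1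
      have h5 := Ty.size_prefix_le (a := .int) h
      exact h4.le.trans (by omega)
  exact (projRound.zip input_labels).map h

theorem boundaryInd {a : Ty} {f : a.Val → inputTy.Val} {h : a.Val → List ℤ} (hf : PT a inputTy f)
    (hh : PT a (.list .int) h) : PT a (.list .int) (fun z => boundaryInd (f z) (h z)) := by
  refine ((input_adj.comp hf).zip hh).map (c := .int)
    (f := fun z : a.Val × (List ℤ × ℤ) =>
      if 0 < 2 * (f z.1).2.1.2 * ((z.2.1.zip (h z.1)).map fun q =>
          q.1 * (1 - NoisyClustering.eqInd z.2.2 q.2)).sum - (f z.1).2.1.1 * z.2.1.sum + 1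
        then 1 else 0)
    (PT.ite (b := .int) ?_ (const 1) (const 0))
  have h1 : PT (.prod a (.prod (.list .int) .int)) (.list .int) (fun z => z.2.1) :=
    left snd
  refine ((((const 2).mul ((input_den.comp hf).comp fst)).mul ?_).sub
    (((input_num.comp hf).comp fst).mul h1.sum)).add (const 1)
  exact ((h1.zip (hh.comp fst)).map (c := .int)
    (f := fun y : (a.Val × (List ℤ × ℤ)) × (ℤ × ℤ) =>
      y.2.1 * (1 - NoisyClustering.eqInd y.1.2.2 y.2.2))
    ((left snd).mul ((const 1).sub
      (eqInd (right (right fst))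
        (right snd))))).sum

theorem differInd {a : Ty} {f : a.Val → inputTy.Val} {h : a.Val → List ℤ} (hf : PT a inputTy f)
    (hh : PT a (.list .int) h) : PT a (.list .int) (fun z => differInd (f z) (h z)) :=
  PT.map (b := .prod .int .int) (c := .int)
    (f := fun z : a.Val × (ℤ × ℤ) => 1 - NoisyClustering.eqInd z.2.1 z.2.2)
    ((input_labels.comp hf).zip hh)
    ((const 1).sub (eqInd (left snd) (right snd)))

theorem growStep {a : Ty} {f : a.Val → List (List ℤ)} {g h : a.Val → List ℤ} (hf : PT a matTy f)
    (hg : PT a (.list .int) g) (hh : PT a (.list .int) h) :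
    PT a (.list .int) (fun z => growStep (f z) (g z) (h z)) :=
  PT.map (b := .prod (.list .int) (.prod .int .int)) (c := .int)
    (f := fun z : a.Val × (List ℤ × (ℤ × ℤ)) =>
      if 0 < z.2.2.2 + z.2.2.1 * NoisyClustering.dot z.2.1 (h z.1) then 1 else 0)
    (hf.zip (hg.zip hh))
    (PT.ite (b := .int)
      ((right (right snd)).add
        ((left (right snd)).mul
          (dot (left snd) (hh.comp fst))))
      (const 1) (const 0))

end PT

theorem size_growStep_le (A : List (List ℤ)) (F T : List ℤ) :
    (Ty.list .int).size (growStep A F T) ≤ A.length * 3 + 1 := by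
  refine (Ty.size_list_le (a := .int) (K := 2) ?_).trans ?_
  · intro y hy
    simp only [growStep, List.mem_map] at hy
    obtain ⟨p, -, rfl⟩ := hy
    split_ifs <;> simp [Ty.size]
  · simp only [growStep, List.length_map, List.length_zip]
    gcongr
    exact min_le_left _ _

namespace PT

open Polynomial in
theorem keepInd {a : Ty} {f : a.Val → inputTy.Val} {h : a.Val → List ℤ} (hf : PT a inputTy f)
    (hh : PT a (.list .int) h) : PT a (.list .int) (fun z => keepInd (f z) (h z)) := by
  have h0 : PT a (.list .int) (fun z => ((NoisyClustering.differInd (f z) (h z)).zip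
      (NoisyClustering.boundaryInd (f z) (h z))).map fun p => p.1 * p.2) :=
    ((differInd hf hh).zip (boundaryInd hf hh)).map (c := .int)
      (f := fun z : a.Val × (ℤ × ℤ) => z.2.1 * z.2.2)
      ((left snd).mul (right snd))
  obtain ⟨B, hB⟩ := h0.size_le
  obtain ⟨R, hR⟩ := hf.size_le
  refine PT.iterate (s := .list .int)
    (f := fun z : a.Val × List ℤ =>
      NoisyClustering.growStep (f z.1).1 (NoisyClustering.differInd (f z.1) (h z.1)) z.2)
    (g := fun z => inputN (f z)) (input_n.comp hf) h0
    (growStep (input_adj.comp (hf.comp fst)) (differInd (hf.comp fst) (hh.comp fst)) snd)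
    R (B + (R * 3 + 1)) (fun x => (inputN_le_size _).trans (hR x)) (fun x j hj => ?_)
  simp only [eval_add, eval_mul, eval_ofNat, eval_one]
  rcases j with _ | j
  · exact (hB x).trans (Nat.le_add_right _ _)
  · rw [Function.iterate_succ_apply']
    refine (size_growStep_le _ _ _).trans ?_
    have := (inputN_le_size (f x)).trans (hR x)
    simp only [inputN, Int.toNat_natCast] at this
    omega

theorem denoise : PT inputTy (.list .int) denoise :=
  PT.map (b := .prod .int (.prod .int .int)) (c := .int)
    (f := fun z : inputTy.Val × (ℤ × (ℤ × ℤ)) => if 0 < z.2.1 then z.2.2.1 else z.2.2.2)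
    ((keepInd id majorityLabels).zip (input_labels.zip majorityLabels))
    (PT.ite (b := .int) (left snd)
      (left (right snd))
      (right (right snd)))

end PT

end NoisyClustering

namespace NoisyClustering

/-! ## Cheeger's inequality -/

section Cheeger

variable {V : Type*} [DecidableEq V] (C : Finset V) (w : V → V → ℝ)

/-- Discrete co-area inequality. -/
theorem coarea (hw : ∀ u v, 0 ≤ w u v) (hsymm : ∀ u v, w u v = w v u) {c : ℝ}
    (hexp : ∀ S ⊆ C, 2 * S.card ≤ C.card → c * S.card ≤ ∑ u ∈ S, ∑ v ∈ C \ S, w u v)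
    (h : V → ℝ) (h0 : ∀ u, 0 ≤ h u) (hS : 2 * (C.filter fun u => h u ≠ 0).card ≤ C.card) :
    2 * c * ∑ u ∈ C, h u ≤ ∑ u ∈ C, ∑ v ∈ C, w u v * |h u - h v| := by
  induction hm : (C.filter fun u => h u ≠ 0).card using Nat.strong_induction_on generalizing h with
  | _ m ih =>
  set S := C.filter fun u => h u ≠ 0 with hSdef
  rcases S.eq_empty_or_nonempty with hE | hne
  · have : ∀ u ∈ C, h u = 0 := by
      intro u hu
      by_contra hc
      have : u ∈ S := by simp [hSdef, hu, hc]
      simp [hE] at this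
    rw [Finset.sum_eq_zero this, mul_zero]
    exact Finset.sum_nonneg fun u _ => Finset.sum_nonneg fun v _ =>
      mul_nonneg (hw u v) (abs_nonneg _)
  · obtain ⟨u₀, hu₀, hmin⟩ := S.exists_min_image h hne
    have hu₀' := Finset.mem_filter.1 hu₀
    set t := h u₀ with ht
    have htpos : 0 < t := lt_of_le_of_ne (h0 u₀) (Ne.symm hu₀'.2)
    let h' : V → ℝ := fun u => if u ∈ S then h u - t else h u
    have h'0 : ∀ u, 0 ≤ h' u := by
      intro u
      by_cases hu : u ∈ S
      · simp only [h', hu, if_true]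
        linarith [hmin u hu]
      · simp only [h', hu, if_false]
        exact h0 u
    have hsub : (C.filter fun u => h' u ≠ 0) ⊆ S.erase u₀ := by
      intro u hu
      rw [Finset.mem_filter] at hu
      have huS : u ∈ S := by
        by_contra hc
        simp only [h', hc, if_false] at hu
        exact hc (Finset.mem_filter.2 hu)
      refine Finset.mem_erase.2 ⟨?_, huS⟩
      rintro rfl
      simp [h', huS, ht] at hu
    have hcard : (C.filter fun u => h' u ≠ 0).card < S.card :=
      (Finset.card_le_card hsub).trans_lt (Finset.card_erase_lt_of_mem hu₀)
    have hSC : S ⊆ C := Finset.filter_subset _ _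
    have IH := ih _ (hm ▸ hcard) h' h'0 (by omega) rfl
    have hsum : ∑ u ∈ C, h u = t * S.card + ∑ u ∈ C, h' u := by
      have : ∀ u ∈ C, h u = (if u ∈ S then t else 0) + h' u := by
        intro u _
        by_cases hu : u ∈ S <;> simp [h', hu]
      rw [Finset.sum_congr rfl this, Finset.sum_add_distrib, Finset.sum_ite_mem,
        Finset.inter_eq_right.2 hSC]
      simp [mul_comm]
    have hzero : ∀ u ∈ C, u ∉ S → h u = 0 := by
      intro u hu hc
      by_contra hne
      exact hc (Finset.mem_filter.2 ⟨hu, hne⟩)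
    -- The subtraction changes a difference only across the cut of `S`, and there by exactly `t`.
    -- Each cut edge is met in both orders, which accounts for the factor 2 in the claim.
    have hterm : ∀ u ∈ C, ∀ v ∈ C, w u v * |h u - h v| =
        (if u ∈ S then (if v ∈ C \ S then t * w u v else 0) else 0) +
        (if v ∈ S then (if u ∈ C \ S then t * w u v else 0) else 0) +
          w u v * |h' u - h' v| := by
      intro u hu v hv
      by_cases hu' : u ∈ S <;> by_cases hv' : v ∈ S
      · simp [h', hu', hv']
      · simp only [h', hu', hv', hv, if_true, if_false, Finset.mem_sdiff, not_false_eq_true,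
          and_self, hzero v hv hv', sub_zero]
        rw [abs_of_nonneg (h0 u), abs_of_nonneg (by linarith [hmin u hu'])]
        ring
      · simp only [h', hu', hv', hu, if_true, if_false, Finset.mem_sdiff, not_false_eq_true,
          and_self, hzero u hu hu', zero_sub, abs_neg]
        rw [abs_of_nonneg (h0 v), abs_of_nonneg (by linarith [hmin v hv'])]
        ring
      · simp [h', hu', hv']
    have hcut : ∑ u ∈ C, ∑ v ∈ C, (if u ∈ S then (if v ∈ C \ S then t * w u v else 0) else 0) =
        t * ∑ u ∈ S, ∑ v ∈ C \ S, w u v := by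
      have : ∀ u ∈ C, ∑ v ∈ C, (if u ∈ S then (if v ∈ C \ S then t * w u v else 0) else 0) =
          if u ∈ S then t * ∑ v ∈ C \ S, w u v else 0 := by
        intro u _
        by_cases hu : u ∈ S
        · simp only [hu, if_true]
          rw [Finset.sum_ite_mem, Finset.inter_eq_right.2 Finset.sdiff_subset, Finset.mul_sum]
        · simp [hu]
      rw [Finset.sum_congr rfl this, Finset.sum_ite_mem, Finset.inter_eq_right.2 hSC,
        Finset.mul_sum]
    have hcut' : ∑ u ∈ C, ∑ v ∈ C, (if v ∈ S then (if u ∈ C \ S then t * w u v else 0) else 0) =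
        t * ∑ u ∈ S, ∑ v ∈ C \ S, w u v := by
      rw [Finset.sum_comm, ← hcut]
      refine Finset.sum_congr rfl fun u _ => Finset.sum_congr rfl fun v _ => ?_
      rw [hsymm]
    rw [Finset.sum_congr rfl fun u hu => Finset.sum_congr rfl (hterm u hu)]
    simp only [Finset.sum_add_distrib]
    rw [hcut, hcut', hsum]
    have := mul_le_mul_of_nonneg_left (hexp S hSC hS) htpos.le
    linarith

/-- Cheeger's inequality for a function supported on at most half of the set. -/
theorem cheeger_half (hw : ∀ u v, 0 ≤ w u v) (hsymm : ∀ u v, w u v = w v u) {φ d : ℝ} (hd : 0 < d)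
    (hφ : 0 ≤ φ) (hdeg : ∀ u ∈ C, ∑ v ∈ C, w u v ≤ d)
    (hexp : ∀ S ⊆ C, 2 * S.card ≤ C.card → φ * d * S.card ≤ ∑ u ∈ S, ∑ v ∈ C \ S, w u v)
    (g : V → ℝ) (hS : 2 * (C.filter fun u => g u ≠ 0).card ≤ C.card) :
    φ ^ 2 * d * ∑ u ∈ C, g u ^ 2 ≤ ∑ u ∈ C, ∑ v ∈ C, w u v * (g u - g v) ^ 2 := by
  have h1 := coarea C w hw hsymm hexp (fun u => g u ^ 2) (fun u => sq_nonneg _) (by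
    simpa only [ne_eq, OfNat.ofNat_ne_zero, not_false_eq_true, pow_eq_zero_iff] using hS)
  set A := ∑ u ∈ C, g u ^ 2 with hA
  have hA0 : 0 ≤ A := Finset.sum_nonneg fun u _ => sq_nonneg _
  rw [← Finset.sum_product'] at h1 ⊢
  -- Cauchy–Schwarz after factoring the difference of squares.
  have h2 : (∑ x ∈ C ×ˢ C, w x.1 x.2 * |g x.1 ^ 2 - g x.2 ^ 2|) ^ 2 ≤
      (∑ x ∈ C ×ˢ C, w x.1 x.2 * (g x.1 - g x.2) ^ 2) *
        ∑ x ∈ C ×ˢ C, w x.1 x.2 * (g x.1 + g x.2) ^ 2 := by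
    refine Finset.sum_sq_le_sum_mul_sum_of_sq_le_mul _ (fun x _ => mul_nonneg (hw _ _) (sq_nonneg _))
      (fun x _ => mul_nonneg (hw _ _) (sq_nonneg _)) fun x _ => ?_
    rw [mul_pow, sq_abs]
    exact le_of_eq (by ring)
  have h3 : ∑ x ∈ C ×ˢ C, w x.1 x.2 * (g x.1 + g x.2) ^ 2 ≤ 4 * d * A := by
    have h4 : ∑ x ∈ C ×ˢ C, w x.1 x.2 * (g x.1 + g x.2) ^ 2 ≤
        ∑ x ∈ C ×ˢ C, (2 * (w x.1 x.2 * g x.1 ^ 2) + 2 * (w x.2 x.1 * g x.2 ^ 2)) := by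
      refine Finset.sum_le_sum fun x _ => ?_
      rw [hsymm x.2 x.1]
      have := mul_le_mul_of_nonneg_left
        (show (g x.1 + g x.2) ^ 2 ≤ 2 * g x.1 ^ 2 + 2 * g x.2 ^ 2 by
          nlinarith [sq_nonneg (g x.1 - g x.2)]) (hw x.1 x.2)
      linarith
    have h5 : ∑ u ∈ C, ∑ v ∈ C, w u v * g u ^ 2 ≤ d * A := by
      rw [hA, Finset.mul_sum]
      refine Finset.sum_le_sum fun u hu => ?_
      rw [← Finset.sum_mul]
      exact mul_le_mul_of_nonneg_right (hdeg u hu) (sq_nonneg _)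
    have h6 : ∑ u ∈ C, ∑ v ∈ C, w v u * g v ^ 2 ≤ d * A := by
      rw [Finset.sum_comm]; exact h5
    rw [Finset.sum_add_distrib, ← Finset.mul_sum, ← Finset.mul_sum,
      Finset.sum_product' C C fun u v => w u v * g u ^ 2,
      Finset.sum_product' C C fun u v => w v u * g v ^ 2] at h4
    linarith
  set D := ∑ x ∈ C ×ˢ C, w x.1 x.2 * (g x.1 - g x.2) ^ 2
  have hD : 0 ≤ D := Finset.sum_nonneg fun x _ => mul_nonneg (hw _ _) (sq_nonneg _)
  rcases hA0.eq_or_lt with hz | hpos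
  · rw [← hz]; simpa using hD
  · have h7 : (2 * (φ * d) * A) ^ 2 ≤ D * (4 * d * A) := by
      refine le_trans (pow_le_pow_left₀ (by positivity) h1 2) (h2.trans ?_)
      exact mul_le_mul_of_nonneg_left h3 hD
    have h8 : (4 * d * A) * (φ ^ 2 * d * A) ≤ (4 * d * A) * D := by nlinarith
    exact le_of_mul_le_mul_left h8 (by positivity)

/-- Take the least value exceeded by at most half of the points. The next smaller value is exceeded
by more than half of them, and these points are disjoint from those below the chosen value. -/
theorem exists_median (y : V → ℝ) (hC : C.Nonempty) :
    ∃ m, 2 * (C.filter fun u => m < y u).card ≤ C.card ∧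
      2 * (C.filter fun u => y u < m).card ≤ C.card := by
  let T := C.filter fun u => 2 * (C.filter fun v => y u < y v).card ≤ C.card
  have hT : T.Nonempty := by
    obtain ⟨u, hu, hmax⟩ := C.exists_max_image y hC
    refine ⟨u, Finset.mem_filter.2 ⟨hu, ?_⟩⟩
    have : (C.filter fun v => y u < y v) = ∅ := by
      rw [Finset.filter_eq_empty_iff]
      intro v hv
      exact not_lt.2 (hmax v hv)
    simp [this]
  obtain ⟨u, hu, hmin⟩ := T.exists_min_image y hT
  refine ⟨y u, (Finset.mem_filter.1 hu).2, ?_⟩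
  rcases (C.filter fun v => y v < y u).eq_empty_or_nonempty with hE | hne
  · simp [hE]
  · obtain ⟨v, hv, hmax⟩ := (C.filter fun v => y v < y u).exists_max_image y hne
    rw [Finset.mem_filter] at hv
    have hvT : v ∉ T := fun h => absurd (hmin v h) (not_le.2 hv.2)
    have hv' : C.card < 2 * (C.filter fun x => y v < y x).card := by
      by_contra hc
      exact hvT (Finset.mem_filter.2 ⟨hv.1, not_lt.1 hc⟩)
    have hdisj : Disjoint (C.filter fun x => y v < y x) (C.filter fun x => y x < y u) := by
      rw [Finset.disjoint_left]
      intro x hx hx'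
      exact absurd (hmax x hx') (not_le.2 (Finset.mem_filter.1 hx).2)
    have := Finset.card_le_card (Finset.union_subset
      (Finset.filter_subset (fun x => y v < y x) C) (Finset.filter_subset (fun x => y x < y u) C))
    rw [Finset.card_union_of_disjoint hdisj] at this
    omega

/-- Cheeger's inequality. -/
theorem cheeger (hw : ∀ u v, 0 ≤ w u v) (hsymm : ∀ u v, w u v = w v u) {φ d : ℝ} (hd : 0 < d)
    (hφ : 0 ≤ φ) (hdeg : ∀ u ∈ C, ∑ v ∈ C, w u v ≤ d)
    (hexp : ∀ S ⊆ C, 2 * S.card ≤ C.card → φ * d * S.card ≤ ∑ u ∈ S, ∑ v ∈ C \ S, w u v)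
    (y : V → ℝ) (hy : ∑ u ∈ C, y u = 0) :
    φ ^ 2 * d * ∑ u ∈ C, y u ^ 2 ≤ ∑ u ∈ C, ∑ v ∈ C, w u v * (y u - y v) ^ 2 := by
  rcases C.eq_empty_or_nonempty with rfl | hC
  · simp
  obtain ⟨m, hm1, hm2⟩ := exists_median C y hC
  have hp := cheeger_half C w hw hsymm hd hφ hdeg hexp (fun u => max (y u - m) 0)
    (by
      convert hm1 using 5 with u
      simp only [ne_eq, max_eq_right_iff, tsub_le_iff_right, zero_add, not_le])
  have hn := cheeger_half C w hw hsymm hd hφ hdeg hexp (fun u => max (m - y u) 0)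
    (by
      convert hm2 using 5 with u
      simp only [ne_eq, max_eq_right_iff, tsub_le_iff_right, zero_add, not_le])
  -- As `y` has mean zero, shifting by the median can only increase the sum of squares.
  have h1 : ∑ u ∈ C, y u ^ 2 ≤ ∑ u ∈ C, max (y u - m) 0 ^ 2 + ∑ u ∈ C, max (m - y u) 0 ^ 2 := by
    have e : ∀ u ∈ C, max (y u - m) 0 ^ 2 + max (m - y u) 0 ^ 2 =
        y u ^ 2 - 2 * m * y u + m ^ 2 := by
      intro u _
      rcases le_total (y u) m with h | h
      · rw [max_eq_right (by linarith), max_eq_left (by linarith)]; ring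
      · rw [max_eq_left (by linarith), max_eq_right (by linarith)]; ring
    rw [← Finset.sum_add_distrib, Finset.sum_congr rfl e, Finset.sum_add_distrib,
      Finset.sum_sub_distrib, ← Finset.mul_sum, hy]
    have : 0 ≤ ∑ _u ∈ C, m ^ 2 := Finset.sum_nonneg fun _ _ => sq_nonneg _
    linarith
  -- The positive and negative parts split `y u - y v` into two numbers of the same sign, so their
  -- squares add up to at most its square.
  have h2 : ∑ u ∈ C, ∑ v ∈ C, w u v * (max (y u - m) 0 - max (y v - m) 0) ^ 2 +
      ∑ u ∈ C, ∑ v ∈ C, w u v * (max (m - y u) 0 - max (m - y v) 0) ^ 2 ≤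
      ∑ u ∈ C, ∑ v ∈ C, w u v * (y u - y v) ^ 2 := by
    simp only [← Finset.sum_add_distrib, ← mul_add]
    refine Finset.sum_le_sum fun u _ => Finset.sum_le_sum fun v _ =>
      mul_le_mul_of_nonneg_left ?_ (hw u v)
    rcases le_total (y u) m with h | h <;> rcases le_total (y v) m with h' | h'
    · rw [max_eq_right (by linarith), max_eq_right (by linarith), max_eq_left (by linarith),
        max_eq_left (by linarith)]; nlinarith
    · rw [max_eq_right (by linarith), max_eq_left (by linarith), max_eq_left (by linarith),
        max_eq_right (by linarith)]; nlinarith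
    · rw [max_eq_left (by linarith), max_eq_right (by linarith), max_eq_right (by linarith),
        max_eq_left (by linarith)]; nlinarith
    · rw [max_eq_left (by linarith), max_eq_left (by linarith), max_eq_right (by linarith),
        max_eq_right (by linarith)]; nlinarith
  have h3 := mul_le_mul_of_nonneg_left h1 (show 0 ≤ φ ^ 2 * d by positivity)
  linarith

end Cheeger

end NoisyClustering

namespace NoisyClustering

/-! ## Functions of a symmetric matrix -/

section Spectral

open Matrix

variable {V : Type*} [Fintype V]

/-- The orthogonal projection to the span of the indicators of the clusters. -/
noncomputable def clusterProj {k : ℕ} (ι : V → Fin k) (u v : V) : ℝ :=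
  if ι u = ι v then 1 / ((cluster ι (ι u)).card : ℝ) else 0

theorem sum_cluster {k : ℕ} (ι : V → Fin k) (f : V → ℝ) :
    ∑ i, ∑ u ∈ cluster ι i, f u = ∑ u, f u :=
  Finset.sum_fiberwise_of_maps_to (fun _ _ => Finset.mem_univ _) f

theorem sum_mul_clusterProj {k : ℕ} (ι : V → Fin k) (f : V → V → ℝ) :
    ∑ u, ∑ v, f u v * clusterProj ι u v =
      ∑ i, (1 / ((cluster ι i).card : ℝ)) * ∑ u ∈ cluster ι i, ∑ v ∈ cluster ι i, f u v := by
  rw [← sum_cluster ι]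
  refine Finset.sum_congr rfl fun i _ => ?_
  rw [Finset.mul_sum]
  refine Finset.sum_congr rfl fun u hu => ?_
  have hu' : ι u = i := (Finset.mem_filter.1 hu).2
  rw [Finset.mul_sum, cluster, Finset.sum_filter]
  refine Finset.sum_congr rfl fun v _ => ?_
  rw [clusterProj, hu']
  by_cases h : ι v = i
  · rw [if_pos h, if_pos h.symm]; exact mul_comm _ _
  · rw [if_neg h, if_neg (Ne.symm h)]; ring

variable [DecidableEq V]

/-- The symmetric matrix with the columns of `U` as eigenvectors and the eigenvalues `l`. -/
def specMat (U : Matrix V V ℝ) (l : V → ℝ) : Matrix V V ℝ := U * diagonal l * Uᵀ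

theorem exists_specMat (P : Matrix V V ℝ) (hP : P.IsSymm) :
    ∃ (U : Matrix V V ℝ) (l : V → ℝ), Uᵀ * U = 1 ∧ U * Uᵀ = 1 ∧ P = specMat U l := by
  have hH : P.IsHermitian := by
    rw [Matrix.IsHermitian, conjTranspose_eq_transpose_of_trivial]
    exact hP
  have hU := Unitary.coe_star_mul_self hH.eigenvectorUnitary
  rw [Matrix.star_eq_conjTranspose, conjTranspose_eq_transpose_of_trivial] at hU
  refine ⟨hH.eigenvectorUnitary, hH.eigenvalues, hU, mul_eq_one_comm.1 hU, ?_⟩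
  · have := hH.spectral_theorem
    rw [Unitary.conjStarAlgAut_apply, Matrix.star_eq_conjTranspose,
      conjTranspose_eq_transpose_of_trivial] at this
    exact this

theorem specMat_apply (U : Matrix V V ℝ) (l : V → ℝ) (u v : V) :
    specMat U l u v = ∑ j, l j * (U u j * U v j) := by
  rw [specMat, Matrix.mul_apply]
  refine Finset.sum_congr rfl fun j _ => ?_
  rw [Matrix.mul_diagonal, Matrix.transpose_apply]
  ring

theorem specMat_symm (U : Matrix V V ℝ) (l : V → ℝ) (u v : V) :
    specMat U l u v = specMat U l v u := by
  simp only [specMat_apply, mul_comm (U u _)]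

theorem specMat_mul {U : Matrix V V ℝ} (hU : Uᵀ * U = 1) (l m : V → ℝ) :
    specMat U l * specMat U m = specMat U (fun j => l j * m j) := by
  unfold specMat
  calc U * diagonal l * Uᵀ * (U * diagonal m * Uᵀ)
      = U * diagonal l * (Uᵀ * U) * diagonal m * Uᵀ := by simp only [Matrix.mul_assoc]
    _ = _ := by rw [hU, Matrix.mul_one, Matrix.mul_assoc U, diagonal_mul_diagonal]

theorem sum_specMat_mul {U : Matrix V V ℝ} (hU : Uᵀ * U = 1) (l m : V → ℝ) (u v : V) :
    ∑ w, specMat U l u w * specMat U m v w = specMat U (fun j => l j * m j) u v := by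
  rw [← specMat_mul hU, Matrix.mul_apply]
  exact Finset.sum_congr rfl fun w _ => by rw [specMat_symm U m]

/-- Rows of an orthogonal matrix are unit vectors, so this is the inequality of arithmetic and
geometric means. It makes rounding errors propagate linearly and keeps the exact entries within the
clamping range. -/
theorem abs_specMat_le {U : Matrix V V ℝ} (hU : U * Uᵀ = 1) {l : V → ℝ} (hl : ∀ j, |l j| ≤ 1)
    (u v : V) : |specMat U l u v| ≤ 1 := by
  have hrow : ∀ u, ∑ j, U u j ^ 2 = 1 := by
    intro u
    have := congrFun (congrFun hU u) u
    rw [Matrix.mul_apply, Matrix.one_apply_eq] at this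
    rw [← this]
    exact Finset.sum_congr rfl fun j _ => by rw [Matrix.transpose_apply]; ring
  rw [specMat_apply]
  calc |∑ j, l j * (U u j * U v j)| ≤ ∑ j, |l j * (U u j * U v j)| :=
        Finset.abs_sum_le_sum_abs _ _
    _ ≤ ∑ j, (U u j ^ 2 + U v j ^ 2) / 2 := by
        refine Finset.sum_le_sum fun j _ => ?_
        rw [abs_mul, abs_mul]
        have h1 : |l j| * (|U u j| * |U v j|) ≤ 1 * (|U u j| * |U v j|) :=
          mul_le_mul_of_nonneg_right (hl j) (by positivity)
        have h2 := sq_nonneg (|U u j| - |U v j|)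
        rw [← sq_abs (U u j), ← sq_abs (U v j)]
        linarith
    _ = 1 := by
        rw [← Finset.sum_div, Finset.sum_add_distrib, hrow, hrow]
        norm_num

theorem sum_sq_specMat {U : Matrix V V ℝ} (hU : Uᵀ * U = 1) (l : V → ℝ) :
    ∑ u, ∑ v, specMat U l u v ^ 2 = ∑ j, l j ^ 2 := by
  have h1 : ∀ u, ∑ v, specMat U l u v ^ 2 = specMat U (fun j => l j * l j) u u := by
    intro u
    rw [← sum_specMat_mul hU]
    exact Finset.sum_congr rfl fun v _ => sq _
  have hcol : ∀ j, ∑ u, U u j * U u j = 1 := by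
    intro j
    have := congrFun (congrFun hU j) j
    rw [Matrix.mul_apply, Matrix.one_apply_eq] at this
    rw [← this]
    exact Finset.sum_congr rfl fun u _ => by rw [Matrix.transpose_apply]
  rw [Finset.sum_congr rfl fun u _ => h1 u]
  simp only [specMat_apply]
  rw [Finset.sum_comm]
  refine Finset.sum_congr rfl fun j _ => ?_
  rw [← Finset.mul_sum, hcol, mul_one, sq]

theorem specMat_quad (U : Matrix V V ℝ) (l : V → ℝ) (x y : V → ℝ) :
    ∑ u, ∑ v, x u * specMat U l u v * y v =
      ∑ j, l j * ((∑ u, U u j * x u) * ∑ v, U v j * y v) := by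
  simp only [specMat_apply, Finset.sum_mul, Finset.mul_sum]
  rw [Finset.sum_congr rfl fun u _ => Finset.sum_comm, Finset.sum_comm]
  refine Finset.sum_congr rfl fun j _ => ?_
  rw [Finset.sum_comm]
  refine Finset.sum_congr rfl fun v _ => Finset.sum_congr rfl fun u _ => by ring

theorem sum_sq_coord {U : Matrix V V ℝ} (hU : U * Uᵀ = 1) (x : V → ℝ) :
    ∑ j, (∑ u, U u j * x u) ^ 2 = ∑ u, x u ^ 2 := by
  have h := specMat_quad U (fun _ => 1) x x
  have h1 : specMat U (fun _ => 1) = 1 := by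
    unfold specMat
    rw [diagonal_one, Matrix.mul_one, hU]
  rw [h1] at h
  simp only [one_mul, ← sq] at h
  rw [← h]
  refine Finset.sum_congr rfl fun u _ => ?_
  rw [Finset.sum_eq_single u]
  · rw [Matrix.one_apply_eq]; ring
  · intro v _ hv
    rw [Matrix.one_apply_ne (Ne.symm hv)]; ring
  · simp

/-- The number of large eigenvalues is at most the codimension of a space on which the quadratic
form is small. -/
theorem card_large_eigenvalues {U : Matrix V V ℝ} (hU : Uᵀ * U = 1) (l : V → ℝ)
    {k : ℕ} (b : Fin k → V → ℝ) {c : ℝ}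
    (hc : ∀ y : V → ℝ, (∀ i, ∑ u, b i u * y u = 0) →
      ∑ u, ∑ v, y u * specMat U l u v * y v ≤ c * ∑ u, y u ^ 2) :
    (Finset.univ.filter fun j => c < l j).card ≤ k := by
  by_contra hlt
  push Not at hlt
  set J := Finset.univ.filter fun j => c < l j with hJ
  -- With more than `k` eigenvectors available, some nonzero combination of them satisfies all `k`
  -- orthogonality conditions; on it the form exceeds `c` times the squared norm.
  let T : (J → ℝ) →ₗ[ℝ] (Fin k → ℝ) :=
    { toFun := fun z i => ∑ u, b i u * ∑ j : J, z j * U u j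
      map_add' := by
        intro z z'
        ext i
        simp only [Pi.add_apply, add_mul, Finset.sum_add_distrib, mul_add]
      map_smul' := by
        intro r z
        ext i
        simp only [Pi.smul_apply, smul_eq_mul, RingHom.id_apply, Finset.mul_sum]
        exact Finset.sum_congr rfl fun u _ => Finset.sum_congr rfl fun j _ => by ring }
  have hker : LinearMap.ker T ≠ ⊥ := LinearMap.ker_ne_bot_of_finrank_lt (by simpa using hlt)
  obtain ⟨z, hz, hz0⟩ := (Submodule.ne_bot_iff _).1 hker
  have hz' : ∀ i, ∑ u, b i u * ∑ j : J, z j * U u j = 0 := fun i => congrFun hz i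
  have h1 := hc _ hz'
  have hcol : ∀ i j, ∑ u, U u i * U u j = if i = j then 1 else 0 := by
    intro i j
    have := congrFun (congrFun hU i) j
    rw [Matrix.mul_apply, Matrix.one_apply] at this
    rw [← this]
    exact Finset.sum_congr rfl fun u _ => by rw [Matrix.transpose_apply]
  have hcoord : ∀ i, ∑ u, U u i * ∑ j : J, z j * U u j =
      if h : i ∈ J then z ⟨i, h⟩ else 0 := by
    intro i
    simp only [Finset.mul_sum]
    rw [Finset.sum_comm]
    have : ∀ j : J, ∑ u, U u i * (z j * U u j) = if i = j then z j else 0 := by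
      intro j
      have := congrArg (fun t => z j * t) (hcol i j)
      simp only [Finset.mul_sum, mul_ite, mul_one, mul_zero] at this
      rw [← this]
      exact Finset.sum_congr rfl fun u _ => by ring
    rw [Finset.sum_congr rfl fun j _ => this j]
    split_ifs with h
    · rw [Finset.sum_eq_single ⟨i, h⟩]
      · simp
      · intro j _ hj
        rw [if_neg]
        rintro rfl
        exact hj rfl
      · simp
    · refine Finset.sum_eq_zero fun j _ => if_neg ?_
      rintro rfl
      exact h j.2
  rw [specMat_quad] at h1
  have hU' : U * Uᵀ = 1 := mul_eq_one_comm.1 hU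
  rw [← sum_sq_coord hU', Finset.mul_sum] at h1
  simp only [hcoord] at h1
  have hex : ∃ j : J, z j ≠ 0 := by
    by_contra hc
    push Not at hc
    exact hz0 (funext hc)
  obtain ⟨j₀, hj₀⟩ := hex
  refine absurd h1 (not_le.2 (Finset.sum_lt_sum (fun i _ => ?_) ⟨j₀, Finset.mem_univ _, ?_⟩))
  · split_ifs with h
    · have : c < l i := (Finset.mem_filter.1 h).2
      nlinarith [sq_nonneg (z ⟨i, h⟩)]
    · simp
  · have h2 : c < l j₀ := (Finset.mem_filter.1 j₀.2).2
    rw [dif_pos j₀.2]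
    have : 0 < z j₀ ^ 2 := by positivity
    nlinarith

/-- If few eigenvalues `m` are not small, and the clusters are almost invariant, then the matrix with
the eigenvalues `m` is close to the projection to the cluster indicators. -/
theorem frobenius_specMat_sub {U : Matrix V V ℝ} (hU : Uᵀ * U = 1) (l m : V → ℝ) {k : ℕ}
    (ι : V → Fin k) (hne : ∀ i, (cluster ι i).Nonempty) {K : ℝ}
    (hlow : ∀ j, 1 - K * (1 - l j) ≤ m j) :
    ∑ u, ∑ v, (specMat U m u v - clusterProj ι u v) ^ 2 ≤
      ∑ j, m j ^ 2 - k + 2 * K * ∑ i, (1 - (1 / ((cluster ι i).card : ℝ)) *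
        ∑ u ∈ cluster ι i, ∑ v ∈ cluster ι i, specMat U l u v) := by
  have hU' : U * Uᵀ = 1 := mul_eq_one_comm.1 hU
  have hpos : ∀ i, (0 : ℝ) < (cluster ι i).card := fun i => by
    exact_mod_cast (hne i).card_pos
  -- Expand the square. The squared norm of the projection is its rank `k`, and the cross term is
  -- the sum of the Rayleigh quotients at the normalised indicators.
  have h1 : ∑ u, ∑ v, (specMat U m u v - clusterProj ι u v) ^ 2 =
      ∑ u, ∑ v, specMat U m u v ^ 2 - 2 * ∑ u, ∑ v, specMat U m u v * clusterProj ι u v +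
        ∑ u, ∑ v, clusterProj ι u v * clusterProj ι u v := by
    simp only [Finset.mul_sum, ← Finset.sum_sub_distrib, ← Finset.sum_add_distrib]
    exact Finset.sum_congr rfl fun u _ => Finset.sum_congr rfl fun v _ => by ring
  have h2 : ∑ u, ∑ v, clusterProj ι u v * clusterProj ι u v = k := by
    rw [sum_mul_clusterProj]
    have : ∀ i : Fin k, (1 / ((cluster ι i).card : ℝ)) *
        ∑ u ∈ cluster ι i, ∑ v ∈ cluster ι i, clusterProj ι u v = 1 := by
      intro i
      have h3 : ∀ u ∈ cluster ι i, ∀ v ∈ cluster ι i,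
          clusterProj ι u v = 1 / ((cluster ι i).card : ℝ) := by
        intro u hu v hv
        have hu' : ι u = i := (Finset.mem_filter.1 hu).2
        have hv' : ι v = i := (Finset.mem_filter.1 hv).2
        rw [clusterProj, hu', hv', if_pos rfl]
      rw [Finset.sum_congr rfl fun u hu => Finset.sum_congr rfl (h3 u hu)]
      have := hpos i
      simp only [Finset.sum_const, nsmul_eq_mul]
      field_simp
    rw [Finset.sum_congr rfl fun i _ => this i]
    simp
  have hquad : ∀ (n : V → ℝ) (i : Fin k), ∑ u ∈ cluster ι i, ∑ v ∈ cluster ι i, specMat U n u v =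
      ∑ j, n j * (∑ u, U u j * (if ι u = i then 1 else 0)) ^ 2 := by
    intro n i
    simp only [sq]
    rw [← specMat_quad, cluster, Finset.sum_filter]
    refine Finset.sum_congr rfl fun u _ => ?_
    by_cases hu : ι u = i
    · simp [hu, Finset.sum_filter]
    · simp [hu]
  have hone : ∀ i : Fin k, ∑ j, (∑ u, U u j * (if ι u = i then (1 : ℝ) else 0)) ^ 2 =
      (cluster ι i).card := by
    intro i
    rw [sum_sq_coord hU', cluster, Finset.card_filter]
    push_cast
    exact Finset.sum_congr rfl fun u _ => by split_ifs <;> simp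
  have h3 : ∀ i : Fin k, 1 - K * (1 - (1 / ((cluster ι i).card : ℝ)) *
        ∑ u ∈ cluster ι i, ∑ v ∈ cluster ι i, specMat U l u v) ≤
      (1 / ((cluster ι i).card : ℝ)) * ∑ u ∈ cluster ι i, ∑ v ∈ cluster ι i, specMat U m u v := by
    intro i
    have hp := hpos i
    -- The lower bound on `m j` is affine in `l j`, so it passes to the quadratic forms at the
    -- indicator.
    have h4 : ∑ j, (1 - K * (1 - l j)) * (∑ u, U u j * (if ι u = i then 1 else 0)) ^ 2 ≤
        ∑ j, m j * (∑ u, U u j * (if ι u = i then 1 else 0)) ^ 2 :=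
      Finset.sum_le_sum fun j _ => mul_le_mul_of_nonneg_right (hlow j) (sq_nonneg _)
    have h5 : ∑ j, (1 - K * (1 - l j)) * (∑ u, U u j * (if ι u = i then (1 : ℝ) else 0)) ^ 2 =
        (1 - K) * (cluster ι i).card + K * ∑ u ∈ cluster ι i, ∑ v ∈ cluster ι i, specMat U l u v := by
      rw [hquad, ← hone, Finset.mul_sum, Finset.mul_sum, ← Finset.sum_add_distrib]
      exact Finset.sum_congr rfl fun j _ => by ring
    rw [h5, ← hquad] at h4
    have h6 := mul_le_mul_of_nonneg_left h4 (one_div_nonneg.2 hp.le)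
    have h7 : (1 / ((cluster ι i).card : ℝ)) * (cluster ι i).card = 1 := by field_simp
    calc _ = (1 / ((cluster ι i).card : ℝ)) * ((1 - K) * (cluster ι i).card +
          K * ∑ u ∈ cluster ι i, ∑ v ∈ cluster ι i, specMat U l u v) := by
          rw [mul_add, mul_left_comm, h7]; ring
      _ ≤ _ := h6
  have h4 := Finset.sum_le_sum fun i (_ : i ∈ Finset.univ) => h3 i
  have h5 := sum_mul_clusterProj ι fun u v => specMat U m u v
  rw [Finset.sum_sub_distrib, ← Finset.mul_sum] at h4
  simp only [Finset.sum_const, Finset.card_univ, Fintype.card_fin, nsmul_eq_mul, mul_one] at h4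
  rw [h1, h2, sum_sq_specMat hU]
  linarith

end Spectral

/-! ## The spectral filter -/

section Filter

/-- The purification polynomial. -/
def purify (y : ℝ) : ℝ := 3 * y ^ 2 - 2 * y ^ 3

theorem purify_nonneg {y : ℝ} (h1 : y ≤ 1) : 0 ≤ purify y := by
  have : purify y = y ^ 2 * (3 - 2 * y) := by unfold purify; ring
  rw [this]
  exact mul_nonneg (sq_nonneg _) (by linarith)

theorem purify_le_one {y : ℝ} (h0 : 0 ≤ y) : purify y ≤ 1 := by
  have : 1 - purify y = (1 - y) ^ 2 * (1 + 2 * y) := by unfold purify; ring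
  nlinarith [mul_nonneg (sq_nonneg (1 - y)) (show 0 ≤ 1 + 2 * y by linarith)]

theorem purify_iterate_mem {y : ℝ} (h0 : 0 ≤ y) (h1 : y ≤ 1) (j : ℕ) :
    0 ≤ purify^[j] y ∧ purify^[j] y ≤ 1 := by
  induction j with
  | zero => exact ⟨h0, h1⟩
  | succ j ih =>
    rw [Function.iterate_succ_apply']
    exact ⟨purify_nonneg ih.2, purify_le_one ih.1⟩

/-- The fixed points of the purification are 0, 1/2 and 1, and it moves values between 1/2 and 1
upwards. -/
theorem le_purify_iterate {y : ℝ} (h0 : 1 / 2 ≤ y) (h1 : y ≤ 1) (j : ℕ) : y ≤ purify^[j] y := by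
  induction j with
  | zero => exact le_rfl
  | succ j ih =>
    rw [Function.iterate_succ_apply']
    have h2 := (purify_iterate_mem (by linarith) h1 j).2
    generalize purify^[j] y = z at *
    have : purify z - z = z * ((2 * z - 1) * (1 - z)) := by unfold purify; ring
    have := mul_nonneg (show 0 ≤ z by linarith)
      (mul_nonneg (show 0 ≤ 2 * z - 1 by linarith) (show 0 ≤ 1 - z by linarith))
    linarith

/-- Below 1/10 the leading term satisfies `3y² ≤ (3/10) y`, so each round contracts by 3/10. -/
theorem purify_iterate_le {y : ℝ} (h0 : 0 ≤ y) (h1 : y ≤ 1 / 10) (j : ℕ) :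
    purify^[j] y ≤ (3 / 10) ^ j * (1 / 10) := by
  induction j with
  | zero => simpa using h1
  | succ j ih =>
    rw [Function.iterate_succ_apply']
    have h2 := (purify_iterate_mem h0 (by linarith) j).1
    have h3 : ((3 / 10 : ℝ)) ^ j ≤ 1 := pow_le_one₀ (by norm_num) (by norm_num)
    generalize purify^[j] y = z at *
    have h4 : purify z ≤ 3 / 10 * z := by
      unfold purify
      have : z ≤ 1 / 10 := by linarith
      nlinarith [pow_nonneg h2 3]
    rw [pow_succ]
    nlinarith

/-- The value at `x` of the filter with exponent `s` and `J` rounds of purification. -/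
noncomputable def filterFun (s J : ℕ) (x : ℝ) : ℝ := purify^[J] (((x ^ 2 + x ^ 3) / 2) ^ s)

/-- The factor `1 + x` suppresses eigenvalues near `-1`, which occur for nearly bipartite graphs,
and the factor `x²` makes the result nonnegative. Powers and purification can then work on `[0, 1]`.
-/
theorem start_mem {x : ℝ} (h0 : -1 ≤ x) (h1 : x ≤ 1) :
    0 ≤ (x ^ 2 + x ^ 3) / 2 ∧ (x ^ 2 + x ^ 3) / 2 ≤ (1 + x) / 2 := by
  constructor
  · have : (x ^ 2 + x ^ 3) / 2 = x ^ 2 * (1 + x) / 2 := by ring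
    rw [this]
    exact div_nonneg (mul_nonneg (sq_nonneg _) (by linarith)) (by norm_num)
  · nlinarith [mul_nonneg (mul_nonneg (show 0 ≤ 1 - x by linarith) (show 0 ≤ 1 + x by linarith))
      (show 0 ≤ 1 + x by linarith)]

theorem filterFun_mem {x : ℝ} (h0 : -1 ≤ x) (h1 : x ≤ 1) (s J : ℕ) :
    0 ≤ filterFun s J x ∧ filterFun s J x ≤ 1 := by
  obtain ⟨h2, h3⟩ := start_mem h0 h1
  exact purify_iterate_mem (pow_nonneg h2 _) (pow_le_one₀ h2 (by linarith)) J

/-- The starting polynomial has slope 5/2 at 1, and Bernoulli's inequality bounds its power below by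
`1 - (5/2) s (1 - x)`. If the power is at least 1/2, purification does not lower it. Otherwise the
claimed bound, with the doubled constant 5, is negative. -/
theorem le_filterFun {x : ℝ} (h0 : -1 ≤ x) (h1 : x ≤ 1) (s J : ℕ) :
    1 - 5 * s * (1 - x) ≤ filterFun s J x := by
  obtain ⟨h2, h3⟩ := start_mem h0 h1
  have h4 : 1 - s * (5 / 2 * (1 - x)) ≤ ((x ^ 2 + x ^ 3) / 2) ^ s := by
    have h5 : 1 - 5 / 2 * (1 - x) ≤ (x ^ 2 + x ^ 3) / 2 := by
      nlinarith [mul_nonneg (sq_nonneg (x - 1)) (show 0 ≤ x + 3 by linarith)]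
    have h6 := one_add_mul_le_pow (a := (x ^ 2 + x ^ 3) / 2 - 1) (by linarith) s
    have h7 : (s : ℝ) * (-(5 / 2 * (1 - x))) ≤ s * ((x ^ 2 + x ^ 3) / 2 - 1) :=
      mul_le_mul_of_nonneg_left (by linarith) (Nat.cast_nonneg s)
    rw [add_sub_cancel] at h6
    linarith
  by_cases h : 1 / 2 ≤ ((x ^ 2 + x ^ 3) / 2) ^ s
  · have h8 := le_purify_iterate h (pow_le_one₀ h2 (by linarith)) J
    have h9 : (0 : ℝ) ≤ s * (1 - x) := mul_nonneg (Nat.cast_nonneg s) (by linarith)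
    unfold filterFun
    linarith
  · have := (filterFun_mem h0 h1 s J).1
    linarith

/-- Under a gap `g` the power is at most `(1 - g/2)^s ≤ exp (-s g / 2) ≤ exp (-5/2) ≤ 1/10`, the
range in which purification contracts. -/
theorem filterFun_le {x g : ℝ} (h0 : -1 ≤ x) (h1 : x ≤ 1 - g) (hg : 0 ≤ g) {s : ℕ}
    (hs : 5 ≤ s * g) (J : ℕ) : filterFun s J x ≤ (3 / 10) ^ J * (1 / 10) := by
  obtain ⟨h2, h3⟩ := start_mem h0 (h1.trans (by linarith))
  refine purify_iterate_le (pow_nonneg h2 _) ?_ J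
  have h4 : (x ^ 2 + x ^ 3) / 2 ≤ Real.exp (-(g / 2)) := by
    have := Real.add_one_le_exp (-(g / 2))
    linarith
  refine (pow_le_pow_left₀ h2 h4 s).trans ?_
  rw [← Real.exp_nat_mul]
  have h5 : Real.exp (s * -(g / 2)) ≤ Real.exp (-(5 / 2)) := Real.exp_le_exp.2 (by linarith)
  refine h5.trans ?_
  have h6 : (10 : ℝ) ≤ Real.exp (5 / 2) := by
    have h7 : Real.exp (5 / 2) ^ 2 = Real.exp 1 ^ 5 := by
      rw [← Real.exp_nat_mul, ← Real.exp_nat_mul]; norm_num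
    have h8 : (2.7 : ℝ) ^ 5 ≤ Real.exp 1 ^ 5 :=
      pow_le_pow_left₀ (by norm_num) (by linarith [Real.exp_one_gt_d9]) 5
    nlinarith [Real.exp_pos (5 / 2)]
  rw [Real.exp_neg, one_div]
  exact inv_anti₀ (by norm_num) h6

end Filter

end NoisyClustering

namespace NoisyClustering

/-! ## Fixed point arithmetic -/

section Rounding

variable {n : ℕ}

/-- A matrix as a list of rows. -/
def toMat (x : Fin n → Fin n → ℤ) : List (List ℤ) := List.ofFn fun u => List.ofFn (x u)

theorem zip_ofFn {α β : Type*} (f : Fin n → α) (g : Fin n → β) :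
    (List.ofFn f).zip (List.ofFn g) = List.ofFn fun i => (f i, g i) := by
  apply List.ext_getElem <;> simp

theorem sum_map_ofFn {α : Type*} (f : Fin n → α) (g : α → ℤ) :
    ((List.ofFn f).map g).sum = ∑ i, g (f i) := by
  rw [List.map_ofFn, List.sum_ofFn]
  rfl

theorem dot_ofFn (f g : Fin n → ℤ) : dot (List.ofFn f) (List.ofFn g) = ∑ i, f i * g i := by
  rw [dot, zip_ofFn, sum_map_ofFn]

/-- Entries of `mulRound`. -/
def mulFn (Q : ℤ) (x y : Fin n → Fin n → ℤ) (u v : Fin n) : ℤ := (∑ w, x u w * y v w) / Q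

/-- Entries of `cubicRound`. -/
def cubicFn (a b c Q : ℤ) (x : Fin n → Fin n → ℤ) (u v : Fin n) : ℤ :=
  clamp Q ((a * mulFn Q x x u v + b * mulFn Q (mulFn Q x x) x u v) / c)

theorem mulRound_toMat (Q : ℤ) (x y : Fin n → Fin n → ℤ) :
    mulRound Q (toMat x) (toMat y) = toMat (mulFn Q x y) := by
  simp only [mulRound, toMat, List.map_ofFn]
  congr 1
  ext1 u
  simp only [Function.comp_apply]
  congr 1
  ext1 v
  simp only [Function.comp_apply, dot_ofFn, mulFn]

theorem cubicRound_toMat (a b c Q : ℤ) (x : Fin n → Fin n → ℤ) :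
    cubicRound a b c Q (toMat x) = toMat (cubicFn a b c Q x) := by
  rw [cubicRound, mulRound_toMat, mulRound_toMat]
  simp only [toMat, zip_ofFn, List.map_ofFn]
  congr 1
  ext1 u
  simp only [Function.comp_apply, zip_ofFn, List.map_ofFn]
  congr 1

theorem abs_ediv_sub_le (z Q : ℤ) (hQ : 0 < Q) : |((z / Q : ℤ) : ℝ) - z / Q| ≤ 1 := by
  have hQ' : (0 : ℝ) < Q := by exact_mod_cast hQ
  have h1 : ((z / Q : ℤ) : ℝ) * Q ≤ z := by exact_mod_cast Int.ediv_mul_le z hQ.ne'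
  have h2 : (z : ℝ) < (((z / Q : ℤ) : ℝ) + 1) * Q := by
    exact_mod_cast Int.lt_ediv_add_one_mul_self z hQ
  rw [abs_le]
  constructor
  · have := (div_lt_iff₀ hQ').2 h2
    linarith
  · have := (le_div_iff₀ hQ').2 h1
    linarith

open Matrix

variable {U : Matrix (Fin n) (Fin n) ℝ}

/-- Exact entries are at most 1 in absolute value. The product of the two entry errors is linearised
by `e' ≤ 1`, which explains the asymmetric `2 * e + e'`; the last summand comes from rounding the
quotient. -/
theorem mulFn_error (hU : Uᵀ * U = 1) {l m : Fin n → ℝ} (hl : ∀ j, |l j| ≤ 1)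
    (hm : ∀ j, |m j| ≤ 1) {Q : ℤ} (hQ : 0 < Q) {x y : Fin n → Fin n → ℤ} {e e' : ℝ} (he : 0 ≤ e)
    (he' : e' ≤ 1) (hx : ∀ u v, |x u v / (Q : ℝ) - specMat U l u v| ≤ e)
    (hy : ∀ u v, |y u v / (Q : ℝ) - specMat U m u v| ≤ e') (u v : Fin n) :
    |mulFn Q x y u v / (Q : ℝ) - specMat U (fun j => l j * m j) u v| ≤
      n * (2 * e + e') + 1 / Q := by
  have hU' : U * Uᵀ = 1 := mul_eq_one_comm.1 hU
  have hQ' : (0 : ℝ) < Q := by exact_mod_cast hQ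
  rw [← sum_specMat_mul hU]
  have h1 : |(mulFn Q x y u v : ℝ) / Q - (∑ w, x u w * y v w : ℤ) / Q / Q| ≤ 1 / Q := by
    rw [← sub_div, abs_div, abs_of_pos hQ']
    exact div_le_div_of_nonneg_right (abs_ediv_sub_le _ Q hQ) hQ'.le
  have h2 : ((∑ w, x u w * y v w : ℤ) : ℝ) / Q / Q = ∑ w, (x u w / (Q : ℝ)) * (y v w / Q) := by
    push_cast
    rw [Finset.sum_div, Finset.sum_div]
    exact Finset.sum_congr rfl fun w _ => by field_simp
  have h3 : |∑ w, (x u w / (Q : ℝ)) * (y v w / Q) - ∑ w, specMat U l u w * specMat U m v w| ≤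
      n * (2 * e + e') := by
    rw [← Finset.sum_sub_distrib]
    refine (Finset.abs_sum_le_sum_abs _ _).trans ?_
    refine (Finset.sum_le_card_nsmul _ _ (2 * e + e') fun w _ => ?_).trans
      (by rw [Finset.card_univ, Fintype.card_fin, nsmul_eq_mul])
    have a1 := hx u w
    have a2 := hy v w
    have a3 := abs_specMat_le hU' hl u w
    have a4 := abs_specMat_le hU' hm v w
    generalize specMat U l u w = p at *
    generalize specMat U m v w = q at *
    generalize (x u w / (Q : ℝ)) = p' at *
    generalize (y v w / (Q : ℝ)) = q' at *
    have e1 : p' * q' - p * q = (p' - p) * (q' - q) + (p' - p) * q + p * (q' - q) := by ring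
    rw [e1]
    refine (abs_add_three _ _ _).trans ?_
    rw [abs_mul, abs_mul, abs_mul]
    have b1 : |p' - p| * |q' - q| ≤ e * 1 :=
      mul_le_mul a1 (a2.trans he') (abs_nonneg _) he
    have b2 : |p' - p| * |q| ≤ e * 1 := mul_le_mul a1 a4 (abs_nonneg _) he
    have b3 : |p| * |q' - q| ≤ 1 * e' := mul_le_mul a3 a2 (abs_nonneg _) (by norm_num)
    linarith
  rw [h2] at h1
  calc _ ≤ |(mulFn Q x y u v : ℝ) / Q - ∑ w, (x u w / (Q : ℝ)) * (y v w / Q)| +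
        |∑ w, (x u w / (Q : ℝ)) * (y v w / Q) - ∑ w, specMat U l u w * specMat U m v w| :=
        abs_sub_le _ _ _
    _ ≤ _ := by linarith

theorem specMat_cubic (l : Fin n → ℝ) (a b c : ℝ) (u v : Fin n) :
    (a * specMat U (fun j => l j * l j) u v + b * specMat U (fun j => l j * l j * l j) u v) / c =
      specMat U (fun j => (a * l j ^ 2 + b * l j ^ 3) / c) u v := by
  simp only [specMat_apply, Finset.mul_sum, ← Finset.sum_add_distrib, Finset.sum_div]
  exact Finset.sum_congr rfl fun j _ => by ring

theorem cubicFn_error (hn : 1 ≤ n) (hU : Uᵀ * U = 1) {l : Fin n → ℝ} (hl : ∀ j, |l j| ≤ 1)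
    {a b c : ℤ} (ha : |(a : ℝ)| ≤ 3) (hb : |(b : ℝ)| ≤ 3) (hc : 1 ≤ c)
    (hl' : ∀ j, |(a * l j ^ 2 + b * l j ^ 3) / (c : ℝ)| ≤ 1) {Q : ℤ} (hQ : 0 < Q)
    {x : Fin n → Fin n → ℤ} {e : ℝ} (he : 0 ≤ e) (hsmall : 32 * n ^ 2 * (e + 1 / Q) ≤ 1)
    (hx : ∀ u v, |x u v / (Q : ℝ) - specMat U l u v| ≤ e) (u v : Fin n) :
    |cubicFn a b c Q x u v / (Q : ℝ) -
      specMat U (fun j => (a * l j ^ 2 + b * l j ^ 3) / (c : ℝ)) u v| ≤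
        32 * n ^ 2 * (e + 1 / Q) := by
  have hU' : U * Uᵀ = 1 := mul_eq_one_comm.1 hU
  have hQ' : (0 : ℝ) < Q := by exact_mod_cast hQ
  have hc' : (1 : ℝ) ≤ c := by exact_mod_cast hc
  have hn' : (1 : ℝ) ≤ n := by exact_mod_cast hn
  have hq : 0 < 1 / (Q : ℝ) := by positivity
  set q := 1 / (Q : ℝ) with hqdef
  have hnn : (n : ℝ) ≤ n ^ 2 := by nlinarith
  have he1 : e ≤ 1 := by nlinarith
  have hl2 : ∀ j, |l j * l j| ≤ 1 := fun j => by
    rw [abs_mul]; exact mul_le_one₀ (hl j) (abs_nonneg _) (hl j)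
  have m2 := mulFn_error hU hl hl hQ he he1 hx hx
  have m3 := mulFn_error hU hl2 hl hQ (by positivity) he1 m2 hx
  set y := (a * mulFn Q x x u v + b * mulFn Q (mulFn Q x x) x u v) / c with hy
  have h1 : |(y : ℝ) / Q - ((a * mulFn Q x x u v + b * mulFn Q (mulFn Q x x) x u v : ℤ) : ℝ) / c / Q|
      ≤ q := by
    rw [← sub_div, abs_div, abs_of_pos hQ']
    exact div_le_div_of_nonneg_right (abs_ediv_sub_le _ c (by omega)) hQ'.le
  have h2 : |((a * mulFn Q x x u v + b * mulFn Q (mulFn Q x x) x u v : ℤ) : ℝ) / c / Q -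
      specMat U (fun j => (a * l j ^ 2 + b * l j ^ 3) / (c : ℝ)) u v| ≤
      3 * (n * (2 * e + e) + q) + 3 * (n * (2 * (n * (2 * e + e) + q) + e) + q) := by
    rw [← specMat_cubic]
    push_cast
    have e1 : ((a : ℝ) * mulFn Q x x u v + b * mulFn Q (mulFn Q x x) x u v) / c / Q -
        (a * specMat U (fun j => l j * l j) u v + b * specMat U (fun j => l j * l j * l j) u v) / c =
        (a * (mulFn Q x x u v / Q - specMat U (fun j => l j * l j) u v) +
          b * (mulFn Q (mulFn Q x x) x u v / Q - specMat U (fun j => l j * l j * l j) u v)) / c := by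
      field_simp
      ring
    rw [e1, abs_div, abs_of_pos (show (0 : ℝ) < c by linarith)]
    refine (div_le_self (abs_nonneg _) hc').trans ((abs_add_le _ _).trans ?_)
    rw [abs_mul, abs_mul]
    exact add_le_add (mul_le_mul ha (m2 u v) (abs_nonneg _) (by norm_num))
      (mul_le_mul hb (m3 u v) (abs_nonneg _) (by norm_num))
  -- The sum of the two bounds is `18 n² e + 12 n e + 6 n q + 7 q`, which is at most `30 n² e + 13
  -- n² q`.
  have h3 : |(y : ℝ) / Q - specMat U (fun j => (a * l j ^ 2 + b * l j ^ 3) / (c : ℝ)) u v| ≤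
      32 * n ^ 2 * (e + q) := by
    refine (abs_sub_le _ _ _).trans ((add_le_add h1 h2).trans ?_)
    have a1 : n * e ≤ n ^ 2 * e := mul_le_mul_of_nonneg_right hnn he
    have a2 : n * q ≤ n ^ 2 * q := mul_le_mul_of_nonneg_right hnn hq.le
    have a3 : q ≤ n ^ 2 * q := le_mul_of_one_le_left hq.le (by nlinarith)
    have a4 : 0 ≤ n ^ 2 * e := by positivity
    have a5 : 0 ≤ n ^ 2 * q := by positivity
    nlinarith
  -- The clamp is inactive: the exact entry is at most 1 and, by `hsmall`, so is the error.
  have h4 : cubicFn a b c Q x u v = y := by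
    unfold cubicFn clamp
    rw [← hy, if_pos]
    have h5 := abs_specMat_le hU' hl' u v
    have h6 : |(y : ℝ) / Q| ≤ 2 := by
      have := abs_sub_abs_le_abs_sub ((y : ℝ) / Q)
        (specMat U (fun j => (a * l j ^ 2 + b * l j ^ 3) / (c : ℝ)) u v)
      linarith
    rw [abs_div, abs_of_pos hQ', div_le_iff₀ hQ'] at h6
    have h7 : |y| ≤ 2 * Q := by exact_mod_cast h6
    rw [abs_le] at h7
    exact mul_pos (by linarith) (by linarith)
  rw [h4]
  exact h3

/-- Error bounds after `j` steps of fixed point arithmetic. -/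
theorem cubicFn_error_pow (hn : 1 ≤ n) (hU : Uᵀ * U = 1) {l : Fin n → ℝ} (hl : ∀ j, |l j| ≤ 1)
    {a b c : ℤ} (ha : |(a : ℝ)| ≤ 3) (hb : |(b : ℝ)| ≤ 3) (hc : 1 ≤ c)
    (hl' : ∀ j, |(a * l j ^ 2 + b * l j ^ 3) / (c : ℝ)| ≤ 1) {Q : ℤ} (hQ : 0 < Q)
    {x : Fin n → Fin n → ℤ} {j : ℕ} (hsmall : (64 * (n : ℝ) ^ 2) ^ (j + 1) ≤ Q)
    (hx : ∀ u v, |x u v / (Q : ℝ) - specMat U l u v| ≤ (64 * (n : ℝ) ^ 2) ^ j / Q) (u v : Fin n) :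
    |cubicFn a b c Q x u v / (Q : ℝ) -
      specMat U (fun j => (a * l j ^ 2 + b * l j ^ 3) / (c : ℝ)) u v| ≤
        (64 * (n : ℝ) ^ 2) ^ (j + 1) / Q := by
  have hQ' : (0 : ℝ) < Q := by exact_mod_cast hQ
  have hn' : (1 : ℝ) ≤ n := by exact_mod_cast hn
  have h1 : (1 : ℝ) ≤ (64 * (n : ℝ) ^ 2) ^ j := one_le_pow₀ (by nlinarith)
  have h2 : 32 * n ^ 2 * ((64 * (n : ℝ) ^ 2) ^ j / Q + 1 / Q) ≤ (64 * (n : ℝ) ^ 2) ^ (j + 1) / Q := by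
    rw [← add_div, ← mul_div_assoc, pow_succ _ j]
    refine div_le_div_of_nonneg_right ?_ hQ'.le
    nlinarith [mul_nonneg (sq_nonneg (n : ℝ)) (sub_nonneg.2 h1)]
  exact (cubicFn_error hn hU hl ha hb hc hl' hQ (by positivity)
    (h2.trans ((div_le_one hQ').2 hsmall)) hx u v).trans h2

/-- The exponent doubles only while `s φ² < 10`, hence never reaches `20 / φ²`. After `i` rounds it
has either attained the target `10 / φ²` or doubled in each round; the second case is the one left
when the cap on the number of rounds intervenes for a tiny `φ`. Each round multiplies the error
bound by at most `64 n²`. -/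
theorem squareStep_invariant (hn : 1 ≤ n) (hU : Uᵀ * U = 1) {l : Fin n → ℝ}
    (hl0 : ∀ j, 0 ≤ l j) (hl1 : ∀ j, l j ≤ 1) {num den Q : ℤ} (hQ : 0 < Q)
    (hnum : 0 < num) (hlt : num < den) {x : Fin n → Fin n → ℤ} {T : ℕ}
    (hsmall : (64 * (n : ℝ) ^ 2) ^ (T + 1) ≤ Q)
    (hx : ∀ u v, |x u v / (Q : ℝ) - specMat U l u v| ≤ 64 * (n : ℝ) ^ 2 / Q) (i : ℕ) (hi : i ≤ T) :
    ∃ (s : ℕ) (y : Fin n → Fin n → ℤ),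
      (squareStep num den Q)^[i] (1, toMat x) = ((s : ℤ), toMat y) ∧ 1 ≤ s ∧
      (s : ℤ) * (num * num) < 20 * (den * den) ∧
      (10 * (den * den) ≤ (s : ℤ) * (num * num) ∨ 2 ^ i ≤ s) ∧
      ∀ u v, |y u v / (Q : ℝ) - specMat U (fun j => l j ^ s) u v| ≤
        (64 * (n : ℝ) ^ 2) ^ (i + 1) / Q := by
  have hQ' : (0 : ℝ) < Q := by exact_mod_cast hQ
  have hn' : (1 : ℝ) ≤ n := by exact_mod_cast hn
  have hbase : (1 : ℝ) ≤ 64 * (n : ℝ) ^ 2 := by nlinarith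
  induction i with
  | zero =>
    refine ⟨1, x, rfl, le_rfl, ?_, Or.inr (by simp), ?_⟩
    · push_cast
      nlinarith
    · simpa using hx
  | succ i ih =>
    obtain ⟨s, y, h1, h2, h3, h4, h5⟩ := ih (by omega)
    rw [Function.iterate_succ_apply', h1]
    unfold squareStep
    split_ifs with hif
    · dsimp only at hif
      refine ⟨2 * s, cubicFn 1 0 1 Q y, ?_, by omega, ?_, ?_, ?_⟩
      · dsimp only
        rw [cubicRound_toMat]
        push_cast
        rfl
      · push_cast
        nlinarith
      · rcases h4 with h4 | h4
        · exact absurd h4 (by omega)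
        · right
          rw [pow_succ]
          omega
      · have habs : ∀ j, |l j ^ s| ≤ 1 := fun j => by
          rw [abs_of_nonneg (pow_nonneg (hl0 j) _)]
          exact pow_le_one₀ (hl0 j) (hl1 j)
        have hsq : ∀ j, ((1 : ℤ) * (l j ^ s) ^ 2 + (0 : ℤ) * (l j ^ s) ^ 3) / ((1 : ℤ) : ℝ) =
            l j ^ (2 * s) := fun j => by push_cast; ring
        have := cubicFn_error_pow (a := 1) (b := 0) (c := 1) hn hU habs (by norm_num) (by norm_num)
          le_rfl (fun j => by
            rw [hsq, abs_of_nonneg (pow_nonneg (hl0 j) _)]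
            exact pow_le_one₀ (hl0 j) (hl1 j)) hQ
          ((pow_le_pow_right₀ hbase (by omega)).trans hsmall) h5
        simpa only [hsq] using this
    · dsimp only at hif
      refine ⟨s, y, rfl, h2, h3, Or.inl (by omega), fun u v => (h5 u v).trans ?_⟩
      exact div_le_div_of_nonneg_right (pow_le_pow_right₀ hbase (by omega)) hQ'.le

theorem purify_invariant (hn : 1 ≤ n) (hU : Uᵀ * U = 1) {l : Fin n → ℝ}
    (hl0 : ∀ j, 0 ≤ l j) (hl1 : ∀ j, l j ≤ 1) {Q : ℤ} (hQ : 0 < Q) {x : Fin n → Fin n → ℤ} {T t : ℕ}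
    (hsmall : (64 * (n : ℝ) ^ 2) ^ (t + T) ≤ Q)
    (hx : ∀ u v, |x u v / (Q : ℝ) - specMat U l u v| ≤ (64 * (n : ℝ) ^ 2) ^ t / Q)
    (i : ℕ) (hi : i ≤ T) :
    ∃ y : Fin n → Fin n → ℤ,
      (cubicRound 3 (-2) 1 Q)^[i] (toMat x) = toMat y ∧
      ∀ u v, |y u v / (Q : ℝ) - specMat U (fun j => purify^[i] (l j)) u v| ≤
        (64 * (n : ℝ) ^ 2) ^ (t + i) / Q := by
  have hn' : (1 : ℝ) ≤ n := by exact_mod_cast hn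
  have hbase : (1 : ℝ) ≤ 64 * (n : ℝ) ^ 2 := by nlinarith
  induction i with
  | zero => exact ⟨x, rfl, by simpa using hx⟩
  | succ i ih =>
    obtain ⟨y, h1, h2⟩ := ih (by omega)
    refine ⟨cubicFn 3 (-2) 1 Q y, ?_, ?_⟩
    · rw [Function.iterate_succ_apply', h1, cubicRound_toMat]
    · have hmem := fun i j => purify_iterate_mem (hl0 j) (hl1 j) i
      have hsq : ∀ j, ((3 : ℤ) * (purify^[i] (l j)) ^ 2 + (-2 : ℤ) * (purify^[i] (l j)) ^ 3) /
          ((1 : ℤ) : ℝ) = purify^[i + 1] (l j) := fun j => by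
        rw [Function.iterate_succ_apply', purify]
        push_cast
        ring
      have := cubicFn_error_pow (a := 3) (b := -2) (c := 1) hn hU
        (fun j => by rw [abs_of_nonneg (hmem i j).1]; exact (hmem i j).2) (by norm_num)
        (by norm_num) le_rfl (fun j => by
          rw [hsq, abs_of_nonneg (hmem (i + 1) j).1]; exact (hmem (i + 1) j).2) hQ
        ((pow_le_pow_right₀ hbase (by omega)).trans hsmall) h2
      simpa only [hsq, add_assoc] using this

/-- There are `1 + 20 n + 20 n` rounds in all, each losing a factor `64 n² ≤ 2 ^ (8 n)`, and `30 n`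
correct bits are to be left. -/
theorem precision_bound (hn : 1 ≤ n) : (64 * (n : ℝ) ^ 2) ^ (40 * n + 1) * 2 ^ (30 * n) ≤
    2 ^ (1000 * (n * n)) := by
  have h1 : (64 * (n : ℝ) ^ 2) ≤ 2 ^ (8 * n) := by
    have h2 : (n : ℝ) ≤ 2 ^ n := by exact_mod_cast Nat.lt_two_pow_self.le
    have h3 : (64 : ℝ) ≤ 2 ^ (6 * n) := by
      have := pow_le_pow_right₀ (show (1 : ℝ) ≤ 2 by norm_num) (show 6 ≤ 6 * n by omega)
      norm_num at this ⊢
      exact this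
    calc (64 * (n : ℝ) ^ 2) ≤ 2 ^ (6 * n) * (2 ^ n) ^ 2 := by gcongr
      _ = 2 ^ (8 * n) := by rw [← pow_mul, ← pow_add]; congr 1; ring
  calc (64 * (n : ℝ) ^ 2) ^ (40 * n + 1) * 2 ^ (30 * n)
      ≤ (2 ^ (8 * n)) ^ (40 * n + 1) * 2 ^ (30 * n) := by gcongr
    _ = 2 ^ (8 * n * (40 * n + 1) + 30 * n) := by rw [← pow_mul, ← pow_add]
    _ ≤ 2 ^ (1000 * (n * n)) := by
        refine pow_le_pow_right₀ (by norm_num) ?_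
        nlinarith

theorem unitQ_eq {x : inputTy.Val} (hx : x.1.length = n) : unitQ x = 2 ^ (1000 * (n * n)) := by
  have : (1000 * (inputN x * inputN x)).toNat = 1000 * (n * n) := by
    rw [inputN, hx]
    norm_cast
  rw [unitQ, this]
  simp

/-- The computed matrix is close to the filter of the random walk matrix. -/
theorem projRound_error (hn : 1 ≤ n) (hU : Uᵀ * U = 1) {l : Fin n → ℝ} (hl0 : ∀ j, -1 ≤ l j)
    (hl1 : ∀ j, l j ≤ 1) {x : inputTy.Val} {a : Fin n → Fin n → ℤ} {d : ℤ} (hd : 0 < d)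
    (hxa : x.1 = toMat a) (hdeg : ∀ u, ∑ v, a u v = d)
    (hl : ∀ u v, (a u v : ℝ) / d = specMat U l u v)
    (hnum : 0 < x.2.1.1) (hlt : x.2.1.1 < x.2.1.2) :
    ∃ (s : ℕ) (y : Fin n → Fin n → ℤ), projRound x = toMat y ∧ 1 ≤ s ∧
      (s : ℤ) * (x.2.1.1 * x.2.1.1) < 20 * (x.2.1.2 * x.2.1.2) ∧
      (10 * (x.2.1.2 * x.2.1.2) ≤ (s : ℤ) * (x.2.1.1 * x.2.1.1) ∨ 2 ^ (20 * n) ≤ s) ∧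
      ∀ u v, |y u v / ((unitQ x : ℤ) : ℝ) - specMat U (fun j => filterFun s (20 * n) (l j)) u v| ≤
        (1 / 2) ^ (30 * n) := by
  have hlen : x.1.length = n := by rw [hxa]; simp [toMat]
  have hN : (20 * inputN x).toNat = 20 * n := by
    rw [inputN, hlen]; norm_cast
  have hQeq := unitQ_eq hlen
  have hQ : 0 < unitQ x := by rw [hQeq]; positivity
  have hprec := precision_bound hn
  have hQr : ((unitQ x : ℤ) : ℝ) = 2 ^ (1000 * (n * n)) := by rw [hQeq]; push_cast; rfl
  rw [← hQr] at hprec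
  unfold projRound powerRound
  rw [hN]
  set Q := unitQ x with hQdef
  have hQ' : (0 : ℝ) < Q := by exact_mod_cast hQ
  have hn' : (1 : ℝ) ≤ n := by exact_mod_cast hn
  have hbase : (1 : ℝ) ≤ 64 * (n : ℝ) ^ 2 := by nlinarith
  have hsmall : (64 * (n : ℝ) ^ 2) ^ (40 * n + 1) ≤ Q := by
    refine le_trans (le_mul_of_one_le_right (by positivity) (one_le_pow₀ (by norm_num))) hprec
  have hwalk : walkRound x = toMat fun u v => a u v * Q / d := by
    unfold walkRound
    rw [hxa]
    simp only [toMat, List.map_ofFn]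
    congr 1
    ext1 u
    simp only [Function.comp_apply, List.map_ofFn, List.sum_ofFn, hdeg]
    rfl
  have hw : ∀ u v, |((a u v * Q / d : ℤ) : ℝ) / Q - specMat U l u v| ≤
      (64 * (n : ℝ) ^ 2) ^ 0 / Q := by
    intro u v
    rw [← hl]
    have h1 := abs_ediv_sub_le (a u v * Q) d hd
    have hd' : (0 : ℝ) < d := by exact_mod_cast hd
    have e1 : ((a u v * Q / d : ℤ) : ℝ) / Q - a u v / d =
        (((a u v * Q / d : ℤ) : ℝ) - (a u v * Q : ℤ) / d) / Q := by
      push_cast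
      field_simp
    rw [e1, abs_div, abs_of_pos hQ', pow_zero]
    exact div_le_div_of_nonneg_right h1 hQ'.le
  have hst := fun j => start_mem (hl0 j) (hl1 j)
  have hs1 : ∀ j, ((1 : ℤ) * l j ^ 2 + (1 : ℤ) * l j ^ 3) / ((2 : ℤ) : ℝ) =
      (l j ^ 2 + l j ^ 3) / 2 := fun j => by push_cast; ring
  have h0 := cubicFn_error_pow (a := 1) (b := 1) (c := 2) hn hU
    (fun j => abs_le.2 ⟨hl0 j, hl1 j⟩) (by norm_num) (by norm_num) (by norm_num)
    (fun j => by
      rw [hs1, abs_of_nonneg (hst j).1]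
      exact (hst j).2.trans (by linarith [hl1 j])) hQ
    ((pow_le_pow_right₀ hbase (by omega)).trans hsmall) hw
  simp only [hs1, zero_add, pow_one] at h0
  rw [hwalk, cubicRound_toMat]
  obtain ⟨s, y, h1, h2, h3, h4, h5⟩ := squareStep_invariant hn hU (fun j => (hst j).1)
    (fun j => (hst j).2.trans (by linarith [hl1 j])) hQ hnum hlt (T := 20 * n)
    ((pow_le_pow_right₀ hbase (by omega)).trans hsmall) h0 (20 * n) le_rfl
  rw [h1]
  obtain ⟨z, h6, h7⟩ := purify_invariant hn hU (fun j => pow_nonneg (hst j).1 s)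
    (fun j => pow_le_one₀ (hst j).1 ((hst j).2.trans (by linarith [hl1 j]))) hQ
    (T := 20 * n) ((pow_le_pow_right₀ hbase (by omega)).trans hsmall) h5 (20 * n) le_rfl
  refine ⟨s, z, h6, h2, h3, h4, fun u v => (h7 u v).trans ?_⟩
  rw [show 20 * n + 1 + 20 * n = 40 * n + 1 by ring, div_le_iff₀ hQ', one_div, inv_pow,
    inv_mul_eq_div, le_div_iff₀ (by positivity)]
  exact hprec

end Rounding

end NoisyClustering

namespace NoisyClustering

/-! ## Consequences of the standing assumptions -/

section GraphFacts

variable {n d k : ℕ} {G : SimpleGraph (Fin n)} {φ η : ℚ} {ε δ : ℝ} {ι : Fin n → Fin k}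
  {p : Fin n → Fin k → ℝ}

open scoped Classical in
/-- The adjacency matrix with integer entries. -/
noncomputable def adjInd (G : SimpleGraph (Fin n)) (u v : Fin n) : ℤ := if G.Adj u v then 1 else 0

theorem adjInd_nonneg (u v : Fin n) : 0 ≤ adjInd G u v := by
  unfold adjInd; split_ifs <;> simp

theorem adjInd_symm (u v : Fin n) : adjInd G u v = adjInd G v u := by
  unfold adjInd
  by_cases h : G.Adj u v
  · rw [if_pos h, if_pos h.symm]
  · rw [if_neg h, if_neg fun h' => h h'.symm]

theorem mem_cluster {u : Fin n} {i : Fin k} : u ∈ cluster ι i ↔ ι u = i := by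
  simp [cluster]

open scoped Classical in
theorem card_interedges (S T : Finset (Fin n)) :
    ((G.interedges S T).card : ℝ) = ∑ u ∈ S, ∑ v ∈ T, (adjInd G u v : ℝ) := by
  rw [SimpleGraph.interedges, Rel.interedges, Finset.card_filter, Finset.sum_product]
  push_cast
  refine Finset.sum_congr rfl fun u _ => Finset.sum_congr rfl fun v _ => ?_
  unfold adjInd
  split_ifs <;> simp

theorem sum_card_cluster (ι : Fin n → Fin k) : ∑ i, ((cluster ι i).card : ℝ) = n := by
  have := sum_cluster ι fun _ => (1 : ℝ)
  simpa using this

namespace Setting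

variable (h : Setting (d := d) G φ η ε δ ι p)
include h

theorem sum_adjInd (u : Fin n) : ∑ v, adjInd G u v = d := by
  classical
  have h1 := h.regular u
  rw [← h1, ← SimpleGraph.card_neighborFinset_eq_degree]
  unfold adjInd
  rw [Finset.sum_ite, Finset.sum_const_zero, add_zero, Finset.sum_const, nsmul_eq_mul, mul_one]
  congr 2
  ext v
  simp

theorem vol_eq (S : Finset (Fin n)) : vol G S = d * S.card := by
  classical
  unfold vol
  rw [Finset.sum_congr rfl fun v _ => h.regular v, Finset.sum_const, smul_eq_mul, mul_comm]

theorem d_pos : (0 : ℝ) < d := by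
  have := h.three_le_d
  exact_mod_cast (by omega : 0 < d)

theorem phi_pos_real : (0 : ℝ) < φ := by exact_mod_cast h.phi_pos

theorem phi_lt_one_real : (φ : ℝ) < 1 := by exact_mod_cast h.phi_lt_one

theorem one_le_eta_real : (1 : ℝ) ≤ η := by exact_mod_cast h.one_le_eta

theorem card_cluster_pos (i : Fin k) : (0 : ℝ) < (cluster ι i).card := by
  exact_mod_cast (h.clustering.nonempty i).card_pos

theorem expansion (i : Fin k) (S : Finset (Fin n)) (hS : S ⊆ cluster ι i)
    (hcard : 2 * S.card ≤ (cluster ι i).card) :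
    φ * d * S.card ≤ ∑ u ∈ S, ∑ v ∈ cluster ι i \ S, (adjInd G u v : ℝ) := by
  rcases S.eq_empty_or_nonempty with rfl | hne
  · simp
  have hss : S ⊂ cluster ι i := by
    refine Finset.ssubset_iff_subset_ne.2 ⟨hS, ?_⟩
    rintro rfl
    have := hne.card_pos
    omega
  have h1 := h.clustering.inner i S hss hne
  have hsd := Finset.card_sdiff_of_subset hS
  unfold conductanceIn at h1
  rw [card_interedges, h.vol_eq, h.vol_eq, min_eq_left (Nat.mul_le_mul_left _ (by omega))] at h1
  have hpos : (0 : ℝ) < (d * S.card : ℕ) := by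
    push_cast
    exact mul_pos h.d_pos (by exact_mod_cast hne.card_pos)
  rw [le_div_iff₀ hpos] at h1
  push_cast at h1
  linarith

theorem out_le (i : Fin k) :
    ∑ u ∈ cluster ι i, ∑ v ∈ Finset.univ \ cluster ι i, (adjInd G u v : ℝ) ≤
      ε * (d * (cluster ι i).card) := by
  have h1 := h.clustering.outer i
  unfold conductance conductanceIn at h1
  rw [card_interedges, h.vol_eq, h.vol_eq] at h1
  -- A second cluster makes the complement nonempty. Otherwise the denominator would be 0, the
  -- conductance 0 by convention, and the assumption void.
  obtain ⟨j, hj⟩ : ∃ j : Fin k, j ≠ i := by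
    have := h.two_le_k
    by_contra hc
    push Not at hc
    have h2 := Fintype.card_le_one_iff.2 fun a b => (hc a).trans (hc b).symm
    simp at h2
    omega
  have hne : (Finset.univ \ cluster ι i).Nonempty := by
    obtain ⟨v, hv⟩ := h.clustering.nonempty j
    refine ⟨v, ?_⟩
    simp only [Finset.mem_sdiff, Finset.mem_univ, true_and, mem_cluster]
    rw [mem_cluster.1 hv]
    exact hj
  have hd : 0 < d := by have := h.three_le_d; omega
  have hpos : (0 : ℝ) < (min (d * (cluster ι i).card) (d * (Finset.univ \ cluster ι i).card) : ℕ) := by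
    have := Nat.mul_pos hd (h.clustering.nonempty i).card_pos
    have := Nat.mul_pos hd hne.card_pos
    exact_mod_cast (by omega)
  rw [div_le_iff₀ hpos] at h1
  refine h1.trans (mul_le_mul_of_nonneg_left ?_ h.eps_pos.le)
  exact_mod_cast min_le_left _ _

theorem d_le_n : (d : ℝ) ≤ n := by
  have hn : 0 < n := by
    have := h.two_le_k
    obtain ⟨v, -⟩ := h.clustering.nonempty ⟨0, by omega⟩
    exact v.pos
  have h1 := h.sum_adjInd ⟨0, hn⟩
  have h2 : ∑ v, adjInd G ⟨0, hn⟩ v ≤ ∑ _v : Fin n, (1 : ℤ) := by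
    refine Finset.sum_le_sum fun v _ => ?_
    unfold adjInd
    split_ifs <;> simp
  rw [h1] at h2
  simp only [Finset.sum_const, Finset.card_univ, Fintype.card_fin, nsmul_eq_mul, mul_one] at h2
  exact_mod_cast h2

theorem three_le_n : 3 ≤ n := by
  have h1 := h.three_le_d
  have h2 := h.d_le_n
  have : d ≤ n := by exact_mod_cast h2
  omega

/-- Clusters are connected, so their expansion is bounded below in terms of their size. -/
theorem expansion_crude (i : Fin k) (S : Finset (Fin n)) (hS : S ⊆ cluster ι i)
    (hcard : 2 * S.card ≤ (cluster ι i).card) :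
    1 / (n : ℝ) ^ 2 * d * S.card ≤ ∑ u ∈ S, ∑ v ∈ cluster ι i \ S, (adjInd G u v : ℝ) := by
  rcases S.eq_empty_or_nonempty with rfl | hne
  · simp
  have h1 := h.expansion i S hS hcard
  have hc : (0 : ℝ) < S.card := by exact_mod_cast hne.card_pos
  have h2 : (0 : ℝ) < ∑ u ∈ S, ∑ v ∈ cluster ι i \ S, (adjInd G u v : ℝ) :=
    lt_of_lt_of_le (mul_pos (mul_pos h.phi_pos_real h.d_pos) hc) h1
  -- Positivity of `φ` is all that is used: a positive number of edges is at least 1, while `d` and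
  -- `|S|` are at most `n`.
  have h3 : (1 : ℝ) ≤ ∑ u ∈ S, ∑ v ∈ cluster ι i \ S, (adjInd G u v : ℝ) := by
    have : 0 < ∑ u ∈ S, ∑ v ∈ cluster ι i \ S, adjInd G u v := by exact_mod_cast h2
    exact_mod_cast this
  refine le_trans ?_ h3
  have hn : (0 : ℝ) < n := by exact_mod_cast (by have := h.three_le_n; omega : 0 < n)
  have h4 : (S.card : ℝ) ≤ n := by
    have := S.card_le_univ
    rw [Fintype.card_fin] at this
    exact_mod_cast this
  have h5 := h.d_le_n
  rw [mul_assoc, one_div, inv_mul_le_iff₀ (by positivity), mul_one, sq]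
  exact mul_le_mul h5 h4 hc.le hn.le

/-- The random walk matrix has a spectral gap on the complement of the cluster indicators. -/
theorem walk_gap {ψ : ℝ} (hψ : 0 ≤ ψ)
    (hexp : ∀ i, ∀ S ⊆ cluster ι i, 2 * S.card ≤ (cluster ι i).card →
      ψ * d * S.card ≤ ∑ u ∈ S, ∑ v ∈ cluster ι i \ S, (adjInd G u v : ℝ))
    (y : Fin n → ℝ) (hy : ∀ i, ∑ u, (if ι u = i then (1 : ℝ) else 0) * y u = 0) :
    ∑ u, ∑ v, y u * ((adjInd G u v : ℝ) / d) * y v ≤ (1 - ψ ^ 2 / 2) * ∑ u, y u ^ 2 := by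
  have hd := h.d_pos
  have hdeg : ∀ u, ∑ v, (adjInd G u v : ℝ) = d := fun u => by exact_mod_cast h.sum_adjInd u
  have hnn : ∀ u v, (0 : ℝ) ≤ adjInd G u v := fun u v => by exact_mod_cast adjInd_nonneg u v
  have hsy : ∀ u v, (adjInd G u v : ℝ) = adjInd G v u := fun u v => by rw [adjInd_symm]
  -- The Dirichlet form of a regular graph in terms of the walk matrix.
  have h1 : ∑ u, ∑ v, (adjInd G u v : ℝ) * (y u - y v) ^ 2 =
      2 * d * ∑ u, y u ^ 2 - 2 * d * ∑ u, ∑ v, y u * ((adjInd G u v : ℝ) / d) * y v := by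
    have e1 : ∑ u, ∑ v, (adjInd G u v : ℝ) * y u ^ 2 = d * ∑ u, y u ^ 2 := by
      rw [Finset.mul_sum]
      exact Finset.sum_congr rfl fun u _ => by rw [← Finset.sum_mul, hdeg]
    have e2 : ∑ u, ∑ v, (adjInd G u v : ℝ) * y v ^ 2 = d * ∑ u, y u ^ 2 := by
      rw [← e1, Finset.sum_comm]
      exact Finset.sum_congr rfl fun u _ => Finset.sum_congr rfl fun v _ => by rw [hsy]
    have e3 : ∑ u, ∑ v, (adjInd G u v : ℝ) * (y u - y v) ^ 2 =
        ∑ u, ∑ v, (adjInd G u v : ℝ) * y u ^ 2 + ∑ u, ∑ v, (adjInd G u v : ℝ) * y v ^ 2 -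
          2 * d * ∑ u, ∑ v, y u * ((adjInd G u v : ℝ) / d) * y v := by
      simp only [Finset.mul_sum, ← Finset.sum_add_distrib, ← Finset.sum_sub_distrib]
      exact Finset.sum_congr rfl fun u _ => Finset.sum_congr rfl fun v _ => by field_simp; ring
    rw [e3, e1, e2]
    ring
  -- Apply Cheeger's inequality in each cluster and discard the nonnegative terms of edges between
  -- clusters.
  have h2 : ψ ^ 2 * d * ∑ u, y u ^ 2 ≤ ∑ u, ∑ v, (adjInd G u v : ℝ) * (y u - y v) ^ 2 := by
    rw [← sum_cluster ι, Finset.mul_sum, ← sum_cluster ι]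
    refine Finset.sum_le_sum fun i _ => ?_
    refine (cheeger (cluster ι i) (fun u v => (adjInd G u v : ℝ)) hnn hsy hd hψ
      (fun u _ => ?_) (hexp i) y ?_).trans ?_
    · rw [← hdeg u]
      exact Finset.sum_le_sum_of_subset_of_nonneg (Finset.subset_univ _) fun v _ _ => hnn u v
    · have := hy i
      rw [cluster, Finset.sum_filter]
      simpa using this
    · refine Finset.sum_le_sum fun u _ => ?_
      exact Finset.sum_le_sum_of_subset_of_nonneg (Finset.subset_univ _)
        fun v _ _ => mul_nonneg (hnn u v) (sq_nonneg _)
  rw [h1] at h2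
  have h3 : (2 * d) * (∑ u, ∑ v, y u * ((adjInd G u v : ℝ) / d) * y v) ≤
      (2 * d) * ((1 - ψ ^ 2 / 2) * ∑ u, y u ^ 2) := by linarith
  exact le_of_mul_le_mul_left h3 (by positivity)

open Matrix in
/-- The eigenvalues of the random walk matrix. -/
theorem walk_eigenvalues {U : Matrix (Fin n) (Fin n) ℝ} (hU : Uᵀ * U = 1) {l : Fin n → ℝ}
    (hl : ∀ u v, (adjInd G u v : ℝ) / d = specMat U l u v) (j : Fin n) :
    -1 ≤ l j ∧ l j ≤ 1 := by
  have hd := h.d_pos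
  have hdeg : ∀ u, ∑ v, (adjInd G u v : ℝ) = d := fun u => by exact_mod_cast h.sum_adjInd u
  have hnn : ∀ u v, (0 : ℝ) ≤ adjInd G u v := fun u v => by exact_mod_cast adjInd_nonneg u v
  have hsy : ∀ u v, (adjInd G u v : ℝ) = adjInd G v u := fun u v => by rw [adjInd_symm]
  have hcol : ∀ i, ∑ u, U u i * U u j = if i = j then 1 else 0 := by
    intro i
    have := congrFun (congrFun hU i) j
    rw [Matrix.mul_apply, Matrix.one_apply] at this
    rw [← this]
    exact Finset.sum_congr rfl fun u _ => by rw [Matrix.transpose_apply]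
  have hq : ∑ u, ∑ v, U u j * ((adjInd G u v : ℝ) / d) * U v j = l j := by
    simp only [hl]
    rw [specMat_quad]
    simp only [hcol]
    simp
  have hone : ∑ u, U u j ^ 2 = 1 := by
    have := hcol j
    simpa only [sq, if_true] using this
  have habs : |∑ u, ∑ v, U u j * ((adjInd G u v : ℝ) / d) * U v j| ≤ 1 := by
    refine (Finset.abs_sum_le_sum_abs _ _).trans ?_
    have h1 : ∀ u, |∑ v, U u j * ((adjInd G u v : ℝ) / d) * U v j| ≤
        ∑ v, ((adjInd G u v : ℝ) / d * U u j ^ 2 / 2 + (adjInd G v u : ℝ) / d * U v j ^ 2 / 2) := by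
      intro u
      refine (Finset.abs_sum_le_sum_abs _ _).trans (Finset.sum_le_sum fun v _ => ?_)
      rw [← hsy u v, abs_mul, abs_mul, abs_of_nonneg (div_nonneg (hnn u v) hd.le)]
      have h2 : 0 ≤ (adjInd G u v : ℝ) / d := div_nonneg (hnn u v) hd.le
      have h3 := mul_nonneg h2 (sq_nonneg (|U u j| - |U v j|))
      rw [← sq_abs (U u j), ← sq_abs (U v j)]
      linarith
    refine (Finset.sum_le_sum fun u _ => h1 u).trans ?_
    have h2 : ∑ u, ∑ v, (adjInd G u v : ℝ) / d * U u j ^ 2 / 2 = 1 / 2 := by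
      have : ∀ u, ∑ v, (adjInd G u v : ℝ) / d * U u j ^ 2 / 2 = U u j ^ 2 / 2 := by
        intro u
        rw [← Finset.sum_div, ← Finset.sum_mul, ← Finset.sum_div, hdeg, div_self hd.ne', one_mul]
      rw [Finset.sum_congr rfl fun u _ => this u, ← Finset.sum_div, hone]
    simp only [Finset.sum_add_distrib]
    rw [h2, Finset.sum_comm, h2]
    norm_num
  rw [hq] at habs
  exact abs_le.1 habs

/-- A step of the walk started uniformly in the cluster leaves it with this probability, which is
the defect of the indicator's Rayleigh quotient from 1. -/
theorem cluster_walk_deficit (i : Fin k) :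
    1 - (1 / ((cluster ι i).card : ℝ)) * ∑ u ∈ cluster ι i, ∑ v ∈ cluster ι i,
      (adjInd G u v : ℝ) / d =
    (∑ u ∈ cluster ι i, ∑ v ∈ Finset.univ \ cluster ι i, (adjInd G u v : ℝ)) /
      (d * (cluster ι i).card) := by
  have hd := h.d_pos
  have hc := h.card_cluster_pos i
  have hdeg : ∀ u, ∑ v, (adjInd G u v : ℝ) = d := fun u => by exact_mod_cast h.sum_adjInd u
  have h1 : ∑ u ∈ cluster ι i, ∑ v ∈ Finset.univ \ cluster ι i, (adjInd G u v : ℝ) +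
      ∑ u ∈ cluster ι i, ∑ v ∈ cluster ι i, (adjInd G u v : ℝ) = d * (cluster ι i).card := by
    rw [← Finset.sum_add_distrib, Finset.sum_congr rfl fun u _ => by
      rw [Finset.sum_sdiff (Finset.subset_univ _), hdeg u]]
    rw [Finset.sum_const, nsmul_eq_mul, mul_comm]
  have h2 : ∑ u ∈ cluster ι i, ∑ v ∈ cluster ι i, (adjInd G u v : ℝ) / d =
      (∑ u ∈ cluster ι i, ∑ v ∈ cluster ι i, (adjInd G u v : ℝ)) / d := by
    simp only [Finset.sum_div]
  rw [h2, eq_div_iff (by positivity)]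
  field_simp
  linarith

end Setting

end GraphFacts

end NoisyClustering

namespace NoisyClustering

/-! ### The rows that the spectral step gets wrong -/

section BadSet

variable {n d k : ℕ} {G : SimpleGraph (Fin n)} {φ η : ℚ} {ε δ : ℝ} {ι : Fin n → Fin k}
  {p : Fin n → Fin k → ℝ}

theorem encodeInput_adj (σ : Fin n → Fin k) : (encodeInput G φ k η σ).1 = toMat (adjInd G) := rfl

theorem inputN_encodeInput (σ : Fin n → Fin k) : inputN (encodeInput G φ k η σ) = n := by
  simp [inputN, encodeInput]

theorem unitQ_encodeInput (σ : Fin n → Fin k) :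
    unitQ (encodeInput G φ k η σ) = 2 ^ (1000 * (n * n)) :=
  unitQ_eq (by simp [encodeInput])

/-- Collects two error terms: at most `n` filtered eigenvalues that are not exactly 0, and the
rounding of `n²` entries. -/
theorem half_pow_bound (hn : 1 ≤ n) {t : ℝ} (ht0 : 0 ≤ t) (ht : t ≤ (3 / 10) ^ (20 * n) * (1 / 10)) :
    2 * (n * t ^ 2) + 2 * (n * (n * ((1 / 2 : ℝ) ^ (30 * n)) ^ 2)) ≤ (1 / 2) ^ (30 * n) := by
  have h2 : (n : ℝ) ≤ 2 ^ n := by exact_mod_cast Nat.lt_two_pow_self.le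
  have hn1 : ((1 : ℝ) / 2) ^ n ≤ 1 / 2 := by
    calc ((1 : ℝ) / 2) ^ n ≤ (1 / 2) ^ 1 := pow_le_pow_of_le_one (by norm_num) (by norm_num) hn
      _ = 1 / 2 := by norm_num
  have hz0 : (0 : ℝ) < (1 / 2) ^ n := by positivity
  set z : ℝ := (1 / 2) ^ n with hz
  have hnz : (n : ℝ) * z ≤ 1 := by
    rw [hz, one_div, inv_pow, ← div_eq_mul_inv]
    exact (div_le_one (by positivity)).2 h2
  have e1 : ((1 : ℝ) / 2) ^ (30 * n) = z ^ 30 := by rw [hz, ← pow_mul]; congr 1; ring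
  have ht' : t ≤ z ^ 20 := by
    refine ht.trans ?_
    calc ((3 : ℝ) / 10) ^ (20 * n) * (1 / 10) ≤ (1 / 2) ^ (20 * n) * 1 :=
          mul_le_mul (pow_le_pow_left₀ (by norm_num) (by norm_num) _) (by norm_num) (by norm_num)
            (by positivity)
      _ = z ^ 20 := by rw [hz, ← pow_mul, mul_one]; congr 1; ring
  have ht2 : t ^ 2 ≤ z ^ 40 := by
    calc t ^ 2 ≤ (z ^ 20) ^ 2 := by gcongr
      _ = z ^ 40 := by ring
  rw [e1]
  have hz1 : z ≤ 1 / 2 := hn1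
  have a1 : (n : ℝ) * t ^ 2 ≤ z ^ 39 := by
    calc (n : ℝ) * t ^ 2 ≤ n * z ^ 40 := by gcongr
      _ = (n * z) * z ^ 39 := by ring
      _ ≤ 1 * z ^ 39 := by gcongr
      _ = z ^ 39 := one_mul _
  have a2 : (n : ℝ) * (n * (z ^ 30) ^ 2) ≤ z ^ 39 := by
    calc (n : ℝ) * (n * (z ^ 30) ^ 2) = (n * z) * (n * z) * z ^ 58 := by ring
      _ ≤ 1 * 1 * z ^ 58 := by gcongr
      _ ≤ z ^ 39 := by
        rw [one_mul, one_mul]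
        exact pow_le_pow_of_le_one hz0.le (by linarith) (by norm_num)
  have a3 : z ^ 39 ≤ z ^ 30 * (1 / 2) ^ 9 := by
    calc z ^ 39 = z ^ 30 * z ^ 9 := by ring
      _ ≤ z ^ 30 * (1 / 2) ^ 9 := by gcongr
  have a4 : 0 < z ^ 30 := by positivity
  norm_num at a3
  linarith

namespace Setting

variable (h : Setting (d := d) G φ η ε δ ι p)
include h

open Matrix in
/-- The computed matrix is close to the projection to the cluster indicators. -/
theorem frobenius_projRound :
    ∃ (s : ℕ) (y : Fin n → Fin n → ℤ), 1 ≤ s ∧ s * (φ : ℝ) ^ 2 ≤ 20 ∧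
      (∀ σ : Fin n → Fin k, projRound (encodeInput G φ k η σ) = toMat y) ∧
      ∑ u, ∑ v, (y u v / (2 : ℝ) ^ (1000 * (n * n)) - clusterProj ι u v) ^ 2 ≤
        20 * s * ∑ i, (∑ u ∈ cluster ι i, ∑ v ∈ Finset.univ \ cluster ι i, (adjInd G u v : ℝ)) /
          (d * (cluster ι i).card) + (1 / 2) ^ (30 * n) := by
  have hn3 := h.three_le_n
  have hn : 1 ≤ n := by omega
  have hd := h.d_pos
  obtain ⟨U, l, hU, hU', hP⟩ := exists_specMat
    (Matrix.of fun u v : Fin n => (adjInd G u v : ℝ) / d)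
    (by ext u v; simp [adjInd_symm u v])
  have hl : ∀ u v, (adjInd G u v : ℝ) / d = specMat U l u v := fun u v => by
    rw [← hP]; rfl
  have hlm := fun j => h.walk_eigenvalues hU hl j
  have hden : (0 : ℝ) < φ.den := by exact_mod_cast φ.den_pos
  have hφ : (φ : ℝ) = φ.num / φ.den := by exact_mod_cast (Rat.num_div_den φ).symm
  have hnum : (0 : ℤ) < φ.num := Rat.num_pos.2 h.phi_pos
  have hlt : φ.num < φ.den := by
    have := h.phi_lt_one_real
    rw [hφ, div_lt_one hden] at this
    exact_mod_cast this
  -- The matrix computation never reads the labels, so `ι` may stand in for the noisy labeling and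
  -- the result serves every `σ`.
  obtain ⟨s, y, hy, hs1, hs2, hs3, herr⟩ := projRound_error hn hU (fun j => (hlm j).1)
    (fun j => (hlm j).2) (x := encodeInput G φ k η ι) (a := adjInd G) (d := d)
    (by exact_mod_cast hd) (encodeInput_adj ι) h.sum_adjInd (by simpa using hl) hnum hlt
  change (s : ℤ) * (φ.num * φ.num) < 20 * (φ.den * φ.den) at hs2
  change 10 * ((φ.den : ℤ) * φ.den) ≤ (s : ℤ) * (φ.num * φ.num) ∨ _ at hs3
  have hs2' : (s : ℝ) * (φ : ℝ) ^ 2 ≤ 20 := by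
    have : (s : ℝ) * (φ.num * φ.num) < 20 * (φ.den * φ.den) := by exact_mod_cast hs2
    rw [hφ, div_pow, ← mul_div_assoc, div_le_iff₀ (by positivity)]
    nlinarith
  -- If the exponent attained its target, the expansion `φ` gives a sufficient gap. If the cap on
  -- the rounds intervened, then `s ≥ 2 ^ (20 n) ≥ 10 n⁴`, and the crude expansion `1 / n²`
  -- suffices.
  obtain ⟨ψ, hψ0, hψs, hexp⟩ : ∃ ψ : ℝ, 0 ≤ ψ ∧ 5 ≤ s * (ψ ^ 2 / 2) ∧
      ∀ i, ∀ S ⊆ cluster ι i, 2 * S.card ≤ (cluster ι i).card →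
        ψ * d * S.card ≤ ∑ u ∈ S, ∑ v ∈ cluster ι i \ S, (adjInd G u v : ℝ) := by
    rcases hs3 with hs3 | hs3
    · refine ⟨φ, h.phi_pos_real.le, ?_, h.expansion⟩
      have : (10 : ℝ) * (φ.den * φ.den) ≤ s * (φ.num * φ.num) := by exact_mod_cast hs3
      have h2 : 10 ≤ (s : ℝ) * (φ : ℝ) ^ 2 := by
        rw [hφ, div_pow, ← mul_div_assoc, le_div_iff₀ (by positivity)]
        nlinarith
      linarith
    · refine ⟨1 / (n : ℝ) ^ 2, by positivity, ?_, h.expansion_crude⟩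
      have hn0 : (0 : ℝ) < n := by exact_mod_cast hn
      have h3 : (2 : ℝ) ^ (20 * n) ≤ s := by exact_mod_cast hs3
      have h4 : (n : ℝ) ≤ 2 ^ n := by exact_mod_cast Nat.lt_two_pow_self.le
      have h5 : (10 : ℝ) * n ^ 4 ≤ s := by
        refine le_trans ?_ h3
        calc (10 : ℝ) * n ^ 4 ≤ 2 ^ (16 * n) * (2 ^ n) ^ 4 := by
              gcongr
              calc (10 : ℝ) ≤ 2 ^ 16 := by norm_num
                _ ≤ 2 ^ (16 * n) := pow_le_pow_right₀ (by norm_num) (by omega)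
          _ = 2 ^ (20 * n) := by rw [← pow_mul, ← pow_add]; congr 1; ring
      have h6 : (1 / (n : ℝ) ^ 2) ^ 2 = 1 / n ^ 4 := by rw [div_pow, one_pow, ← pow_mul]
      rw [h6, div_div, mul_one_div, le_div_iff₀ (by positivity)]
      linarith
  set m : Fin n → ℝ := fun j => filterFun s (20 * n) (l j) with hm
  set t : ℝ := (3 / 10) ^ (20 * n) * (1 / 10) with ht
  have hcount : (Finset.univ.filter fun j => 1 - ψ ^ 2 / 2 < l j).card ≤ k :=
    card_large_eigenvalues hU l (fun i u => if ι u = i then (1 : ℝ) else 0) fun y hy => by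
      have := h.walk_gap hψ0 hexp y hy
      simpa only [hl] using this
  -- At most `k` eigenvalues are large, and each of them contributes at most 1 after filtering.
  have hmsq : ∑ j, m j ^ 2 ≤ k + n * t ^ 2 := by
    have h1 : ∀ j, m j ^ 2 ≤ (if 1 - ψ ^ 2 / 2 < l j then 1 else 0) + t ^ 2 := by
      intro j
      have hmem := filterFun_mem (hlm j).1 (hlm j).2 s (20 * n)
      split_ifs with hj
      · have : m j ^ 2 ≤ 1 := pow_le_one₀ hmem.1 hmem.2
        nlinarith [sq_nonneg t]
      · rw [zero_add]
        exact pow_le_pow_left₀ hmem.1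
          (filterFun_le (hlm j).1 (not_lt.1 hj) (by positivity) hψs (20 * n)) 2
    refine (Finset.sum_le_sum fun j _ => h1 j).trans ?_
    rw [Finset.sum_add_distrib, Finset.sum_boole, Finset.sum_const, Finset.card_univ,
      Fintype.card_fin, nsmul_eq_mul]
    have : ((Finset.univ.filter fun j => 1 - ψ ^ 2 / 2 < l j).card : ℝ) ≤ k := by
      exact_mod_cast hcount
    linarith
  have hfro := frobenius_specMat_sub hU l m ι h.clustering.nonempty (K := 5 * s)
    fun j => le_filterFun (hlm j).1 (hlm j).2 s (20 * n)
  simp only [← hl, h.cluster_walk_deficit] at hfro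
  refine ⟨s, y, hs1, hs2', fun σ => hy, ?_⟩
  rw [unitQ_encodeInput] at herr
  push_cast at herr
  -- Splitting off the rounding error by `(a + b)² ≤ 2a² + 2b²` turns the factor `2 * K = 10 s` into
  -- `20 s`.
  have h2 : ∀ u v, (y u v / (2 : ℝ) ^ (1000 * (n * n)) - clusterProj ι u v) ^ 2 ≤
      2 * (specMat U m u v - clusterProj ι u v) ^ 2 + 2 * ((1 / 2) ^ (30 * n)) ^ 2 := by
    intro u v
    have h3 := herr u v
    have h4 : (y u v / (2 : ℝ) ^ (1000 * (n * n)) - specMat U m u v) ^ 2 ≤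
        ((1 / 2) ^ (30 * n)) ^ 2 := by
      rw [← sq_abs]
      exact pow_le_pow_left₀ (abs_nonneg _) h3 2
    nlinarith [sq_nonneg ((y u v / (2 : ℝ) ^ (1000 * (n * n)) - specMat U m u v) -
      (specMat U m u v - clusterProj ι u v))]
  refine (Finset.sum_le_sum fun u _ => Finset.sum_le_sum fun v _ => h2 u v).trans ?_
  simp only [Finset.sum_add_distrib, ← Finset.mul_sum, Finset.sum_const, Finset.card_univ,
    Fintype.card_fin, nsmul_eq_mul]
  have h5 := half_pow_bound hn (show 0 ≤ t by positivity) le_rfl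
  linarith

/-- Cluster sizes lie between 1 and `n`, so the balance parameter may always be lowered to `n`. A
parameter polynomial in `n` is needed for the rounding error to be negligible against the thresholds
built from it. -/
theorem exists_capEta : ∃ en ed : ℤ, (∀ σ : Fin n → Fin k,
      capEta (encodeInput G φ k η σ) = (en, ed)) ∧ 0 < ed ∧ (1 : ℝ) ≤ en / ed ∧
      (en / ed : ℝ) ≤ η ∧ (en / ed : ℝ) ≤ n ∧
      ∀ i j, ((cluster ι i).card : ℝ) ≤ en / ed * (cluster ι j).card := by
  have hden : (0 : ℝ) < η.den := by exact_mod_cast η.den_pos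
  have hη : (η : ℝ) = η.num / η.den := by exact_mod_cast (Rat.num_div_den η).symm
  have hn3 := h.three_le_n
  by_cases hc : 0 < η.num - n * η.den
  · refine ⟨n, 1, fun σ => ?_, one_pos, ?_, ?_, ?_, fun i j => ?_⟩
    · rw [capEta, inputN_encodeInput]
      exact if_pos hc
    · push_cast
      rw [div_one]
      exact_mod_cast (by omega : 1 ≤ n)
    · rw [hη, le_div_iff₀ hden]
      push_cast
      rw [div_one]
      exact_mod_cast (by omega : (n : ℤ) * η.den ≤ η.num)
    · simp
    · have h1 := h.card_cluster_pos j
      have h2 : (1 : ℝ) ≤ (cluster ι j).card := by exact_mod_cast h1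
      have h3 : ((cluster ι i).card : ℝ) ≤ n := by
        have := (cluster ι i).card_le_univ
        rw [Fintype.card_fin] at this
        exact_mod_cast this
      push_cast
      rw [div_one]
      nlinarith
  · refine ⟨η.num, η.den, fun σ => ?_, by exact_mod_cast η.den_pos, ?_, ?_, ?_, fun i j => ?_⟩
    · rw [capEta, inputN_encodeInput]
      exact if_neg hc
    · push_cast
      rw [← hη]
      exact h.one_le_eta_real
    · push_cast
      rw [← hη]
    · push_cast
      rw [div_le_iff₀ hden]
      exact_mod_cast (by omega : η.num ≤ (n : ℤ) * η.den)
    · push_cast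
      rw [← hη]
      exact h.balanced i j

/-- The total relative boundary of the clusters. -/
theorem boundary_bounds :
    let κ := ∑ i, (∑ u ∈ cluster ι i, ∑ v ∈ Finset.univ \ cluster ι i, (adjInd G u v : ℝ)) /
      (d * (cluster ι i).card)
    κ ≤ k * ε ∧ (κ = 0 ∨ 1 / (n : ℝ) ^ 2 ≤ κ) := by
  intro κ
  have hd := h.d_pos
  have hnn : ∀ u v, (0 : ℝ) ≤ adjInd G u v := fun u v => by exact_mod_cast adjInd_nonneg u v
  have h0 : ∀ i, 0 ≤ (∑ u ∈ cluster ι i, ∑ v ∈ Finset.univ \ cluster ι i, (adjInd G u v : ℝ)) /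
      (d * (cluster ι i).card) := fun i =>
    div_nonneg (Finset.sum_nonneg fun u _ => Finset.sum_nonneg fun v _ => hnn u v)
      (mul_nonneg hd.le (Nat.cast_nonneg _))
  constructor
  · have : ∀ i ∈ Finset.univ,
        (∑ u ∈ cluster ι i, ∑ v ∈ Finset.univ \ cluster ι i, (adjInd G u v : ℝ)) /
          (d * (cluster ι i).card) ≤ ε := fun i _ => by
      rw [div_le_iff₀ (mul_pos hd (h.card_cluster_pos i))]
      exact h.out_le i
    exact (Finset.sum_le_card_nsmul _ _ _ this).trans (by simp)
  · by_cases hz : ∀ i, (∑ u ∈ cluster ι i, ∑ v ∈ Finset.univ \ cluster ι i, (adjInd G u v : ℝ)) = 0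
    · left
      exact Finset.sum_eq_zero fun i _ => by rw [hz i, zero_div]
    · right
      push Not at hz
      obtain ⟨i, hi⟩ := hz
      refine le_trans ?_ (Finset.single_le_sum (fun i _ => h0 i) (Finset.mem_univ i))
      have h1 : (1 : ℝ) ≤ ∑ u ∈ cluster ι i, ∑ v ∈ Finset.univ \ cluster ι i, (adjInd G u v : ℝ) := by
        have h2 : (0 : ℝ) < ∑ u ∈ cluster ι i, ∑ v ∈ Finset.univ \ cluster ι i,
            (adjInd G u v : ℝ) :=
          lt_of_le_of_ne (Finset.sum_nonneg fun u _ => Finset.sum_nonneg fun v _ => hnn u v)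
            (Ne.symm hi)
        have : 0 < ∑ u ∈ cluster ι i, ∑ v ∈ Finset.univ \ cluster ι i, adjInd G u v := by
          exact_mod_cast h2
        exact_mod_cast this
      have h3 : ((cluster ι i).card : ℝ) ≤ n := by
        have := (cluster ι i).card_le_univ
        rw [Fintype.card_fin] at this
        exact_mod_cast this
      have h4 := h.card_cluster_pos i
      refine div_le_div₀ (by linarith) h1 (mul_pos hd h4) ?_
      rw [sq]
      exact mul_le_mul h.d_le_n h3 h4.le (Nat.cast_nonneg _)

/-- The computed matrix determines the cluster of each vertex outside a small set that does not
depend on the noisy labels. -/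
theorem exists_badSet :
    ∃ (y b : Fin n → Fin n → ℤ) (Z : Finset (Fin n)),
      (∀ σ : Fin n → Fin k, projRound (encodeInput G φ k η σ) = toMat y) ∧
      (∀ (σ : Fin n → Fin k) (u v : Fin n), bigInd (encodeInput G φ k η σ) (y u v) = b u v) ∧
      (Z.card : ℝ) * (φ : ℝ) ^ 2 ≤ 168000 * (η : ℝ) ^ 3 * (n * ε) ∧
      (∀ u v, b u v = 0 ∨ b u v = 1) ∧
      ∀ u ∉ Z, 100 * (Finset.univ.filter fun v => b u v ≠ if ι v = ι u then 1 else 0).card ≤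
        (cluster ι (ι u)).card := by
  obtain ⟨s, y, hs1, hs2, hy, hfro⟩ := h.frobenius_projRound
  obtain ⟨en, ed, hcap, hed, hone, hleη, hlen, hbal⟩ := h.exists_capEta
  obtain ⟨hκ1, hκ2⟩ := h.boundary_bounds
  set κ := ∑ i, (∑ u ∈ cluster ι i, ∑ v ∈ Finset.univ \ cluster ι i, (adjInd G u v : ℝ)) /
      (d * (cluster ι i).card) with hκ
  set θ : ℝ := en / ed with hθ
  have hn3 := h.three_le_n
  have hn : (0 : ℝ) < n := by exact_mod_cast (by omega : 0 < n)
  have hk2 := h.two_le_k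
  have hk : (0 : ℝ) < k := by exact_mod_cast (by omega : 0 < k)
  have hed' : (0 : ℝ) < ed := by exact_mod_cast hed
  set Q : ℝ := 2 ^ (1000 * (n * n)) with hQ
  have hQ0 : 0 < Q := by positivity
  have hθ0 : 0 < θ := by linarith
  -- By balance `1 / |C| ≥ k / (θ n)` for every cluster; the threshold is half of this lower bound,
  -- so an entry on the wrong side of it is off by at least `τ`.
  set τ : ℝ := k / (2 * θ * n) with hτ
  have hτ0 : 0 < τ := by positivity
  have hbig : ∀ (σ : Fin n → Fin k) (t : ℤ), bigInd (encodeInput G φ k η σ) t =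
      if τ ≤ t / Q then 1 else 0 := by
    intro σ t
    unfold bigInd
    rw [hcap σ, inputN_encodeInput, unitQ_encodeInput]
    change (if 0 < 2 * en * n * t - (k : ℤ) * ed * 2 ^ (1000 * (n * n)) + 1 then (1 : ℤ) else 0) = _
    refine if_congr ?_ rfl rfl
    rw [hτ, div_le_div_iff₀ (by positivity) hQ0]
    have e1 : (k : ℝ) * Q ≤ t * (2 * θ * n) ↔ (k : ℝ) * ed * Q ≤ 2 * en * n * t := by
      have : en = θ * ed := by rw [hθ]; field_simp
      rw [this]
      constructor
      · intro h1
        nlinarith [mul_le_mul_of_nonneg_left h1 hed'.le]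
      · intro h1
        refine le_of_mul_le_mul_left ?_ hed'
        nlinarith
    rw [e1, hQ]
    have e2 : (k : ℝ) * ed * 2 ^ (1000 * (n * n)) ≤ 2 * en * n * t ↔
        (k : ℤ) * ed * 2 ^ (1000 * (n * n)) ≤ 2 * en * n * t := by
      exact_mod_cast Iff.rfl
    rw [e2]
    generalize (k : ℤ) * ed * 2 ^ (1000 * (n * n)) = A
    generalize 2 * en * n * t = B
    omega
  set ℓ : Fin n → ℝ := fun u => ∑ v, (y u v / Q - clusterProj ι u v) ^ 2 with hℓ
  have hℓ0 : ∀ u, 0 ≤ ℓ u := fun u => Finset.sum_nonneg fun v _ => sq_nonneg _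
  have hupper : ∀ i, k * ((cluster ι i).card : ℝ) ≤ θ * n := by
    intro i
    have := Finset.sum_le_sum fun j (_ : j ∈ Finset.univ) => hbal i j
    rw [← Finset.mul_sum, sum_card_cluster] at this
    simpa using this
  have hlower : ∀ j, (n : ℝ) ≤ k * (θ * (cluster ι j).card) := by
    intro j
    have := Finset.sum_le_sum fun i (_ : i ∈ Finset.univ) => hbal i j
    rw [sum_card_cluster] at this
    simpa using this
  -- Each misjudged entry costs `τ²` in the row error, and `n / (θ k)` is a lower bound for cluster
  -- sizes. Rows outside `Z` thus misjudge at most one percent of a cluster.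
  set Z := Finset.univ.filter fun u => τ ^ 2 * (n / (θ * k)) < 100 * ℓ u with hZ
  refine ⟨y, fun u v => if τ ≤ y u v / Q then 1 else 0, Z, hy, fun σ u v => hbig σ _, ?_,
    fun u v => ?_, fun u hu => ?_⟩
  · have h1 : (Z.card : ℝ) * (τ ^ 2 * (n / (θ * k))) ≤ 100 * (20 * s * κ + (1 / 2) ^ (30 * n)) := by
      rw [← nsmul_eq_mul]
      refine (Finset.card_nsmul_le_sum Z (fun u => 100 * ℓ u) _
        fun u hu => (Finset.mem_filter.1 hu).2.le).trans ?_
      rw [← Finset.mul_sum]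
      refine mul_le_mul_of_nonneg_left (le_trans ?_ hfro) (by norm_num)
      exact Finset.sum_le_sum_of_subset_of_nonneg (Finset.subset_univ _) fun u _ _ => hℓ0 u
    have e1 : τ ^ 2 * (n / (θ * k)) = k / (4 * θ ^ 3 * n) := by
      rw [hτ]; field_simp; ring
    rw [e1, ← mul_div_assoc, div_le_iff₀ (by positivity)] at h1
    set w : ℝ := (1 / 2) ^ (30 * n) with hw
    have hw0 : 0 < w := by positivity
    have hnpow : (n : ℝ) ≤ 2 ^ n := by exact_mod_cast Nat.lt_two_pow_self.le
    have hwn : 400 * (n : ℝ) ^ 4 * w < 1 := by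
      rw [hw, one_div, inv_pow, ← div_eq_mul_inv, div_lt_one (by positivity)]
      calc 400 * (n : ℝ) ^ 4 ≤ 400 * (2 ^ n) ^ 4 := by gcongr
        _ < 2 ^ (26 * n) * (2 ^ n) ^ 4 := by
          gcongr
          calc (400 : ℝ) < 2 ^ 26 := by norm_num
            _ ≤ 2 ^ (26 * n) := pow_le_pow_right₀ (by norm_num) (by omega)
        _ = 2 ^ (30 * n) := by rw [← pow_mul, ← pow_add]; congr 1; ring
    have hε := h.eps_pos
    -- Without boundary edges the bound must be proved with rounding error alone, which is too small
    -- to spoil even one row. With a boundary edge, `κ ≥ 1 / n²` dominates the rounding error.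
    rcases hκ2 with h0 | h0
    · have hZ0 : Z.card = 0 := by
        by_contra hne
        have h2 : (1 : ℝ) ≤ Z.card := by exact_mod_cast Nat.one_le_iff_ne_zero.2 hne
        have hk1 : (1 : ℝ) ≤ k := by exact_mod_cast (by omega : 1 ≤ k)
        have h3 : (1 : ℝ) ≤ Z.card * k := by nlinarith
        rw [h0, mul_zero, zero_add] at h1
        have h4 : θ ^ 3 ≤ (n : ℝ) ^ 3 := pow_le_pow_left₀ hθ0.le hlen 3
        have h5 : 100 * w * (4 * θ ^ 3 * n) ≤ 400 * (n : ℝ) ^ 4 * w := by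
          have := mul_le_mul_of_nonneg_left h4 (show 0 ≤ 400 * w * n by positivity)
          nlinarith
        linarith
      rw [hZ0]
      have := h.one_le_eta_real
      simp only [Nat.cast_zero, zero_mul]
      positivity
    · have hs1' : (1 : ℝ) ≤ s := by exact_mod_cast hs1
      have hκ0 : 0 ≤ κ := le_trans (by positivity) h0
      have hwκ : w ≤ s * κ := by
        have h2 : w ≤ 1 / (n : ℝ) ^ 2 := by
          rw [le_div_iff₀ (by positivity)]
          have : (1 : ℝ) ≤ n := by exact_mod_cast (by omega : 1 ≤ n)
          have h3 : (n : ℝ) ^ 2 ≤ n ^ 4 := pow_le_pow_right₀ this (by norm_num)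
          nlinarith
        nlinarith
      have h2 : (Z.card : ℝ) * k ≤ 8400 * (s * (k * ε)) * (θ ^ 3 * n) := by
        refine h1.trans ?_
        have h3 : 100 * (20 * s * κ + w) ≤ 2100 * (s * (k * ε)) := by
          have := mul_le_mul_of_nonneg_left hκ1 (show (0 : ℝ) ≤ s by linarith)
          linarith
        have := mul_le_mul_of_nonneg_right h3 (show 0 ≤ 4 * θ ^ 3 * n by positivity)
        linarith
      have h3 : (Z.card : ℝ) ≤ 8400 * (s * ε) * (θ ^ 3 * n) := by
        refine le_of_mul_le_mul_right ?_ hk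
        linarith
      have h4 : θ ^ 3 ≤ (η : ℝ) ^ 3 := pow_le_pow_left₀ hθ0.le hleη 3
      calc (Z.card : ℝ) * (φ : ℝ) ^ 2 ≤ 8400 * (s * ε) * (θ ^ 3 * n) * (φ : ℝ) ^ 2 :=
            mul_le_mul_of_nonneg_right h3 (sq_nonneg _)
        _ = 8400 * (s * (φ : ℝ) ^ 2) * (θ ^ 3 * (n * ε)) := by ring
        _ ≤ 8400 * 20 * ((η : ℝ) ^ 3 * (n * ε)) := by gcongr
        _ = _ := by ring
  · dsimp only
    split_ifs <;> simp
  · have hu' : 100 * ℓ u ≤ τ ^ 2 * (n / (θ * k)) := by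
      by_contra hc
      exact hu (Finset.mem_filter.2 ⟨Finset.mem_univ _, not_le.1 hc⟩)
    set C := cluster ι (ι u)
    have hC := h.card_cluster_pos (ι u)
    have h2τ : 2 * τ ≤ 1 / (C.card : ℝ) := by
      rw [hτ, le_div_iff₀ hC]
      have := hupper (ι u)
      calc 2 * (k / (2 * θ * n)) * (C.card : ℝ) = k * C.card / (θ * n) := by field_simp
        _ ≤ 1 := (div_le_one (by positivity)).2 this
    set D := Finset.univ.filter fun v => (if τ ≤ y u v / Q then (1 : ℤ) else 0) ≠
      if ι v = ι u then 1 else 0 with hD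
    have h1 : ∀ v ∈ D, τ ^ 2 ≤ (y u v / Q - clusterProj ι u v) ^ 2 := by
      intro v hv
      have hv := (Finset.mem_filter.1 hv).2
      unfold clusterProj
      by_cases hι : ι v = ι u
      · have hlt : ¬ τ ≤ y u v / Q := fun hc => by simp [hι, hc] at hv
        rw [if_pos hι.symm]
        push Not at hlt
        have : τ ≤ 1 / (C.card : ℝ) - y u v / Q := by linarith
        rw [← neg_sq (y u v / Q - _), neg_sub]
        exact pow_le_pow_left₀ hτ0.le this 2
      · have hle : τ ≤ y u v / Q := by
          by_contra hc
          simp [hι, hc] at hv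
        rw [if_neg (Ne.symm hι), sub_zero]
        exact pow_le_pow_left₀ hτ0.le hle 2
    have h2 : (D.card : ℝ) * τ ^ 2 ≤ ℓ u := by
      rw [← nsmul_eq_mul]
      refine (Finset.card_nsmul_le_sum D _ _ h1).trans ?_
      exact Finset.sum_le_sum_of_subset_of_nonneg (Finset.subset_univ _) fun v _ _ => sq_nonneg _
    have h3 : (100 * D.card : ℝ) * τ ^ 2 ≤ (n / (θ * k)) * τ ^ 2 := by linarith
    have h4 : (100 * D.card : ℝ) ≤ n / (θ * k) := le_of_mul_le_mul_right h3 (by positivity)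
    have h5 : n / (θ * k) ≤ (C.card : ℝ) := by
      rw [div_le_iff₀ (by positivity)]
      have := hlower (ι u)
      linarith
    exact_mod_cast h4.trans h5

end Setting

end BadSet

end NoisyClustering

namespace NoisyClustering

/-! ## What the algorithm computes -/

section Semantics

variable {n k : ℕ} {G : SimpleGraph (Fin n)} {φ η : ℚ}

theorem eqInd_eq (x y : ℤ) : eqInd x y = if x = y then 1 else 0 := by
  unfold eqInd
  split_ifs <;> first | rfl | omega

theorem eqInd_label (i j : Fin k) : eqInd ((i : ℕ) : ℤ) ((j : ℕ) : ℤ) = if i = j then 1 else 0 := by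
  rw [eqInd_eq]
  refine if_congr ?_ rfl rfl
  rw [Nat.cast_inj, Fin.val_inj]

theorem exists_toMat_cubicRound_iterate (a b c Q : ℤ) (x : Fin n → Fin n → ℤ) (j : ℕ) :
    ∃ y, (cubicRound a b c Q)^[j] (toMat x) = toMat (n := n) y := by
  induction j with
  | zero => exact ⟨x, rfl⟩
  | succ j ih =>
    obtain ⟨y, hy⟩ := ih
    exact ⟨_, by rw [Function.iterate_succ_apply', hy, cubicRound_toMat]⟩

theorem exists_toMat_squareStep_iterate (num den Q s : ℤ) (x : Fin n → Fin n → ℤ) (j : ℕ) :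
    ∃ y, ((squareStep num den Q)^[j] (s, toMat x)).2 = toMat (n := n) y := by
  induction j with
  | zero => exact ⟨x, rfl⟩
  | succ j ih =>
    obtain ⟨y, hy⟩ := ih
    rw [Function.iterate_succ_apply']
    generalize (squareStep num den Q)^[j] (s, toMat x) = t at *
    unfold squareStep
    split_ifs
    · exact ⟨_, by dsimp only; rw [hy, cubicRound_toMat]⟩
    · exact ⟨y, hy⟩

/-- The output must be a labeling on every encoded input, so the shape of the computed matrix is
needed outside the standing assumptions as well. -/
theorem exists_toMat_projRound (σ : Fin n → Fin k) :
    ∃ y, projRound (encodeInput G φ k η σ) = toMat (n := n) y := by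
  unfold projRound powerRound
  have hw : ∃ x, walkRound (encodeInput G φ k η σ) = toMat (n := n) x := by
    refine ⟨fun u v => adjInd G u v * unitQ (encodeInput G φ k η σ) / (List.ofFn (adjInd G u)).sum, ?_⟩
    unfold walkRound
    rw [encodeInput_adj]
    simp only [toMat, List.map_ofFn]
    congr 1
    ext1 u
    simp only [Function.comp_apply, List.map_ofFn]
    rfl
  obtain ⟨x, hx⟩ := hw
  rw [hx, cubicRound_toMat]
  obtain ⟨y, hy⟩ := exists_toMat_squareStep_iterate (encodeInput G φ k η σ).2.1.1
    (encodeInput G φ k η σ).2.1.2 (unitQ (encodeInput G φ k η σ)) 1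
    (cubicFn 1 1 2 (unitQ (encodeInput G φ k η σ)) x) (20 * inputN (encodeInput G φ k η σ)).toNat
  rw [hy]
  exact exists_toMat_cubicRound_iterate _ _ _ _ _ _

theorem majorityLabels_eq {σ : Fin n → Fin k} {y : Fin n → Fin n → ℤ}
    (hy : projRound (encodeInput G φ k η σ) = toMat y) :
    majorityLabels (encodeInput G φ k η σ) = List.ofFn fun u =>
      (encodeLabeling σ).foldl (fun t l =>
        if 0 < excess (encodeInput G φ k η σ) (List.ofFn (y u)) l then l else t)
        ((σ u : ℕ) : ℤ) := by
  unfold majorityLabels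
  rw [hy]
  change ((toMat y).zip (encodeLabeling σ)).map _ = _
  rw [toMat, encodeLabeling, zip_ofFn, List.map_ofFn]
  rfl

/-- The majority labels are labels. -/
theorem exists_majorityLabels (σ : Fin n → Fin k) :
    ∃ hat : Fin n → Fin k, majorityLabels (encodeInput G φ k η σ) = encodeLabeling hat := by
  obtain ⟨y, hy⟩ := exists_toMat_projRound (G := G) (φ := φ) (η := η) σ
  rw [majorityLabels_eq hy]
  have : ∀ u, ∃ i : Fin k, (encodeLabeling σ).foldl (fun t l =>
        if 0 < excess (encodeInput G φ k η σ) (List.ofFn (y u)) l then l else t)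
        ((σ u : ℕ) : ℤ) = ((i : ℕ) : ℤ) := by
    intro u
    rcases foldl_select_mem
      (fun l => 0 < excess (encodeInput G φ k η σ) (List.ofFn (y u)) l) (encodeLabeling σ)
      ((σ u : ℕ) : ℤ) with h | h
    · exact ⟨_, h⟩
    · rw [encodeLabeling, List.mem_ofFn] at h
      obtain ⟨v, hv⟩ := h
      exact ⟨σ v, by rw [encodeLabeling]; exact hv.symm⟩
  choose hat hhat using this
  refine ⟨hat, ?_⟩
  rw [encodeLabeling]
  congr 1
  ext1 u
  exact hhat u

/-- The order of the search is irrelevant because only one label can pass the majority test. -/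
theorem foldl_select_eq {α : Type*} (P : α → Prop) [DecidablePred P] {c : α} (l : List α) (t : α)
    (h1 : ∀ y ∈ l, P y → y = c) (h2 : t = c ∨ (c ∈ l ∧ P c)) :
    l.foldl (fun t y => if P y then y else t) t = c := by
  induction l generalizing t with
  | nil => simpa using h2
  | cons y l ih =>
    rw [List.foldl_cons]
    refine ih _ (fun z hz => h1 z (List.mem_cons_of_mem _ hz)) ?_
    by_cases hy : P y
    · rw [if_pos hy]
      exact Or.inl (h1 y List.mem_cons_self hy)
    · rw [if_neg hy]
      rcases h2 with h2 | ⟨h2, h3⟩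
      · exact Or.inl h2
      · rcases List.mem_cons.1 h2 with rfl | h4
        · exact absurd h3 hy
        · exact Or.inr ⟨h4, h3⟩

theorem excess_eq {σ : Fin n → Fin k} {y b : Fin n → Fin n → ℤ}
    (hb : ∀ u v, bigInd (encodeInput G φ k η σ) (y u v) = b u v) (u : Fin n) (i : Fin k) :
    excess (encodeInput G φ k η σ) (List.ofFn (y u)) ((i : ℕ) : ℤ) =
      ∑ v, b u v * (if σ v = i then 1 else -1) := by
  unfold excess
  change (((List.ofFn (y u)).zip (encodeLabeling σ)).map _).sum = _
  rw [encodeLabeling, zip_ofFn, sum_map_ofFn]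
  refine Finset.sum_congr rfl fun v _ => ?_
  dsimp only
  rw [hb, eqInd_label]
  split_ifs <;> norm_num

/-- A label shared by more than half of the vertices with a large entry is the majority label. -/
theorem majority_unique {σ : Fin n → Fin k} {b : Fin n → ℤ} (hb : ∀ v, b v = 0 ∨ b v = 1)
    {i j : Fin k} (hi : 0 < ∑ v, b v * (if σ v = i then 1 else -1))
    (hj : 0 < ∑ v, b v * (if σ v = j then 1 else -1)) : j = i := by
  by_contra hne
  have h1 : ∑ v, b v * (if σ v = i then 1 else -1) + ∑ v, b v * (if σ v = j then 1 else -1) ≤ 0 := by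
    rw [← Finset.sum_add_distrib]
    refine Finset.sum_nonpos fun v _ => ?_
    rcases hb v with h | h
    · simp [h]
    · rw [h]
      by_cases h1 : σ v = i
      · rw [if_pos h1, if_neg (fun h2 => hne (h2.symm.trans h1))]; norm_num
      · rw [if_neg h1]; split_ifs <;> norm_num
  omega

open scoped Classical in
/-- Indicator function of a set of vertices. -/
noncomputable def ind (S : Finset (Fin n)) (u : Fin n) : ℤ := if u ∈ S then 1 else 0

open scoped Classical in
/-- Vertices with many neighbours of another label. -/
noncomputable def boundarySet (G : SimpleGraph (Fin n)) (φ : ℚ) (hat : Fin n → Fin k) :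
    Finset (Fin n) :=
  Finset.univ.filter fun u => φ.num * ∑ v, adjInd G u v ≤
    2 * φ.den * ∑ v, adjInd G u v * (if hat u = hat v then 0 else 1)

/-- Vertices on which two labelings differ. -/
def differSet (σ hat : Fin n → Fin k) : Finset (Fin n) := Finset.univ.filter fun u => σ u ≠ hat u

open scoped Classical in
/-- One round of a breadth first search inside `F`. -/
noncomputable def growSet (G : SimpleGraph (Fin n)) (F S : Finset (Fin n)) : Finset (Fin n) :=
  S ∪ F.filter fun u => ∃ v ∈ S, G.Adj u v

/-- Vertices of `F` that are connected inside `F` to `F ∩ B`. -/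
noncomputable def keepSet (G : SimpleGraph (Fin n)) (F B : Finset (Fin n)) : Finset (Fin n) :=
  (growSet G F)^[n] (F ∩ B)

theorem boundaryInd_eq (σ hat : Fin n → Fin k) :
    boundaryInd (encodeInput G φ k η σ) (encodeLabeling hat) =
      List.ofFn (ind (boundarySet G φ hat)) := by
  unfold boundaryInd
  rw [encodeInput_adj, toMat, encodeLabeling, zip_ofFn, List.map_ofFn]
  congr 1
  ext1 u
  simp only [Function.comp_apply]
  rw [zip_ofFn, sum_map_ofFn, List.sum_ofFn]
  unfold ind
  refine if_congr ?_ rfl rfl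
  simp only [boundarySet, Finset.mem_filter, Finset.mem_univ, true_and, eqInd_label]
  have e : ∀ v, adjInd G u v * (1 - if hat u = hat v then 1 else 0) =
      adjInd G u v * (if hat u = hat v then 0 else 1) := by
    intro v
    split_ifs <;> ring
  simp only [e]
  change 0 < 2 * (φ.den : ℤ) * _ - φ.num * _ + 1 ↔ _
  omega

theorem differInd_eq (σ hat : Fin n → Fin k) :
    differInd (encodeInput G φ k η σ) (encodeLabeling hat) = List.ofFn (ind (differSet σ hat)) := by
  unfold differInd
  change ((encodeLabeling σ).zip (encodeLabeling hat)).map _ = _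
  rw [encodeLabeling, encodeLabeling, zip_ofFn, List.map_ofFn]
  congr 1
  ext1 u
  simp only [Function.comp_apply, eqInd_label, ind, differSet, Finset.mem_filter, Finset.mem_univ,
    true_and]
  by_cases h : σ u = hat u <;> simp [h]

theorem growStep_eq (F S : Finset (Fin n)) :
    growStep (toMat (adjInd G)) (List.ofFn (ind F)) (List.ofFn (ind S)) =
      List.ofFn (ind (growSet G F S)) := by
  classical
  unfold growStep
  rw [toMat, zip_ofFn, zip_ofFn, List.map_ofFn]
  congr 1
  ext1 u
  simp only [Function.comp_apply, dot_ofFn]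
  have hnn : ∀ v, 0 ≤ adjInd G u v * ind S v := fun v =>
    mul_nonneg (adjInd_nonneg u v) (by unfold ind; split_ifs <;> simp)
  have hsum : 0 < ∑ v, adjInd G u v * ind S v ↔ ∃ v ∈ S, G.Adj u v := by
    rw [Finset.sum_pos_iff_of_nonneg fun v _ => hnn v]
    constructor
    · rintro ⟨v, -, hv⟩
      refine ⟨v, ?_, ?_⟩
      · by_contra hc
        simp [ind, hc] at hv
      · by_contra hc
        simp [adjInd, hc] at hv
    · rintro ⟨v, hv, hadj⟩
      exact ⟨v, Finset.mem_univ _, by simp [ind, adjInd, hv, hadj]⟩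
  have hsum0 : 0 ≤ ∑ v, adjInd G u v * ind S v := Finset.sum_nonneg fun v _ => hnn v
  rw [ind.eq_1 (growSet G F S)]
  refine if_congr ?_ rfl rfl
  simp only [growSet, Finset.mem_union, Finset.mem_filter]
  rw [← hsum]
  generalize ∑ v, adjInd G u v * ind S v = t at *
  by_cases h1 : u ∈ S <;> by_cases h2 : u ∈ F <;> simp [ind, h1, h2]
  omega

theorem keepInd_eq (σ hat : Fin n → Fin k) :
    keepInd (encodeInput G φ k η σ) (encodeLabeling hat) =
      List.ofFn (ind (keepSet G (differSet σ hat) (boundarySet G φ hat))) := by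
  unfold keepInd
  rw [differInd_eq, boundaryInd_eq, inputN_encodeInput, Int.toNat_natCast, encodeInput_adj,
    zip_ofFn, List.map_ofFn, keepSet]
  have h0 : List.ofFn ((fun p : ℤ × ℤ => p.1 * p.2) ∘
      fun i => (ind (differSet σ hat) i, ind (boundarySet G φ hat) i)) =
      List.ofFn (ind (differSet σ hat ∩ boundarySet G φ hat)) := by
    congr 1
    ext1 u
    by_cases h1 : u ∈ differSet σ hat <;> by_cases h2 : u ∈ boundarySet G φ hat <;>
      simp [ind, h1, h2]
  rw [h0]
  generalize differSet σ hat ∩ boundarySet G φ hat = S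
  generalize differSet σ hat = F
  have : ∀ j, (growStep (toMat (adjInd G)) (List.ofFn (ind F)))^[j] (List.ofFn (ind S)) =
      List.ofFn (ind ((growSet G F)^[j] S)) := by
    intro j
    induction j with
    | zero => rfl
    | succ j ih => rw [Function.iterate_succ_apply', Function.iterate_succ_apply', ih, growStep_eq]
  exact this n

open scoped Classical in
/-- The labeling computed by the algorithm. -/
noncomputable def outLabel (G : SimpleGraph (Fin n)) (φ : ℚ) (σ hat : Fin n → Fin k) (u : Fin n) :
    Fin k :=
  if u ∈ keepSet G (differSet σ hat) (boundarySet G φ hat) then σ u else hat u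

theorem denoise_eq {σ hat : Fin n → Fin k}
    (hhat : majorityLabels (encodeInput G φ k η σ) = encodeLabeling hat) :
    denoise (encodeInput G φ k η σ) = encodeLabeling (outLabel G φ σ hat) := by
  unfold denoise finalLabels
  rw [hhat, keepInd_eq]
  change ((List.ofFn _).zip ((encodeLabeling σ).zip (encodeLabeling hat))).map _ = _
  rw [encodeLabeling, encodeLabeling, encodeLabeling, zip_ofFn, zip_ofFn, List.map_ofFn]
  congr 1
  ext1 u
  simp only [Function.comp_apply, ind, outLabel]
  split_ifs <;> simp_all

theorem subset_growSet (F S : Finset (Fin n)) : S ⊆ growSet G F S := Finset.subset_union_left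

theorem subset_keepSet (F B : Finset (Fin n)) : F ∩ B ⊆ keepSet G F B := by
  unfold keepSet
  have : ∀ j, F ∩ B ⊆ (growSet G F)^[j] (F ∩ B) := by
    intro j
    induction j with
    | zero => exact subset_rfl
    | succ j ih =>
      rw [Function.iterate_succ_apply']
      exact ih.trans (subset_growSet F _)
  exact this n

/-- Until the search stabilises it gains at least one vertex per round, so `n` rounds suffice. -/
theorem growSet_keepSet (F B : Finset (Fin n)) : growSet G F (keepSet G F B) = keepSet G F B := by
  unfold keepSet
  have : ∀ j, (growSet G F)^[j + 1] (F ∩ B) = (growSet G F)^[j] (F ∩ B) ∨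
      j + 1 ≤ ((growSet G F)^[j + 1] (F ∩ B)).card := by
    intro j
    induction j with
    | zero =>
      by_cases h : growSet G F (F ∩ B) = F ∩ B
      · exact Or.inl h
      · right
        have := Finset.card_lt_card (Finset.ssubset_iff_subset_ne.2
          ⟨subset_growSet (G := G) F (F ∩ B), Ne.symm h⟩)
        simp only [zero_add, Function.iterate_one]
        omega
    | succ j ih =>
      rcases ih with ih | ih
      · left
        rw [Function.iterate_succ_apply' _ (j + 1), ih]
        rwa [Function.iterate_succ_apply'] at ih
      · rw [Function.iterate_succ_apply' _ (j + 1)]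
        generalize (growSet G F)^[j + 1] (F ∩ B) = S at *
        by_cases h : growSet G F S = S
        · exact Or.inl h
        · right
          have := Finset.card_lt_card (Finset.ssubset_iff_subset_ne.2
            ⟨subset_growSet (G := G) F S, Ne.symm h⟩)
          omega
  rcases this n with h | h
  · rwa [Function.iterate_succ_apply'] at h
  · have := ((growSet G F)^[n + 1] (F ∩ B)).card_le_univ
    rw [Fintype.card_fin] at this
    omega

/-- The kept set is contained in every set that contains its start and is closed. -/
theorem keepSet_subset {F B : Finset (Fin n)} {R : Set (Fin n)} (h0 : ∀ u ∈ F ∩ B, u ∈ R)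
    (h1 : ∀ u ∈ F, ∀ v ∈ R, G.Adj u v → u ∈ R) : ∀ u ∈ keepSet G F B, u ∈ R := by
  classical
  unfold keepSet
  have : ∀ j, ∀ u ∈ (growSet G F)^[j] (F ∩ B), u ∈ R := by
    intro j
    induction j with
    | zero => exact h0
    | succ j ih =>
      intro u hu
      rw [Function.iterate_succ_apply', growSet, Finset.mem_union, Finset.mem_filter] at hu
      rcases hu with hu | ⟨hu, v, hv, hadj⟩
      · exact ih u hu
      · exact h1 u hu v (ih v hv) hadj
  exact this n

end Semantics

end NoisyClustering

namespace NoisyClustering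

/-! ## The vertices reached through noise -/

section Paths

variable {n k : ℕ} {G : SimpleGraph (Fin n)}

open scoped Classical in
/-- Self-avoiding paths of length `l` that start next to `w`, as lists with the last vertex first. -/
noncomputable def paths (G : SimpleGraph (Fin n)) (w : Fin n) : ℕ → Finset (List (Fin n))
  | 0 => {[]}
  | l + 1 => (paths G w l).biUnion fun L =>
      (Finset.univ.filter fun v => G.Adj (L.headD w) v ∧ v ∉ L).image fun v => v :: L

theorem mem_paths_succ {w : Fin n} {l : ℕ} {M : List (Fin n)} :
    M ∈ paths G w (l + 1) ↔
      ∃ L ∈ paths G w l, ∃ v, (G.Adj (L.headD w) v ∧ v ∉ L) ∧ v :: L = M := by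
  classical
  rw [paths, Finset.mem_biUnion]
  refine exists_congr fun L => and_congr_right fun _ => ?_
  rw [Finset.mem_image]
  refine exists_congr fun v => and_congr_left fun _ => ?_
  simp

theorem nodup_of_mem_paths {w : Fin n} {l : ℕ} {L : List (Fin n)} (h : L ∈ paths G w l) :
    L.Nodup ∧ L.length = l := by
  induction l generalizing L with
  | zero => simp [paths] at h; simp [h]
  | succ l ih =>
    obtain ⟨L, hL, v, ⟨-, hv⟩, rfl⟩ := mem_paths_succ.1 h
    exact ⟨List.nodup_cons.2 ⟨hv, (ih hL).1⟩, by rw [List.length_cons, (ih hL).2]⟩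

open scoped Classical in
theorem card_paths_le {d : ℕ} (hd : ∀ u, (Finset.univ.filter fun v => G.Adj u v).card ≤ d)
    (w : Fin n) (l : ℕ) : (paths G w l).card ≤ d ^ l := by
  induction l with
  | zero => simp [paths]
  | succ l ih =>
    rw [paths, pow_succ]
    refine (Finset.card_biUnion_le_card_mul _ _ d fun L _ => ?_).trans (Nat.mul_le_mul_right _ ih)
    refine Finset.card_image_le.trans (le_trans (Finset.card_le_card ?_) (hd (L.headD w)))
    intro v hv
    simp only [Finset.mem_filter, Finset.mem_univ, true_and] at hv ⊢
    exact hv.1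

/-- Cut the path off at `v`. -/
theorem exists_path_to_mem {w : Fin n} {l : ℕ} {L : List (Fin n)} (h : L ∈ paths G w l) {v : Fin n}
    (hv : v ∈ L) : ∃ l', ∃ M ∈ paths G w l', M.headD w = v ∧ ∀ u ∈ M, u ∈ L := by
  induction l generalizing L with
  | zero => simp [paths] at h; simp [h] at hv
  | succ l ih =>
    obtain ⟨L', hL, x, hx, rfl⟩ := mem_paths_succ.1 h
    rcases List.mem_cons.1 hv with rfl | hv'
    · exact ⟨l + 1, _, h, rfl, fun u hu => hu⟩
    · obtain ⟨l', M, hM, h1, h2⟩ := ih hL hv'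
      exact ⟨l', M, hM, h1, fun u hu => List.mem_cons_of_mem _ (h2 u hu)⟩

/-- Vertices reached from `W` by paths inside `N`. -/
def Reached (G : SimpleGraph (Fin n)) (W N : Finset (Fin n)) : Set (Fin n) :=
  {u | ∃ w ∈ W, ∃ l, ∃ L ∈ paths G w l, L.headD w = u ∧ ∀ v ∈ L, v ∈ N}

theorem subset_reached {W N : Finset (Fin n)} {u : Fin n} (h : u ∈ W) : u ∈ Reached G W N :=
  ⟨u, h, 0, [], by simp [paths], rfl, by simp⟩

/-- If `u` already lies on the path, the path is cut there rather than extended. Paths stay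
self-avoiding, so the noise events along them are independent. -/
theorem reached_step {W N : Finset (Fin n)} {u v : Fin n} (hv : v ∈ Reached G W N) (hu : u ∈ N)
    (hadj : G.Adj u v) : u ∈ Reached G W N := by
  obtain ⟨w, hw, l, L, hL, hhead, hN⟩ := hv
  by_cases h : u ∈ L
  · obtain ⟨l', M, hM, h1, h2⟩ := exists_path_to_mem hL h
    exact ⟨w, hw, l', M, hM, h1, fun x hx => hN x (h2 x hx)⟩
  · refine ⟨w, hw, l + 1, u :: L, mem_paths_succ.2 ⟨L, hL, u, ⟨?_, h⟩, rfl⟩, rfl, ?_⟩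
    · rw [hhead]; exact hadj.symm
    · intro x hx
      rcases List.mem_cons.1 hx with rfl | hx
      · exact hu
      · exact hN x hx

open scoped Classical in
/-- The number of vertices reached from `W`, counted with the paths that reach them. -/
theorem card_reached_le (W N : Finset (Fin n)) :
    ((Finset.univ.filter fun u => u ∈ Reached G W N ∧ u ∉ W).card : ℝ) ≤
      ∑ w ∈ W, ∑ l ∈ Finset.range n, ∑ L ∈ paths G w (l + 1),
        if ∀ v ∈ L, v ∈ N then (1 : ℝ) else 0 := by
  have hsub : (Finset.univ.filter fun u => u ∈ Reached G W N ∧ u ∉ W) ⊆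
      W.biUnion fun w => (Finset.range n).biUnion fun l =>
        ((paths G w (l + 1)).filter fun L => ∀ v ∈ L, v ∈ N).image fun L => L.headD w := by
    intro u hu
    obtain ⟨⟨w, hw, l, L, hL, hhead, hN⟩, huW⟩ := (Finset.mem_filter.1 hu).2
    rcases l with _ | l
    · simp only [paths, Finset.mem_singleton] at hL
      subst hL
      exact absurd (hhead ▸ hw) huW
    · simp only [Finset.mem_biUnion, Finset.mem_image, Finset.mem_filter, Finset.mem_range]
      refine ⟨w, hw, l, ?_, L, ⟨hL, hN⟩, hhead⟩
      -- A self-avoiding path has at most `n` vertices, so the sum over lengths is finite.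
      have h1 := nodup_of_mem_paths hL
      have h2 := h1.1.length_le_card
      rw [h1.2, Fintype.card_fin] at h2
      omega
  have h1 : ((Finset.univ.filter fun u => u ∈ Reached G W N ∧ u ∉ W).card) ≤
      ∑ w ∈ W, ∑ l ∈ Finset.range n, ((paths G w (l + 1)).filter fun L => ∀ v ∈ L, v ∈ N).card := by
    refine (Finset.card_le_card hsub).trans (Finset.card_biUnion_le.trans ?_)
    refine Finset.sum_le_sum fun w _ => Finset.card_biUnion_le.trans ?_
    exact Finset.sum_le_sum fun l _ => Finset.card_image_le
  refine (Nat.cast_le.2 h1).trans (le_of_eq ?_)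
  push_cast
  refine Finset.sum_congr rfl fun w _ => Finset.sum_congr rfl fun l _ => ?_
  rw [Finset.sum_boole]

end Paths

/-! ## The number of errors -/

section Errors

variable {n d k : ℕ} {G : SimpleGraph (Fin n)} {φ η : ℚ} {ε δ : ℝ} {ι : Fin n → Fin k}
  {p : Fin n → Fin k → ℝ}

open scoped Classical in
/-- The vertices on which the boundary of a labeling can lie that agrees with `ι` outside `Z`. -/
noncomputable def boundaryHull (G : SimpleGraph (Fin n)) (φ : ℚ) (d : ℕ) (ι : Fin n → Fin k)
    (Z : Finset (Fin n)) : Finset (Fin n) :=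
  Finset.univ.filter fun u => (φ : ℝ) * d ≤
    2 * ∑ v, (adjInd G u v : ℝ) * (if ι u = ι v ∧ u ∉ Z ∧ v ∉ Z then 0 else 1)

namespace Setting

variable (h : Setting (d := d) G φ η ε δ ι p)
include h

theorem mem_boundarySet {hat : Fin n → Fin k} {u : Fin n} :
    u ∈ boundarySet G φ hat ↔
      (φ : ℝ) * d ≤ 2 * ∑ v, (adjInd G u v : ℝ) * (if hat u = hat v then 0 else 1) := by
  have hden : (0 : ℝ) < φ.den := by exact_mod_cast φ.den_pos
  have hφ : (φ : ℝ) = φ.num / φ.den := by exact_mod_cast (Rat.num_div_den φ).symm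
  simp only [boundarySet, Finset.mem_filter, Finset.mem_univ, true_and]
  rw [h.sum_adjInd, hφ, div_mul_eq_mul_div, div_le_iff₀ hden]
  have : (φ.num * d ≤ 2 * φ.den * ∑ v, adjInd G u v * (if hat u = hat v then 0 else 1)) ↔
      ((φ.num * d : ℤ) : ℝ) ≤
        ((2 * φ.den * ∑ v, adjInd G u v * (if hat u = hat v then 0 else 1) : ℤ) : ℝ) := by
    rw [Int.cast_le]
  rw [this]
  push_cast
  rw [mul_right_comm 2 (φ.den : ℝ)]

/-- The boundary set depends on the noise through the majority labels. Its hull does not, so the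
noise near the hull can be averaged. -/
theorem boundarySet_subset {hat : Fin n → Fin k} {Z : Finset (Fin n)}
    (hhat : ∀ u ∉ Z, hat u = ι u) : boundarySet G φ hat ⊆ boundaryHull G φ d ι Z := by
  classical
  intro u hu
  rw [h.mem_boundarySet] at hu
  simp only [boundaryHull, Finset.mem_filter, Finset.mem_univ, true_and]
  refine hu.trans (mul_le_mul_of_nonneg_left (Finset.sum_le_sum fun v _ => ?_) (by norm_num))
  refine mul_le_mul_of_nonneg_left ?_ (by exact_mod_cast adjInd_nonneg u v)
  by_cases hc : ι u = ι v ∧ u ∉ Z ∧ v ∉ Z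
  · rw [if_pos hc, if_pos]
    rw [hhat u hc.2.1, hhat v hc.2.2, hc.1]
  · rw [if_neg hc]
    split_ifs <;> norm_num

/-- Double counting: each vertex of the hull has at least `φ d / 2` counted edges. Such edges run
between clusters, at most `ε d n` ordered pairs, or touch `Z`, at most `2 d |Z|` ordered pairs. -/
theorem card_boundaryHull_le (Z : Finset (Fin n)) :
    φ * ((boundaryHull G φ d ι Z).card : ℝ) ≤ 2 * (ε * n + 2 * Z.card) := by
  classical
  have hd := h.d_pos
  have hdeg : ∀ u, ∑ v, (adjInd G u v : ℝ) = d := fun u => by exact_mod_cast h.sum_adjInd u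
  have hnn : ∀ u v, (0 : ℝ) ≤ adjInd G u v := fun u v => by exact_mod_cast adjInd_nonneg u v
  have h1 : ((boundaryHull G φ d ι Z).card : ℝ) * (φ * d) ≤
      2 * ∑ u, ∑ v, (adjInd G u v : ℝ) * (if ι u = ι v ∧ u ∉ Z ∧ v ∉ Z then 0 else 1) := by
    rw [← nsmul_eq_mul, Finset.mul_sum]
    refine (Finset.card_nsmul_le_sum (boundaryHull G φ d ι Z) (fun u =>
      2 * ∑ v, (adjInd G u v : ℝ) * (if ι u = ι v ∧ u ∉ Z ∧ v ∉ Z then 0 else 1)) _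
        fun u hu => (Finset.mem_filter.1 hu).2).trans ?_
    refine Finset.sum_le_sum_of_subset_of_nonneg (Finset.subset_univ _) fun u _ _ => ?_
    refine mul_nonneg (by norm_num) (Finset.sum_nonneg fun v _ => mul_nonneg (hnn u v) ?_)
    split_ifs <;> norm_num
  have h2 : ∑ u, ∑ v, (adjInd G u v : ℝ) * (if ι u = ι v ∧ u ∉ Z ∧ v ∉ Z then 0 else 1) ≤
      ∑ u, ∑ v, (adjInd G u v : ℝ) * (if ι u = ι v then 0 else 1) +
      ∑ u, ∑ v, (adjInd G u v : ℝ) * (if u ∈ Z then 1 else 0) +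
      ∑ u, ∑ v, (adjInd G u v : ℝ) * (if v ∈ Z then 1 else 0) := by
    simp only [← Finset.sum_add_distrib, ← mul_add]
    refine Finset.sum_le_sum fun u _ => Finset.sum_le_sum fun v _ =>
      mul_le_mul_of_nonneg_left ?_ (hnn u v)
    by_cases a1 : ι u = ι v <;> by_cases a2 : u ∈ Z <;> by_cases a3 : v ∈ Z <;>
      simp [a1, a2, a3]
  have h3 : ∑ u, ∑ v, (adjInd G u v : ℝ) * (if u ∈ Z then 1 else 0) = d * Z.card := by
    have : ∀ u, ∑ v, (adjInd G u v : ℝ) * (if u ∈ Z then 1 else 0) = if u ∈ Z then (d : ℝ) else 0 := by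
      intro u
      rw [← Finset.sum_mul, hdeg]
      split_ifs <;> simp
    rw [Finset.sum_congr rfl fun u _ => this u, Finset.sum_ite_mem, Finset.univ_inter,
      Finset.sum_const, nsmul_eq_mul, mul_comm]
  have h4 : ∑ u, ∑ v, (adjInd G u v : ℝ) * (if v ∈ Z then 1 else 0) = d * Z.card := by
    rw [← h3, Finset.sum_comm]
    exact Finset.sum_congr rfl fun u _ => Finset.sum_congr rfl fun v _ => by rw [adjInd_symm]
  have h5 : ∑ u, ∑ v, (adjInd G u v : ℝ) * (if ι u = ι v then 0 else 1) ≤ ε * (d * n) := by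
    rw [← sum_cluster ι, ← sum_card_cluster ι, Finset.mul_sum, Finset.mul_sum]
    refine Finset.sum_le_sum fun i _ => le_trans (le_of_eq ?_) (h.out_le i)
    refine Finset.sum_congr rfl fun u hu => ?_
    rw [mem_cluster] at hu
    have : Finset.univ \ cluster ι i = Finset.univ.filter fun v => ι u ≠ ι v := by
      ext v
      simp [mem_cluster, hu, eq_comm]
    rw [this, Finset.sum_filter]
    refine Finset.sum_congr rfl fun v _ => ?_
    by_cases hc : ι u = ι v <;> simp [hc]
  have h6 : (d : ℝ) * (φ * (boundaryHull G φ d ι Z).card) ≤ d * (2 * (ε * n + 2 * Z.card)) := by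
    rw [h3, h4] at h2
    linarith
  exact le_of_mul_le_mul_left h6 hd

/-- The vertices that lose their correct noisy label are controlled by the expansion. -/
theorem card_lost_le {σ hat : Fin n → Fin k} {Z : Finset (Fin n)} (hhat : ∀ u ∉ Z, hat u = ι u)
    (hZ : ∀ i, 2 * Z.card ≤ (cluster ι i).card) :
    φ * ((Finset.univ.filter fun u => u ∉ keepSet G (differSet σ hat) (boundarySet G φ hat) ∧
      hat u ≠ ι u ∧ σ u = ι u).card : ℝ) ≤
      2 * ((differSet σ ι ∩ Z).card : ℝ) := by
  classical
  set S := keepSet G (differSet σ hat) (boundarySet G φ hat) with hS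
  set U := Finset.univ.filter fun u => u ∉ S ∧ hat u ≠ ι u ∧ σ u = ι u with hU
  have hd := h.d_pos
  have hdeg : ∀ u, ∑ v, (adjInd G u v : ℝ) = d := fun u => by exact_mod_cast h.sum_adjInd u
  have hnn : ∀ u v, (0 : ℝ) ≤ adjInd G u v := fun u v => by exact_mod_cast adjInd_nonneg u v
  have hUZ : U ⊆ Z := by
    intro u hu
    by_contra hc
    exact (Finset.mem_filter.1 hu).2.2.1 (hhat u hc)
  have hUF : ∀ u ∈ U, u ∈ differSet σ hat := by
    intro u hu
    obtain ⟨-, h2, h3⟩ := (Finset.mem_filter.1 hu).2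
    simp only [differSet, Finset.mem_filter, Finset.mem_univ, true_and]
    rw [h3]
    exact Ne.symm h2
  have hUB : ∀ u ∈ U, 2 * ∑ v, (adjInd G u v : ℝ) * (if hat u = hat v then 0 else 1) ≤ φ * d := by
    intro u hu
    by_contra hc
    push Not at hc
    have h1 : u ∈ boundarySet G φ hat := h.mem_boundarySet.2 hc.le
    exact (Finset.mem_filter.1 hu).2.1
      (subset_keepSet _ _ (Finset.mem_inter.2 ⟨hUF u hu, h1⟩))
  -- The neighbour `v` shares the wrong majority label, so it lies in `Z`. If its noisy label were
  -- correct, then `v ∉ U` would force it to be kept, and closedness of the kept set would keep `u`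
  -- too.
  have hclosed : ∀ u ∈ U, ∀ v, G.Adj u v → ι v = ι u → v ∉ U → hat u = hat v →
      v ∈ differSet σ ι ∩ Z := by
    intro u hu v hadj hι hv hh
    obtain ⟨h1, h2, h3⟩ := (Finset.mem_filter.1 hu).2
    have hne : hat v ≠ ι v := by rw [← hh, hι]; exact h2
    have hvZ : v ∈ Z := by
      by_contra hc
      exact hne (hhat v hc)
    have hσ : σ v ≠ ι v := by
      intro hc
      refine hv (Finset.mem_filter.2 ⟨Finset.mem_univ _, ?_, hne, hc⟩)
      intro hvS
      refine h1 ?_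
      rw [hS, ← growSet_keepSet, growSet, Finset.mem_union, Finset.mem_filter]
      exact Or.inr ⟨hUF u hu, v, hvS, hadj⟩
    exact Finset.mem_inter.2 ⟨by simp [differSet, hσ], hvZ⟩
  set M := differSet σ ι ∩ Z with hM
  have hcl : ∀ i, φ * d * ((U.filter fun u => ι u = i).card : ℝ) ≤
      φ * d / 2 * ((U.filter fun u => ι u = i).card : ℝ) + d * (M.filter fun u => ι u = i).card := by
    intro i
    set Ui := U.filter fun u => ι u = i with hUi
    have hsub : Ui ⊆ cluster ι i := fun u hu => mem_cluster.2 (Finset.mem_filter.1 hu).2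
    have hcard : 2 * Ui.card ≤ (cluster ι i).card := by
      have h1 := Finset.card_le_card ((Finset.filter_subset (fun u => ι u = i) U).trans hUZ)
      have h2 := hZ i
      rw [← hUi] at h1
      omega
    refine (h.expansion i Ui hsub hcard).trans ?_
    -- An edge leaving `Ui` inside the cluster either joins different majority labels or ends at a
    -- noisy vertex of `Z`. The first kind uses up at most half of the expansion, because lost
    -- vertices are not in the boundary set.
    have h1 : ∀ u ∈ Ui, ∑ v ∈ cluster ι i \ Ui, (adjInd G u v : ℝ) ≤
        ∑ v, (adjInd G u v : ℝ) * (if hat u = hat v then 0 else 1) +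
          ∑ v ∈ M.filter fun u => ι u = i, (adjInd G u v : ℝ) := by
      intro u hu
      have hu' := Finset.mem_filter.1 hu
      have h2 : ∑ v ∈ M.filter (fun u => ι u = i), (adjInd G u v : ℝ) =
          ∑ v, if v ∈ M.filter (fun u => ι u = i) then (adjInd G u v : ℝ) else 0 := by
        rw [Finset.sum_ite_mem, Finset.univ_inter]
      rw [h2, ← Finset.sum_add_distrib]
      have h3 : ∀ v ∈ cluster ι i \ Ui, (adjInd G u v : ℝ) ≤
          (adjInd G u v : ℝ) * (if hat u = hat v then 0 else 1) +
            if v ∈ M.filter (fun u => ι u = i) then (adjInd G u v : ℝ) else 0 := by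
        intro v hv
        obtain ⟨hv1, hv2⟩ := Finset.mem_sdiff.1 hv
        rw [mem_cluster] at hv1
        by_cases hadj : G.Adj u v
        · by_cases hh : hat u = hat v
          · have hvU : v ∉ U := fun hc => hv2 (Finset.mem_filter.2 ⟨hc, hv1⟩)
            have := hclosed u hu'.1 v hadj (hv1.trans hu'.2.symm) hvU hh
            rw [if_pos (Finset.mem_filter.2 ⟨this, hv1⟩)]
            simp [hh]
          · rw [if_neg hh, mul_one]
            have : (0 : ℝ) ≤ if v ∈ M.filter (fun u => ι u = i) then (adjInd G u v : ℝ) else 0 := by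
              split_ifs
              · exact hnn u v
              · exact le_rfl
            linarith
        · have : (adjInd G u v : ℝ) = 0 := by simp [adjInd, hadj]
          rw [this]
          simp
      refine (Finset.sum_le_sum h3).trans ?_
      refine Finset.sum_le_sum_of_subset_of_nonneg (Finset.subset_univ _) fun v _ _ => ?_
      refine add_nonneg (mul_nonneg (hnn u v) (by split_ifs <;> norm_num)) ?_
      split_ifs
      · exact hnn u v
      · exact le_rfl
    refine (Finset.sum_le_sum h1).trans ?_
    rw [Finset.sum_add_distrib]
    refine add_le_add ?_ ?_
    · refine (Finset.sum_le_card_nsmul Ui _ ((φ : ℝ) * d / 2) fun u hu => ?_).trans ?_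
      · have := hUB u (Finset.mem_filter.1 hu).1
        linarith
      · rw [nsmul_eq_mul, mul_comm]
    · rw [Finset.sum_comm]
      refine (Finset.sum_le_card_nsmul _ _ (d : ℝ) fun v _ => ?_).trans ?_
      · rw [← hdeg v]
        refine (Finset.sum_le_sum_of_subset_of_nonneg (Finset.subset_univ Ui)
          fun u _ _ => hnn u v).trans (le_of_eq ?_)
        exact Finset.sum_congr rfl fun u _ => by rw [adjInd_symm]
      · rw [nsmul_eq_mul, mul_comm]
  have hsum : ∀ T : Finset (Fin n), ∑ i, ((T.filter fun u => ι u = i).card : ℝ) = T.card := by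
    intro T
    have := Finset.card_eq_sum_card_fiberwise (f := ι) (s := T) (t := Finset.univ)
      fun _ _ => Finset.mem_univ _
    rw [this]
    push_cast
    rfl
  have htot := Finset.sum_le_sum fun i (_ : i ∈ Finset.univ) => hcl i
  rw [Finset.sum_add_distrib, ← Finset.mul_sum, ← Finset.mul_sum, ← Finset.mul_sum, hsum, hsum]
    at htot
  have : (d : ℝ) * (φ * U.card) ≤ d * (2 * M.card) := by linarith
  exact le_of_mul_le_mul_left this hd

open scoped Classical in
/-- The number of misclassified vertices. -/
theorem misclassified_le {σ hat : Fin n → Fin k} {Z : Finset (Fin n)}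
    (hhat : ∀ u ∉ Z, hat u = ι u) (hZ : ∀ i, 2 * Z.card ≤ (cluster ι i).card) :
    φ * (misclassified ι (outLabel G φ σ hat) : ℝ) ≤
      3 * ((differSet σ ι ∩ Z).card : ℝ) +
      ((differSet σ ι ∩ (Z ∪ boundaryHull G φ d ι Z)).card : ℝ) +
      ((Finset.univ.filter fun u => u ∈ Reached G (Z ∪ boundaryHull G φ d ι Z) (differSet σ ι) ∧
        u ∉ Z ∪ boundaryHull G φ d ι Z).card : ℝ) := by
  set W := Z ∪ boundaryHull G φ d ι Z with hW
  set S := keepSet G (differSet σ hat) (boundarySet G φ hat) with hS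
  have hlost := h.card_lost_le (σ := σ) hhat hZ
  rw [← hS] at hlost
  have hreach : ∀ u ∈ S, u ∈ Reached G W (differSet σ ι) := by
    refine keepSet_subset (fun u hu => ?_) fun u hu v hv hadj => ?_
    · exact subset_reached (Finset.mem_union_right _
        (h.boundarySet_subset hhat (Finset.mem_inter.1 hu).2))
    -- Inside `Z` a new path is started. Outside `Z` the majority label is correct, so differing
    -- from it means being noisy.
    · by_cases hz : u ∈ Z
      · exact subset_reached (Finset.mem_union_left _ hz)
      · refine reached_step hv ?_ hadj
        simp only [differSet, Finset.mem_filter, Finset.mem_univ, true_and] at hu ⊢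
        rwa [hhat u hz] at hu
  -- Wrong labels that were not kept are noisy vertices of `Z` or lost vertices; wrong labels that
  -- were kept are noisy vertices of `W` or reached vertices outside `W`. The lost ones add 2 to the
  -- coefficient of the first kind, giving 3.
  have hsub : (Finset.univ.filter fun u => outLabel G φ σ hat u ≠ ι u) ⊆
      (((differSet σ ι ∩ Z) ∪ (Finset.univ.filter fun u => u ∉ S ∧ hat u ≠ ι u ∧ σ u = ι u)) ∪
        (differSet σ ι ∩ W)) ∪
        (Finset.univ.filter fun u => u ∈ Reached G W (differSet σ ι) ∧ u ∉ W) := by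
    intro u hu
    have hu' := (Finset.mem_filter.1 hu).2
    unfold outLabel at hu'
    rw [← hS] at hu'
    have hmem : u ∈ differSet σ ι ↔ σ u ≠ ι u := by simp [differSet]
    simp only [Finset.mem_union, Finset.mem_inter, Finset.mem_filter, Finset.mem_univ, true_and]
    by_cases hu1 : u ∈ S
    · rw [if_pos hu1] at hu'
      by_cases hu2 : u ∈ W
      · exact Or.inl (Or.inr ⟨hmem.2 hu', hu2⟩)
      · refine Or.inr ⟨?_, hu2⟩
        exact hreach u hu1
    · rw [if_neg hu1] at hu'
      by_cases hσ : σ u = ι u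
      · exact Or.inl (Or.inl (Or.inr ⟨hu1, hu', hσ⟩))
      · refine Or.inl (Or.inl (Or.inl ⟨hmem.2 hσ, ?_⟩))
        by_contra hc
        exact hu' (hhat u hc)
  have hcard := (Finset.card_le_card hsub).trans ((Finset.card_union_le _ _).trans
    (Nat.add_le_add_right ((Finset.card_union_le _ _).trans
      (Nat.add_le_add_right (Finset.card_union_le _ _) _)) _))
  have hcard' : (misclassified ι (outLabel G φ σ hat) : ℝ) ≤ _ := Nat.cast_le.2 hcard
  push_cast at hcard'
  have hφ0 := h.phi_pos_real
  have hφ1 := h.phi_lt_one_real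
  have h1 := mul_le_mul_of_nonneg_left hcard' hφ0.le
  have h2 : ∀ a : ℕ, (φ : ℝ) * a ≤ a := fun a =>
    mul_le_of_le_one_left (Nat.cast_nonneg a) hφ1.le
  have a1 := h2 (differSet σ ι ∩ Z).card
  have a2 := h2 (differSet σ ι ∩ W).card
  have a3 := h2 (Finset.univ.filter fun u => u ∈ Reached G W (differSet σ ι) ∧ u ∉ W).card
  linarith

end Setting

end Errors

end NoisyClustering

namespace NoisyClustering

/-! ## The noise -/

section Noise

variable {n k : ℕ} {p : Fin n → Fin k → ℝ} {ι : Fin n → Fin k} {δ : ℝ}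

/-- Expectation over independent labels `σ u` with laws `p u`. -/
noncomputable def noiseMean (p : Fin n → Fin k → ℝ) (f : (Fin n → Fin k) → ℝ) : ℝ :=
  ∑ σ : Fin n → Fin k, (∏ u, p u (σ u)) * f σ

theorem noiseMean_mono (hp : ∀ u i, 0 ≤ p u i) {f g : (Fin n → Fin k) → ℝ} (hfg : ∀ σ, f σ ≤ g σ) :
    noiseMean p f ≤ noiseMean p g :=
  Finset.sum_le_sum fun σ _ =>
    mul_le_mul_of_nonneg_left (hfg σ) (Finset.prod_nonneg fun u _ => hp u _)

theorem noiseMean_add (f g : (Fin n → Fin k) → ℝ) :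
    noiseMean p (fun σ => f σ + g σ) = noiseMean p f + noiseMean p g := by
  simp only [noiseMean, mul_add, Finset.sum_add_distrib]

theorem noiseMean_const_mul (c : ℝ) (f : (Fin n → Fin k) → ℝ) :
    noiseMean p (fun σ => c * f σ) = c * noiseMean p f := by
  rw [noiseMean, noiseMean, Finset.mul_sum]
  exact Finset.sum_congr rfl fun σ _ => by ring

theorem noiseMean_sum {κ : Type*} (s : Finset κ) (f : κ → (Fin n → Fin k) → ℝ) :
    noiseMean p (fun σ => ∑ j ∈ s, f j σ) = ∑ j ∈ s, noiseMean p (f j) := by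
  simp only [noiseMean, Finset.mul_sum]
  exact Finset.sum_comm

/-- Independence of the labels in the form used for all moment bounds. -/
theorem noiseMean_prod (g : Fin n → Fin k → ℝ) :
    noiseMean p (fun σ => ∏ u, g u (σ u)) = ∏ u, ∑ i, p u i * g u i := by
  rw [Finset.prod_univ_sum, Fintype.piFinset_univ, noiseMean]
  exact Finset.sum_congr rfl fun σ _ => Finset.prod_mul_distrib.symm

theorem noiseMean_one (hp : ∀ u, p u ∈ stdSimplex ℝ (Fin k)) : noiseMean p (fun _ => 1) = 1 := by
  have := noiseMean_prod (p := p) fun _ _ => 1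
  simp only [Finset.prod_const_one, mul_one] at this
  rw [this]
  exact Finset.prod_eq_one fun u _ => (hp u).2

theorem sum_law_ne {q : Fin k → ℝ} (hq : q ∈ stdSimplex ℝ (Fin k)) (i : Fin k) :
    ∑ j, q j * (if j ≠ i then 1 else 0) = 1 - q i := by
  have h1 : ∀ j, q j * (if j ≠ i then (1 : ℝ) else 0) = q j - if j = i then q j else 0 := by
    intro j
    by_cases hj : j = i <;> simp [hj]
  simp only [h1, Finset.sum_sub_distrib, hq.2, Finset.sum_ite_eq', Finset.mem_univ, if_true]

/-- All vertices of a set are noisy with probability at most `δ ^ |T|`. -/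
theorem noiseMean_all_le (hp : ∀ u, p u ∈ stdSimplex ℝ (Fin k)) (hδ : ∀ u, 1 - δ ≤ p u (ι u))
    (T : Finset (Fin n)) :
    noiseMean p (fun σ => if ∀ u ∈ T, u ∈ differSet σ ι then 1 else 0) ≤ δ ^ T.card := by
  have e : ∀ σ : Fin n → Fin k, (if ∀ u ∈ T, u ∈ differSet σ ι then (1 : ℝ) else 0) =
      ∏ u, if u ∈ T then (if σ u ≠ ι u then 1 else 0) else 1 := by
    intro σ
    rw [Finset.prod_ite_mem, Finset.univ_inter]
    split_ifs with h
    · refine (Finset.prod_eq_one fun u hu => if_pos ?_).symm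
      simpa [differSet] using h u hu
    · push Not at h
      obtain ⟨u, hu, hσ⟩ := h
      refine (Finset.prod_eq_zero hu (if_neg ?_)).symm
      simpa [differSet] using hσ
  simp only [e]
  rw [noiseMean_prod (p := p) fun u i => if u ∈ T then (if i ≠ ι u then 1 else 0) else 1]
  have h1 : ∀ u, ∑ i, p u i * (if u ∈ T then (if i ≠ ι u then (1 : ℝ) else 0) else 1) =
      if u ∈ T then 1 - p u (ι u) else 1 := by
    intro u
    split_ifs
    · exact sum_law_ne (hp u) _
    · simpa using (hp u).2
  simp only [h1]
  rw [Finset.prod_ite_mem, Finset.univ_inter]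
  rw [← Finset.prod_const]
  exact Finset.prod_le_prod
    (fun u _ => sub_nonneg.2 (mem_Icc_of_mem_stdSimplex (hp u) _).2) fun u _ => by linarith [hδ u]

theorem noiseMean_card_inter_le (hp : ∀ u, p u ∈ stdSimplex ℝ (Fin k))
    (hδ : ∀ u, 1 - δ ≤ p u (ι u)) (T : Finset (Fin n)) :
    noiseMean p (fun σ => ((differSet σ ι ∩ T).card : ℝ)) ≤ δ * T.card := by
  have e : ∀ σ : Fin n → Fin k, ((differSet σ ι ∩ T).card : ℝ) =
      ∑ u ∈ T, if ∀ v ∈ ({u} : Finset (Fin n)), v ∈ differSet σ ι then (1 : ℝ) else 0 := by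
    intro σ
    rw [Finset.inter_comm, ← Finset.filter_mem_eq_inter, Finset.card_filter]
    push_cast
    simp
  simp only [e]
  rw [noiseMean_sum]
  refine (Finset.sum_le_card_nsmul _ _ δ fun u _ => ?_).trans (by rw [nsmul_eq_mul, mul_comm])
  simpa using noiseMean_all_le hp hδ {u}

/-- A tail bound for the number of noisy vertices in a set. -/
theorem noiseMean_many_le (hp : ∀ u, p u ∈ stdSimplex ℝ (Fin k)) (hδ : ∀ u, 1 - δ ≤ p u (ι u))
    (hδ1 : δ ≤ 1 / 300) (T : Finset (Fin n)) :
    noiseMean p (fun σ => if 48 * T.card < 100 * (differSet σ ι ∩ T).card then 1 else 0) ≤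
      Real.exp (-(19 / 10) * T.card) := by
  -- Exponential Markov bound with parameter 5. The moment per vertex is at most `1 + 148 / 300 ≤
  -- exp (1/2)`, and `5 * 0.48 - 1/2 = 19 / 10`.
  have hc : Real.exp 5 ≤ 149 := by
    have h1 := Real.exp_one_lt_d9
    have : Real.exp 5 = Real.exp 1 ^ 5 := by rw [← Real.exp_nat_mul]; norm_num
    rw [this]
    refine (pow_le_pow_left₀ (Real.exp_pos _).le h1.le 5).trans (by norm_num)
  have hc1 : 1 ≤ Real.exp 5 := Real.one_le_exp (by norm_num)
  have h1 : ∀ σ : Fin n → Fin k,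
      (if 48 * T.card < 100 * (differSet σ ι ∩ T).card then (1 : ℝ) else 0) ≤
      Real.exp (-(24 / 10) * T.card) *
        ∏ u, if u ∈ T then (if σ u ≠ ι u then Real.exp 5 else 1) else 1 := by
    intro σ
    have e : (∏ u, if u ∈ T then (if σ u ≠ ι u then Real.exp 5 else 1) else 1) =
        Real.exp (5 * (differSet σ ι ∩ T).card) := by
      rw [Finset.prod_ite_mem, Finset.univ_inter, Finset.prod_ite, Finset.prod_const_one, mul_one,
        Finset.prod_const, ← Real.exp_nat_mul, mul_comm]
      congr 3
      congr 1
      ext u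
      simp [differSet, and_comm]
    rw [e, ← Real.exp_add]
    split_ifs with h
    · refine Real.one_le_exp ?_
      have : (48 : ℝ) * T.card < 100 * (differSet σ ι ∩ T).card := by exact_mod_cast h
      linarith
    · exact (Real.exp_pos _).le
  refine (noiseMean_mono (fun u i => (hp u).1 i) h1).trans ?_
  rw [noiseMean_const_mul,
    noiseMean_prod (p := p) fun u i => if u ∈ T then (if i ≠ ι u then Real.exp 5 else 1) else 1]
  have h2 : ∀ u, ∑ i, p u i * (if u ∈ T then (if i ≠ ι u then Real.exp 5 else 1) else 1) =
      if u ∈ T then 1 + (Real.exp 5 - 1) * (1 - p u (ι u)) else 1 := by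
    intro u
    split_ifs
    · trans ∑ i, p u i + (Real.exp 5 - 1) * ∑ i, p u i * (if i ≠ ι u then 1 else 0)
      · rw [Finset.mul_sum, ← Finset.sum_add_distrib]
        refine Finset.sum_congr rfl fun i _ => ?_
        split_ifs <;> ring
      · rw [sum_law_ne (hp u), (hp u).2]
    · simpa using (hp u).2
  simp only [h2]
  rw [Finset.prod_ite_mem, Finset.univ_inter]
  have h3 : ∏ u ∈ T, (1 + (Real.exp 5 - 1) * (1 - p u (ι u))) ≤ Real.exp (1 / 2) ^ T.card := by
    rw [← Finset.prod_const]
    have hle : ∀ u, p u (ι u) ≤ 1 := fun u => (mem_Icc_of_mem_stdSimplex (hp u) _).2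
    refine Finset.prod_le_prod (fun u _ => ?_) fun u _ => ?_
    · have := mul_nonneg (sub_nonneg.2 hc1) (sub_nonneg.2 (hle u))
      linarith
    · have h4 : (Real.exp 5 - 1) * (1 - p u (ι u)) ≤ 148 * (1 / 300) :=
        mul_le_mul (by linarith) (by linarith [hδ u]) (sub_nonneg.2 (hle u)) (by norm_num)
      have := Real.add_one_le_exp (1 / 2 : ℝ)
      linarith
  refine (mul_le_mul_of_nonneg_left h3 (Real.exp_pos _).le).trans (le_of_eq ?_)
  rw [← Real.exp_nat_mul, ← Real.exp_add]
  congr 1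
  ring

/-- Expected number of vertices reached through noise. -/
theorem noiseMean_reached_le {G : SimpleGraph (Fin n)} {d : ℕ}
    (hd : ∀ u, ∑ v, adjInd G u v = d) (hp : ∀ u, p u ∈ stdSimplex ℝ (Fin k))
    (hδ0 : 0 ≤ δ) (hδ : ∀ u, 1 - δ ≤ p u (ι u)) (hdδ : δ * d ≤ 1 / 100) (W : Finset (Fin n)) :
    noiseMean p (fun σ => ∑ w ∈ W, ∑ l ∈ Finset.range n, ∑ L ∈ paths G w (l + 1),
      if ∀ v ∈ L, v ∈ differSet σ ι then (1 : ℝ) else 0) ≤ 2 * (d * δ) * W.card := by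
  classical
  have hdeg : ∀ u, (Finset.univ.filter fun v => G.Adj u v).card ≤ d := by
    intro u
    have h1 := hd u
    unfold adjInd at h1
    rw [Finset.sum_boole] at h1
    exact_mod_cast h1.le
  have hx0 : 0 ≤ δ * d := mul_nonneg hδ0 (Nat.cast_nonneg d)
  rw [noiseMean_sum]
  refine (Finset.sum_le_card_nsmul _ _ (2 * (d * δ)) fun w _ => ?_).trans
    (by rw [nsmul_eq_mul, mul_comm])
  rw [noiseMean_sum]
  -- There are at most `d ^ (l + 1)` paths, each noisy throughout with probability at most `δ ^ (l +
  -- 1)`; bounding the ratio `δ d` by 1/2 leaves a geometric series of sum at most 2.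
  have h1 : ∀ l ∈ Finset.range n, noiseMean p (fun σ => ∑ L ∈ paths G w (l + 1),
      if ∀ v ∈ L, v ∈ differSet σ ι then (1 : ℝ) else 0) ≤ δ * d * (1 / 2) ^ l := by
    intro l _
    rw [noiseMean_sum]
    have h2 : ∀ L ∈ paths G w (l + 1), noiseMean p (fun σ =>
        if ∀ v ∈ L, v ∈ differSet σ ι then (1 : ℝ) else 0) ≤ δ ^ (l + 1) := by
      intro L hL
      obtain ⟨hnd, hlen⟩ := nodup_of_mem_paths hL
      have h3 := noiseMean_all_le hp hδ L.toFinset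
      rw [List.toFinset_card_of_nodup hnd, hlen] at h3
      simpa only [List.mem_toFinset] using h3
    refine (Finset.sum_le_card_nsmul _ _ _ h2).trans ?_
    rw [nsmul_eq_mul]
    have h4 : ((paths G w (l + 1)).card : ℝ) ≤ d ^ (l + 1) := by
      exact_mod_cast card_paths_le hdeg w (l + 1)
    refine (mul_le_mul_of_nonneg_right h4 (pow_nonneg hδ0 _)).trans ?_
    rw [← mul_pow, mul_comm (d : ℝ), pow_succ']
    exact mul_le_mul_of_nonneg_left (pow_le_pow_left₀ hx0 (by linarith) l) hx0
  refine (Finset.sum_le_sum h1).trans ?_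
  rw [← Finset.mul_sum]
  have := mul_le_mul_of_nonneg_left (sum_geometric_two_le n) hx0
  linarith

end Noise

/-! ## The success probability -/

section Success

variable {n d k : ℕ} {G : SimpleGraph (Fin n)} {φ η : ℚ} {ε δ : ℝ} {ι : Fin n → Fin k}
  {p : Fin n → Fin k → ℝ}

/-- If the large entries of row `u` nearly match the cluster of `u`, and most vertices of the cluster
have their correct label, the majority label of `u` is correct. -/
theorem majority_correct {σ : Fin n → Fin k} {y b : Fin n → Fin n → ℤ} {hat : Fin n → Fin k}
    (hhat : majorityLabels (encodeInput G φ k η σ) = encodeLabeling hat)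
    (hy : projRound (encodeInput G φ k η σ) = toMat y)
    (hb : ∀ u v, bigInd (encodeInput G φ k η σ) (y u v) = b u v)
    (hb01 : ∀ u v, b u v = 0 ∨ b u v = 1) {u : Fin n}
    (hu : 100 * (Finset.univ.filter fun v => b u v ≠ if ι v = ι u then 1 else 0).card ≤
        (cluster ι (ι u)).card)
    (hσ : 100 * (differSet σ ι ∩ cluster ι (ι u)).card ≤ 48 * (cluster ι (ι u)).card) :
    hat u = ι u := by
  set c := ι u with hc
  have hcpos : 0 < (cluster ι c).card := Finset.card_pos.2 ⟨u, mem_cluster.2 hc.symm⟩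
  -- A noisy vertex of the cluster costs 2 and a misjudged entry costs 1, so the excess is at least
  -- `(1 - 0.96 - 0.01) |C|`.
  have hpt : ∀ v, (if ι v = c then 1 else 0) - 2 * (if σ v ≠ ι v ∧ ι v = c then 1 else 0) -
      (if b u v ≠ if ι v = c then 1 else 0 then 1 else 0) ≤
      b u v * (if σ v = c then (1 : ℤ) else -1) := by
    intro v
    rcases hb01 u v with h | h <;> rw [h] <;> by_cases h1 : ι v = c <;> by_cases h2 : σ v = c <;>
      simp [h1, h2]
  have hsum : (0 : ℤ) < ∑ v, b u v * (if σ v = c then 1 else -1) := by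
    refine lt_of_lt_of_le ?_ (Finset.sum_le_sum fun v _ => hpt v)
    rw [Finset.sum_sub_distrib, Finset.sum_sub_distrib, ← Finset.mul_sum, Finset.sum_boole,
      Finset.sum_boole, Finset.sum_boole]
    have e1 : (Finset.univ.filter fun v => ι v = c) = cluster ι c := rfl
    have e2 : (Finset.univ.filter fun v => σ v ≠ ι v ∧ ι v = c) =
        differSet σ ι ∩ cluster ι c := by
      ext v
      simp [differSet, mem_cluster]
    rw [e1, e2]
    zify at hu hσ hcpos
    linarith
  rw [majorityLabels_eq hy, encodeLabeling] at hhat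
  have h1 := congrFun (List.ofFn_injective hhat) u
  rw [foldl_select_eq (c := ((c : ℕ) : ℤ)) (fun l => 0 < excess _ _ l)] at h1
  · exact (Fin.ext (by exact_mod_cast h1)).symm
  · intro l hl hpos
    rw [List.mem_ofFn] at hl
    obtain ⟨v, rfl⟩ := hl
    rw [excess_eq hb] at hpos
    rw [majority_unique (hb01 u) hsum hpos]
  · right
    constructor
    · rw [List.mem_ofFn]
      by_contra hne
      push Not at hne
      refine absurd hsum (not_lt.2 (Finset.sum_nonpos fun v _ => ?_))
      have : σ v ≠ c := fun h => hne v (by rw [h])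
      rw [if_neg this]
      rcases hb01 u v with h | h <;> simp [h]
    · rw [excess_eq hb]
      exact hsum

namespace Setting

variable (h : Setting (d := d) G φ η ε δ ι p)
include h

theorem delta_le : δ ≤ 1 / 300 := by
  have h1 := h.delta_d
  have h2 : (3 : ℝ) ≤ d := by exact_mod_cast h.three_le_d
  have := mul_le_mul_of_nonneg_left h2 h.delta_pos.le
  linarith

theorem eps_le_inv : ε ≤ 1 / 10 ^ 5 := by
  have h1 := h.eps_le
  have hφ := h.phi_pos_real
  have hη := h.one_le_eta_real
  rw [div_le_iff₀ (by positivity)] at h1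
  refine h1.trans ?_
  have h2 : (φ : ℝ) ^ 6 ≤ 1 := pow_le_one₀ hφ.le h.phi_lt_one_real.le
  have h3 : 1 / (10 ^ 5 * (η : ℝ) ^ 4) ≤ 1 / 10 ^ 5 := by
    refine one_div_le_one_div_of_le (by norm_num) ?_
    have := one_le_pow₀ (n := 4) hη
    linarith
  calc _ ≤ 1 / 10 ^ 5 * (1 : ℝ) := mul_le_mul h3 h2 (by positivity) (by norm_num)
    _ = _ := mul_one _

/-- The average degree inside a cluster is at least `d (1 - ε)`, nearly 3, and at most `|C| - 1`.
This excludes clusters too small for the tail bound. -/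
theorem four_le_card (i : Fin k) : 4 ≤ (cluster ι i).card := by
  classical
  set m := (cluster ι i).card with hm
  have hmpos : (0 : ℝ) < m := h.card_cluster_pos i
  have h1 := h.out_le i
  have h2 : ∀ u ∈ cluster ι i, (d : ℝ) - ∑ v ∈ Finset.univ \ cluster ι i, (adjInd G u v : ℝ) ≤ m - 1 := by
    intro u hu
    have h3 : (d : ℝ) = ∑ v, (adjInd G u v : ℝ) := by exact_mod_cast (h.sum_adjInd u).symm
    rw [h3, ← Finset.sum_sdiff (Finset.subset_univ (cluster ι i)), add_sub_cancel_left,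
      ← Finset.add_sum_erase _ _ hu]
    have h4 : ((adjInd G u u : ℤ) : ℝ) = 0 := by simp [adjInd]
    rw [h4, zero_add]
    refine (Finset.sum_le_card_nsmul _ _ (1 : ℝ) fun v _ => ?_).trans ?_
    · unfold adjInd
      split_ifs <;> simp
    · rw [Finset.card_erase_of_mem hu, nsmul_eq_mul, mul_one, Nat.cast_sub (by
        have := Finset.card_pos.2 ⟨u, hu⟩; omega)]
      simp [hm]
  have h5 := Finset.sum_le_card_nsmul _ _ _ h2
  rw [Finset.sum_sub_distrib, Finset.sum_const, nsmul_eq_mul, nsmul_eq_mul, ← hm] at h5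
  have h6 : (m : ℝ) * (d * (1 - ε)) ≤ m * (m - 1) := by nlinarith
  have h7 := le_of_mul_le_mul_left h6 hmpos
  have h8 : (3 : ℝ) ≤ d := by exact_mod_cast h.three_le_d
  have h9 := h.eps_le_inv
  have h10 : (3 : ℝ) * (1 - 1 / 10 ^ 5) ≤ d * (1 - ε) :=
    mul_le_mul h8 (by linarith) (by norm_num) h.d_pos.le
  have h11 : (3 : ℝ) < m := by norm_num at h10; linarith
  exact_mod_cast h11

/-- With high probability no cluster has too many noisy vertices. -/
theorem noiseMean_crowded_le :
    noiseMean p (fun σ => ∑ i, if 48 * (cluster ι i).card < 100 * (differSet σ ι ∩ cluster ι i).card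
      then 1 else 0) ≤ 1 / 20 := by
  have hk : (0 : ℝ) < k := by
    have := h.two_le_k
    exact_mod_cast (by omega : 0 < k)
  rw [noiseMean_sum]
  have h1 : ∀ i ∈ Finset.univ, noiseMean p (fun σ =>
      if 48 * (cluster ι i).card < 100 * (differSet σ ι ∩ cluster ι i).card then 1 else 0) ≤
      1 / k * (1 / 20) := by
    intro i _
    refine (noiseMean_many_le h.label_law h.label_correct h.delta_le _).trans ?_
    have h2 := h.log_le_card i
    have h3 : (4 : ℝ) ≤ (cluster ι i).card := by exact_mod_cast h.four_le_card i
    -- Of the exponent `1.9 |C|`, one `|C|` pays for `log k` and `0.9 |C| ≥ 3.6` yields the factor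
    -- 1/20.
    have h4 : Real.exp (-(19 / 10) * (cluster ι i).card) ≤ Real.exp (-Real.log k + -(36 / 10)) :=
      Real.exp_le_exp.2 (by linarith)
    refine h4.trans ?_
    rw [Real.exp_add, Real.exp_neg, Real.exp_log hk, one_div]
    refine mul_le_mul_of_nonneg_left ?_ (by positivity)
    rw [Real.exp_neg, one_div]
    refine inv_anti₀ (by norm_num) ?_
    have h5 := Real.exp_one_gt_d9
    have h6 : Real.exp (36 / 10) = Real.exp 1 ^ 3 * Real.exp (6 / 10) := by
      rw [← Real.exp_nat_mul, ← Real.exp_add]; norm_num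
    have h7 := Real.add_one_le_exp (6 / 10 : ℝ)
    have h8 : (2.7 : ℝ) ^ 3 ≤ Real.exp 1 ^ 3 := pow_le_pow_left₀ (by norm_num) (by linarith) 3
    rw [h6]
    calc (20 : ℝ) ≤ 2.7 ^ 3 * (6 / 10 + 1) := by norm_num
      _ ≤ _ := mul_le_mul h8 h7 (by norm_num) (by positivity)
  refine (Finset.sum_le_card_nsmul _ _ _ h1).trans (le_of_eq ?_)
  rw [Finset.card_univ, Fintype.card_fin, nsmul_eq_mul]
  field_simp

/-- Balance gives `n ≤ k η |C|`, and the bound on `k log k`, with `log k ≥ 1/2`, makes `k η⁴ ε`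
small against `φ²`. This allows expansion to be applied to subsets of `Z` in a cluster. -/
theorem two_mul_card_le {Z : Finset (Fin n)}
    (hZ : (Z.card : ℝ) * (φ : ℝ) ^ 2 ≤ 168000 * (η : ℝ) ^ 3 * (n * ε)) (i : Fin k) :
    2 * Z.card ≤ (cluster ι i).card := by
  have hφ := h.phi_pos_real
  have hφ1 := h.phi_lt_one_real
  have hη := h.one_le_eta_real
  have hε := h.eps_pos
  have hk2 : (2 : ℝ) ≤ k := by exact_mod_cast h.two_le_k
  have hm := h.card_cluster_pos i
  set m : ℝ := ((cluster ι i).card : ℝ)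
  have hn : (n : ℝ) ≤ k * (η * m) := by
    rw [← sum_card_cluster ι]
    refine (Finset.sum_le_card_nsmul _ _ (η * m) fun j _ => h.balanced j i).trans (le_of_eq ?_)
    rw [Finset.card_univ, Fintype.card_fin, nsmul_eq_mul]
  have hlog : (1 : ℝ) / 2 ≤ Real.log k := by
    have h1 := Real.log_two_gt_d9
    have h2 := Real.log_le_log (by norm_num) hk2
    linarith
  have hkl := h.k_log_k
  rw [le_div_iff₀ (by positivity)] at hkl
  have h3 : (k : ℝ) * (1 / 2) * (10 ^ 9 * (η : ℝ) ^ 4 * ε) ≤ (φ : ℝ) ^ 6 :=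
    (mul_le_mul_of_nonneg_right (mul_le_mul_of_nonneg_left hlog (by linarith))
      (by positivity)).trans hkl
  have h4 : (φ : ℝ) ^ 6 ≤ (φ : ℝ) ^ 2 := pow_le_pow_of_le_one hφ.le hφ1.le (by norm_num)
  have h5 : 168000 * (η : ℝ) ^ 3 * (n * ε) ≤ 168000 * (η : ℝ) ^ 3 * (k * (η * m) * ε) := by gcongr
  have h6 : 168000 * (η : ℝ) ^ 3 * (k * (η * m) * ε) =
      336 / 10 ^ 6 * m * ((k : ℝ) * (1 / 2) * (10 ^ 9 * (η : ℝ) ^ 4 * ε)) := by ring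
  have h7 : 336 / 10 ^ 6 * m * ((k : ℝ) * (1 / 2) * (10 ^ 9 * (η : ℝ) ^ 4 * ε)) ≤
      336 / 10 ^ 6 * m * (φ : ℝ) ^ 2 := mul_le_mul_of_nonneg_left (h3.trans h4) (by positivity)
  have h8 : (Z.card : ℝ) * (φ : ℝ) ^ 2 ≤ 336 / 10 ^ 6 * m * (φ : ℝ) ^ 2 := by linarith
  have h9 := le_of_mul_le_mul_right h8 (by positivity)
  have h10 : ((2 * Z.card : ℕ) : ℝ) ≤ ((cluster ι i).card : ℕ) := by
    push_cast
    linarith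
  exact Nat.cast_le.1 h10

open scoped Classical in
/-- The algorithm succeeds with probability at least `0.9`. -/
theorem denoise_success {η₀ : ℝ} (hη₀ : (η : ℝ) ≤ η₀) :
    0.9 ≤ noiseMean p fun σ =>
      if ∃ α : Fin n → Fin k, denoise (encodeInput G φ k η σ) = encodeLabeling α ∧
        (misclassified ι α : ℝ) ≤ 2 * 10 ^ 8 * η₀ ^ 3 * (d * δ * ε / (φ : ℝ) ^ 5) * n
      then 1 else 0 := by
  obtain ⟨y, b, Z, hy, hb, hZ, hb01, hgood⟩ := h.exists_badSet
  have hφ := h.phi_pos_real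
  have hφ1 := h.phi_lt_one_real
  have hη := h.one_le_eta_real
  have hε := h.eps_pos
  have hδ := h.delta_pos
  have hd := h.d_pos
  have hn : (0 : ℝ) < n := by have := h.three_le_n; exact_mod_cast (by omega : 0 < n)
  set W := Z ∪ boundaryHull G φ d ι Z with hW
  set γ : ℝ := 2 * 10 ^ 8 * η₀ ^ 3 * (d * δ * ε / (φ : ℝ) ^ 5) with hγ
  have hη00 : 0 < η₀ := by linarith
  have hγ0 : 0 < γ := by positivity
  set X : (Fin n → Fin k) → ℝ := fun σ =>
    3 * ((differSet σ ι ∩ Z).card : ℝ) + ((differSet σ ι ∩ W).card : ℝ) +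
      ∑ w ∈ W, ∑ l ∈ Finset.range n, ∑ L ∈ paths G w (l + 1),
        if ∀ v ∈ L, v ∈ differSet σ ι then (1 : ℝ) else 0 with hX
  have hX0 : ∀ σ, 0 ≤ X σ := by
    intro σ
    simp only [hX]
    refine add_nonneg (by positivity) (Finset.sum_nonneg fun w _ => Finset.sum_nonneg fun l _ =>
      Finset.sum_nonneg fun L _ => ?_)
    split_ifs <;> norm_num
  have hZW : (Z.card : ℝ) ≤ W.card := by
    exact_mod_cast Finset.card_le_card Finset.subset_union_left
  -- From `φ |W| ≤ 5 |Z| + 2 ε n` and the bound on `|Z|`: `840002 = 5 * 168000 + 2`.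
  have hWcard : (W.card : ℝ) ≤ 840002 * (η : ℝ) ^ 3 * (n * ε) / (φ : ℝ) ^ 3 := by
    have h1 := h.card_boundaryHull_le Z
    have h2 : (W.card : ℝ) ≤ Z.card + (boundaryHull G φ d ι Z).card := by
      exact_mod_cast Finset.card_union_le _ _
    rw [le_div_iff₀ (by positivity)]
    have h3 : (φ : ℝ) * W.card ≤ 5 * Z.card + 2 * (n * ε) := by
      have := mul_le_mul_of_nonneg_left h2 hφ.le
      have := mul_le_of_le_one_left (Nat.cast_nonneg Z.card : (0 : ℝ) ≤ Z.card) hφ1.le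
      linarith
    have h4 := mul_le_mul_of_nonneg_right h3 (sq_nonneg (φ : ℝ))
    have h5 : (n * ε) * (φ : ℝ) ^ 2 ≤ (η : ℝ) ^ 3 * (n * ε) := by
      rw [mul_comm]
      refine mul_le_mul_of_nonneg_right ?_ (by positivity)
      exact (pow_le_one₀ hφ.le hφ1.le).trans (one_le_pow₀ hη)
    linarith
  -- The three parts of `X` contribute 3, 1 and 2 times `d δ |W|`. The target leaves room for one
  -- more factor `1 / φ`.
  have hmean : noiseMean p X ≤ φ * (γ * n) / 20 := by
    have h1 : noiseMean p X ≤ 3 * (δ * Z.card) + δ * W.card + 2 * (d * δ) * W.card := by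
      simp only [hX]
      rw [noiseMean_add, noiseMean_add, noiseMean_const_mul]
      exact add_le_add (add_le_add (mul_le_mul_of_nonneg_left
        (noiseMean_card_inter_le h.label_law h.label_correct Z) (by norm_num))
        (noiseMean_card_inter_le h.label_law h.label_correct W))
        (noiseMean_reached_le h.sum_adjInd h.label_law hδ.le h.label_correct h.delta_d W)
    have hd1 : (1 : ℝ) ≤ d := by
      have := h.three_le_d
      exact_mod_cast (by omega : 1 ≤ d)
    have h2 : δ * Z.card ≤ d * δ * W.card := by
      refine mul_le_mul ?_ hZW (by positivity) (by positivity)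
      exact le_mul_of_one_le_left hδ.le hd1
    have h3 : δ * W.card ≤ d * δ * W.card :=
      mul_le_mul_of_nonneg_right (le_mul_of_one_le_left hδ.le hd1) (by positivity)
    have h4 : noiseMean p X ≤ 6 * (d * δ) * (840002 * (η : ℝ) ^ 3 * (n * ε) / (φ : ℝ) ^ 3) := by
      have := mul_le_mul_of_nonneg_left hWcard (by positivity : 0 ≤ 6 * (d * δ))
      linarith
    refine h4.trans ?_
    have h5 : (φ : ℝ) * (γ * n) / 20 =
        6 * (d * δ) * (10 ^ 7 / 6 * η₀ ^ 3 * (n * ε) / (φ : ℝ) ^ 4) := by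
      rw [hγ]
      field_simp
      ring
    rw [h5]
    have h6 : (φ : ℝ) ^ 4 ≤ (φ : ℝ) ^ 3 := pow_le_pow_of_le_one hφ.le hφ1.le (by norm_num)
    have h7 : (η : ℝ) ^ 3 ≤ η₀ ^ 3 := pow_le_pow_left₀ (by linarith) hη₀ 3
    refine mul_le_mul_of_nonneg_left ?_ (by positivity)
    gcongr
    norm_num
  -- Union bound and Markov's inequality in pointwise form: a failure forces a crowded cluster or `X
  -- σ ≥ φ γ n`.
  have hpt : ∀ σ : Fin n → Fin k, (1 : ℝ) ≤
      (if ∃ α : Fin n → Fin k, denoise (encodeInput G φ k η σ) = encodeLabeling α ∧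
        (misclassified ι α : ℝ) ≤ γ * n then 1 else 0) +
      ((∑ i, if 48 * (cluster ι i).card < 100 * (differSet σ ι ∩ cluster ι i).card
        then 1 else 0) + 1 / (φ * (γ * n)) * X σ) := by
    intro σ
    have hX' : 0 ≤ 1 / (φ * (γ * n)) * X σ := mul_nonneg (by positivity) (hX0 σ)
    have hS : ∀ i, (0 : ℝ) ≤ if 48 * (cluster ι i).card < 100 * (differSet σ ι ∩ cluster ι i).card
        then 1 else 0 := fun i => by split_ifs <;> norm_num
    have hS' := Finset.sum_nonneg fun i (_ : i ∈ Finset.univ) => hS i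
    split_ifs with hP
    · linarith
    · by_cases hcr : ∃ i, 48 * (cluster ι i).card < 100 * (differSet σ ι ∩ cluster ι i).card
      · obtain ⟨i, hi⟩ := hcr
        have h1 := Finset.single_le_sum (fun i _ => hS i) (Finset.mem_univ i)
        rw [if_pos hi] at h1
        linarith
      · push Not at hcr
        obtain ⟨hat, hhat⟩ := exists_majorityLabels (G := G) (φ := φ) (η := η) σ
        have hcorr : ∀ u ∉ Z, hat u = ι u := fun u hu =>
          majority_correct hhat (hy σ) (hb σ) hb01 (hgood u hu) (hcr _)
        have h1 := h.misclassified_le (σ := σ) hcorr (h.two_mul_card_le hZ)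
        have h2 := card_reached_le (G := G) W (differSet σ ι)
        have h3 : (φ : ℝ) * misclassified ι (outLabel G φ σ hat) ≤ X σ := by
          refine h1.trans ?_
          simp only [hX]
          exact add_le_add le_rfl h2
        have h4 : γ * n < misclassified ι (outLabel G φ σ hat) := by
          by_contra hc
          exact hP ⟨_, denoise_eq hhat, not_lt.1 hc⟩
        have h5 : 1 ≤ 1 / (φ * (γ * n)) * X σ := by
          rw [one_div, inv_mul_eq_div, one_le_div (by positivity)]
          exact (mul_le_mul_of_nonneg_left h4.le hφ.le).trans h3
        linarith
  have htot := noiseMean_mono (fun u i => (h.label_law u).1 i) hpt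
  rw [noiseMean_one h.label_law, noiseMean_add, noiseMean_add, noiseMean_const_mul] at htot
  have h1 := h.noiseMean_crowded_le
  have h2 : 1 / (φ * (γ * n)) * noiseMean p X ≤ 1 / 20 := by
    refine (mul_le_mul_of_nonneg_left hmean (by positivity)).trans (le_of_eq ?_)
    field_simp
  rw [show (0.9 : ℝ) = 9 / 10 by norm_num]
  linarith

end Setting

end Success

end NoisyClustering

/-! ### The main theorem -/

theorem mainTheorem2 :
    ∃ A : NoisyClustering.RandAlg NoisyClustering.inputTy (.list .int),
      (∃ T : Polynomial ℕ,
        ∀ (n k : ℕ) (G : SimpleGraph (Fin n)) (φ η : ℚ) (σ : Fin n → Fin k)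
          (r : Fin (A.coins (NoisyClustering.encodeInput G φ k η σ)) → Bool),
          A.time (NoisyClustering.encodeInput G φ k η σ) r ≤
              T.eval (NoisyClustering.inputTy.size (NoisyClustering.encodeInput G φ k η σ)) ∧
            ∃ α : Fin n → Fin k,
              A.output (NoisyClustering.encodeInput G φ k η σ) r =
                NoisyClustering.encodeLabeling α) ∧
      ∀ η₀ : ℝ, ∃ C : ℝ,
        ∀ (n d k : ℕ) (G : SimpleGraph (Fin n)) (φ η : ℚ) (ε δ : ℝ) (ι : Fin n → Fin k)
          (p : Fin n → Fin k → ℝ),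
          NoisyClustering.Setting (d := d) G φ η ε δ ι p → (η : ℝ) ≤ η₀ →
          0.9 ≤ NoisyClustering.successProb A G φ η ι p (C * (d * δ * ε / (φ : ℝ) ^ 5)) := by
  obtain ⟨q, hq, T, hT⟩ := NoisyClustering.PT.denoise.comp
    (NoisyClustering.PT.fst (a := NoisyClustering.inputTy) (b := .list .int))
  have hcoins : ∀ x, (NoisyClustering.RandAlg.mk q 0).coins x = 0 := fun x => by
    simp [NoisyClustering.RandAlg.coins]
  have hout : ∀ x r, (NoisyClustering.RandAlg.mk q 0).output x r = NoisyClustering.denoise x :=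
    fun x r => hq _
  -- The tape polynomial is 0. The empty list of coins and the pairing add 2 to the size of the
  -- input.
  refine ⟨⟨q, 0⟩, ⟨T.comp (Polynomial.X + 2), ?_⟩, fun η₀ => ⟨2 * 10 ^ 8 * η₀ ^ 3, ?_⟩⟩
  · intro n k G φ η σ r
    constructor
    · refine (hT _).trans ?_
      rw [Polynomial.eval_comp]
      refine NoisyClustering.natPoly_mono T ?_
      have hr : (List.ofFn fun i => if r i then (1 : ℤ) else 0) = [] := by
        rw [← List.length_eq_zero_iff, List.length_ofFn]
        exact hcoins _
      unfold NoisyClustering.RandAlg.withCoins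
      rw [hr]
      simp [NoisyClustering.Ty.size]
    · obtain ⟨hat, hhat⟩ := NoisyClustering.exists_majorityLabels (G := G) (φ := φ) (η := η) σ
      exact ⟨_, (hout _ r).trans (NoisyClustering.denoise_eq hhat)⟩
  · intro n d k G φ η ε δ ι p h hη
    refine (h.denoise_success hη).trans (le_of_eq ?_)
    refine Finset.sum_congr rfl fun σ _ => ?_
    congr 1
    -- For a deterministic algorithm the probability over the coins is an indicator.
    unfold NoisyClustering.RandAlg.prob
    simp only [hout]
    split_ifs with hP
    · rw [Finset.filter_true_of_mem fun _ _ => hP, Finset.card_univ, Fintype.card_fun,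
        Fintype.card_bool, Fintype.card_fin]
      push_cast
      exact (div_self (by positivity)).symm
    · rw [Finset.filter_false_of_mem fun _ _ => hP, Finset.card_empty, Nat.cast_zero, zero_div]
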